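/- **Setting.** Let $a>0$, let $\mathcal V$ be a Hermitian vector bundle of rank $N$ over the circle $S^1$ of circumference $2\pi a$ with a metric connection $D=\partial_x$; in a parallel frame its sections are the functions $f:\mathbb R\to\mathbb C^N$ with $f(x+2\pi a)=g\,f(x)$ for a unitary matrix $g$ (periodic functions if $g=1$). Let $Q$ be a smooth Hermitian endomorphism of $\mathcal V$ (so $Q(x+2\pi a)=g\,Q(x)\,g^{-1}$), and let $U(t;x,x')$ be the heat kernel of $L=-D^2+Q$: for $t>0$ it is $C^1$ in $t$ and $C^2$ in $x$ (with these derivatives jointly continuous), it satisfies $(\partial_t+L)U=0$, and $\int_{S^1} U(t;x,x')f(x')\,dx'\to f(x)$ uniformly in $x$ as $t\to0^+$, for every smooth section $f$. The diagonal heat kernel coefficients $[a_k](x)$ are the coefficients of the asymptotic expansion, as $t\to 0^+$, $$U(t;x,x)\sim(4\pi t)^{-1/2}\sum_{k\ge0}\frac{(-t)^k}{k!}[a_k](x).$$ Let $\mathcal P=\mathbb C\langle Q,Q',Q'',\dots\rangle$ be the free associative unital algebra of noncommutative differential polynomials, with the derivation $D$, $DQ^{(i)}=Q^{(i+1)}$.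 For $p\in\mathcal P$ that is a total derivative, $D^{-1}p$ denotes the unique $q\in\mathcal P$ with $Dq=p$ and without constant term. Put $\mathrm{Ad}_Qp=Qp-pQ$ and $$E=D^3-2QD-2DQ+\mathrm{Ad}_QD+D\,\mathrm{Ad}_Q+\mathrm{Ad}_QD^{-1}\mathrm{Ad}_Q,\qquad A=-D^{-1}E,$$ where $Q$ alone stands for left multiplication by $Q$. **Theorem.** The coefficients $[a_k]$ are given by universal differential polynomials: there are $\alpha_k\in\mathcal P$, $k\ge0$, independent of $a,N,\mathcal V,Q$, such that the expansion above holds at every $x\in\mathbb R$ for all $a,N,\mathcal V,Q$ as above, precisely with the coefficients $[a_k](x)=\alpha_k(Q(x),Q'(x),Q''(x),\dots)$. They satisfy $\alpha_0=1$, and for every $k\ge1$: 1. $\mathrm{Ad}_Q\alpha_{k-1}$ and $E\alpha_{k-1}$ are total derivatives with a unique primitive without constant term, and $$D\alpha_k=-\frac{k}{2(2k-1)}E\alpha_{k-1},\qquad \alpha_k=\frac{k}{2(2k-1)}A\alpha_{k-1}.$$ 2. $\mathrm{Ad}_QA^{k-1}Q$ and $EA^{k-1}Q$ are likewise total derivatives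 with a unique primitive without constant term, and $$\alpha_k=\frac{k!\,(k-1)!}{(2k-1)!}A^{k-1}Q.$$ 3. For every such $a,N,\mathcal V,Q$ the functions $[a_k]$, $[a_{k-1}]$ and $w=(D^{-1}\mathrm{Ad}_Q\alpha_{k-1})(Q,Q',\dots)$ of $x$ (differential polynomials evaluated at the given $Q$) are smooth, $w'=[Q,[a_{k-1}]]$ (commutator), and with $f=[a_{k-1}]$ $$\frac{d}{dx}[a_k]=-\frac{k}{2(2k-1)}\Big(f'''-2Qf'-2(Qf)'+[Q,f']+[Q,f]'+[Q,w]\Big).$$ -/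

import Mathlib

open Set Filter Topology Asymptotics
open scoped ContDiff Interval Nat

/-! ### Noncommutative differential polynomials -/

/-- Noncommutative differential polynomials in one indeterminate `Q`: the free associative unital
algebra on the symbols `Q⁽⁰⁾ = Q, Q⁽¹⁾, Q⁽²⁾, …`. -/
abbrev DiffPoly : Type := FreeAlgebra ℂ ℕ

namespace DiffPoly

/-- The symbol `Q⁽ⁱ⁾`. -/
noncomputable def jet (i : ℕ) : DiffPoly := FreeAlgebra.ι ℂ i

/-- The indeterminate `Q = Q⁽⁰⁾`. -/
noncomputable def Q : DiffPoly := jet 0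

/-- The homomorphism `p ↦ p + ε D p` into the dual numbers over `DiffPoly`. -/
noncomputable def dualHom : DiffPoly →ₐ[ℂ] TrivSqZeroExt DiffPoly DiffPoly :=
  FreeAlgebra.lift ℂ fun i => TrivSqZeroExt.inl (jet i) + TrivSqZeroExt.inr (jet (i + 1))

/-- The total derivative: the derivation of `DiffPoly` with `D Q⁽ⁱ⁾ = Q⁽ⁱ⁺¹⁾`. -/
noncomputable def D (p : DiffPoly) : DiffPoly := (dualHom p).snd

theorem dualHom_fst (p : DiffPoly) : (dualHom p).fst = p := by
  have h : (TrivSqZeroExt.fstHom ℂ DiffPoly DiffPoly).comp dualHom = AlgHom.id ℂ DiffPoly := by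
    apply FreeAlgebra.hom_ext
    funext i
    simp [dualHom, jet]
  exact congrArg (fun f : DiffPoly →ₐ[ℂ] DiffPoly => f p) h

theorem D_jet (i : ℕ) : D (jet i) = jet (i + 1) := by
  simp [D, dualHom, jet]

theorem D_add (p q : DiffPoly) : D (p + q) = D p + D q := by
  simp [D]

theorem D_smul (c : ℂ) (p : DiffPoly) : D (c • p) = c • D p := by
  simp [D]

theorem D_one : D 1 = 0 := by
  simp [D]

theorem D_mul (p q : DiffPoly) : D (p * q) = D p * q + p * D q := by
  simp [D, dualHom_fst, add_comm]

/-- The constant term of a differential polynomial. -/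
noncomputable def constTerm : DiffPoly →ₐ[ℂ] ℂ := FreeAlgebra.lift ℂ fun _ => 0

/-- `q` is the normalised primitive of `p`: `D q = p`, and `q` has no constant term. -/
def IsPrimitive (p q : DiffPoly) : Prop := D q = p ∧ constTerm q = 0

open Classical in
/-- `D⁻¹ p`, the normalised primitive of `p` (and `0` if `p` is not a total derivative). -/
noncomputable def Dinv (p : DiffPoly) : DiffPoly :=
  if h : ∃ q, IsPrimitive p q then h.choose else 0

end DiffPoly

/-- The expression `D³f - 2QDf - 2D(Qf) + [Q, Df] + D[Q, f] + [Q, w]`, in which `w` stands for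
`D⁻¹[Q, f]`; it is used for differential polynomials and for functions. -/
def opE {R : Type*} [Ring R] (D : R → R) (Q f w : R) : R :=
  D (D (D f)) - 2 * (Q * D f) - 2 * D (Q * f) + ⁅Q, D f⁆ + D ⁅Q, f⁆ + ⁅Q, w⁆

namespace DiffPoly

/-- The operator `E = D³ - 2QD - 2DQ + Ad_Q D + D Ad_Q + Ad_Q D⁻¹ Ad_Q`. -/
noncomputable def E (p : DiffPoly) : DiffPoly := opE D Q p (Dinv ⁅Q, p⁆)

/-- The operator `A = -D⁻¹ E`. -/
noncomputable def A (p : DiffPoly) : DiffPoly := -Dinv (E p)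

/-- Both inverse derivatives that occur in `A p = -D⁻¹ E p` exist and are unique. -/
def InDomainA (p : DiffPoly) : Prop :=
  (∃! w, IsPrimitive ⁅Q, p⁆ w) ∧ ∃! v, IsPrimitive (E p) v

end DiffPoly

/-! ### The operator `L = -D² + Q` over the circle -/

/-- The Hermitian fibre `ℂᴺ`. -/
abbrev Fibre (N : ℕ) : Type := EuclideanSpace ℂ (Fin N)

/-- Endomorphisms of the fibre. -/
abbrev EndFibre (N : ℕ) : Type := Fibre N →L[ℂ] Fibre N

/-- The circle has circumference `2πa`. In a parallel frame of a Hermitian bundle of rank `N` with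
holonomy `g`, smooth sections are the smooth `f : ℝ → ℂᴺ` with `f (x + 2πa) = g (f x)`
(for `g = 1`: the periodic functions). -/
def IsSmoothSection (a : ℝ) {N : ℕ} (g : EndFibre N) (f : ℝ → Fibre N) : Prop :=
  ContDiff ℝ ∞ f ∧ ∀ x, f (x + 2 * Real.pi * a) = g (f x)

/-- `Q` is a smooth Hermitian endomorphism of the bundle. -/
structure IsPotential (a : ℝ) {N : ℕ} (g : EndFibre N) (Q : ℝ → EndFibre N) : Prop where
  smooth : ContDiff ℝ ∞ Q
  selfAdjoint : ∀ x, IsSelfAdjoint (Q x)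
  equivariant : ∀ x, Q (x + 2 * Real.pi * a) = g * Q x * star g

/-- `U t x x'` (`t > 0`) is the heat kernel of `L = -∂ₓ² + Q`: it is `C¹` in `t` and `C²` in `x`,
it is a section in `x` and a dual section in `x'`, it solves `(∂ₜ + L) U = 0`, and
`U t x x' → δ(x - x')` as `t → 0+`, that is, `∫ U t x x' f(x') dx' → f(x)` uniformly in `x` for
every smooth section `f`. -/
structure IsHeatKernel (a : ℝ) {N : ℕ} (g : EndFibre N) (Q : ℝ → EndFibre N)
    (U : ℝ → ℝ → ℝ → EndFibre N) : Prop where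
  continuousOn : ContinuousOn (fun p : ℝ × ℝ × ℝ => U p.1 p.2.1 p.2.2) (Ioi 0 ×ˢ univ)
  differentiable_time : ∀ t, 0 < t → ∀ x x', DifferentiableAt ℝ (fun s => U s x x') t
  continuousOn_time : ContinuousOn
    (fun p : ℝ × ℝ × ℝ => deriv (fun s => U s p.2.1 p.2.2) p.1) (Ioi 0 ×ˢ univ)
  contDiff_space : ∀ t, 0 < t → ∀ x', ContDiff ℝ 2 (fun x => U t x x')
  continuousOn_space : ContinuousOn
    (fun p : ℝ × ℝ × ℝ => deriv (fun x => U p.1 x p.2.2) p.2.1) (Ioi 0 ×ˢ univ)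
  continuousOn_space_two : ContinuousOn
    (fun p : ℝ × ℝ × ℝ => iteratedDeriv 2 (fun x => U p.1 x p.2.2) p.2.1) (Ioi 0 ×ˢ univ)
  section_left : ∀ t, 0 < t → ∀ x x', U t (x + 2 * Real.pi * a) x' = g * U t x x'
  section_right : ∀ t, 0 < t → ∀ x x', U t x (x' + 2 * Real.pi * a) = U t x x' * star g
  heat_equation : ∀ t, 0 < t → ∀ x x',
    deriv (fun s => U s x x') t + (-iteratedDeriv 2 (fun y => U t y x') x + Q x * U t x x') = 0
  initial : ∀ f : ℝ → Fibre N, IsSmoothSection a g f →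
    TendstoUniformly (fun t x => ∫ x' in (0 : ℝ)..(2 * Real.pi * a), U t x x' (f x')) f (𝓝[>] 0)

/-- `c 0, c 1, …` are the diagonal heat kernel coefficients at `x`:
`U t x x ∼ (4πt)^(-1/2) ∑ₖ (-t)ᵏ / k! · c k` as `t → 0+`, where the remainder after `n` terms is
`O(t^(n - 1/2))` for every `n`. -/
def HasDiagonalExpansion {N : ℕ} (U : ℝ → ℝ → ℝ → EndFibre N) (x : ℝ) (c : ℕ → EndFibre N) :
    Prop :=
  ∀ n : ℕ, (fun t : ℝ => U t x x - ((4 * Real.pi * t) ^ (-(1 / 2 : ℝ))) •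
      ∑ k ∈ Finset.range n, ((-t) ^ k / (k ! : ℝ)) • c k)
    =O[𝓝[>] 0] fun t : ℝ => t ^ ((n : ℝ) - 1 / 2)

/-- The value of a differential polynomial at the function `Q` and the point `x`:
`Q⁽ⁱ⁾` is replaced by the `i`-th derivative of the function. -/
noncomputable def DiffPoly.evalAt {N : ℕ} (Q : ℝ → EndFibre N) (x : ℝ) :
    DiffPoly →ₐ[ℂ] EndFibre N :=
  FreeAlgebra.lift ℂ fun i => iteratedDeriv i Q x

/-! Insert `(4πt)^(-1/2) exp(-(x-x')²/4t) Σ (-t)ᵏ/k! a_k(x,x')` into the heat equation in `x`. With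
`σ = x - x'` this gives the transport equations `(k + σ∂ₓ) a_k = k L a_{k-1}`, `L = -∂ₓ² + Q(x)`.
Since `σ∂ₓ` multiplies the `n`-th Taylor coefficient in `σ` by `n`, they have a unique solution with
`a_0 = 1`, whose Taylor coefficients on the diagonal are universal differential polynomials `offDiag
k n`.

Algebra. The same `a_k` solve the transport equations in `x'`: `(k - σ∂ₓ') a_k = k R a_{k-1}`, where
`R f = -∂ₓ'² f + f Q(x')` (`rightDefect_eq_zero`). Comparing both equations at order `σ⁰` shows that
`[Q, a_k]` is a total derivative (`isPrimitive_adPrimitive`). Comparing them at order `σ¹` and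
eliminating the higher off-diagonal coefficients gives the recursion (`E_diagCoeff`), which
integrates because its left side is `D` of the next coefficient. The closed formula is the iteration
from `a_1 = Q`. Primitives are unique because `D` kills only constants (`eq_zero_of_D_eq_zero`).

Analysis. Truncating and cutting off the formal series near a point gives a parametrix `H` whose
error in the heat equation is `O(tⁿ)` (`exists_parametrix_residual`). Let `U` be any heat kernel.
Tested against a smooth bump, `U - H` has zero initial values, so a maximum principle for
vector-valued functions bounds it (`norm_le_of_heat_inequality`). The bound does not depend on the
bump, which can therefore be shrunk to a point (`norm_diagonal_compare_le`). Thus `U` has the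
expansion of `H` on the diagonal, and expansion coefficients are unique. -/

namespace DiffPoly

/-! ### Derivations of the free algebra and uniqueness of primitives -/

/-- The homomorphism `p ↦ p + ε δ p`, where `δ` is the derivation with `δ Q⁽ⁱ⁾ = f i`. -/
noncomputable def dualHomOf (f : ℕ → DiffPoly) : DiffPoly →ₐ[ℂ] TrivSqZeroExt DiffPoly DiffPoly :=
  FreeAlgebra.lift ℂ fun i => TrivSqZeroExt.inl (jet i) + TrivSqZeroExt.inr (f i)

/-- The derivation `δ` of `DiffPoly` with `δ Q⁽ⁱ⁾ = f i`. -/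
noncomputable def derivationOf (f : ℕ → DiffPoly) : DiffPoly →ₗ[ℂ] DiffPoly :=
  (TrivSqZeroExt.sndHom DiffPoly DiffPoly).restrictScalars ℂ ∘ₗ (dualHomOf f).toLinearMap

theorem dualHomOf_fst (f : ℕ → DiffPoly) (p : DiffPoly) : (dualHomOf f p).fst = p := by
  have h : (TrivSqZeroExt.fstHom ℂ DiffPoly DiffPoly).comp (dualHomOf f) = AlgHom.id ℂ DiffPoly := by
    apply FreeAlgebra.hom_ext
    funext i
    simp [dualHomOf, jet]
  exact congrArg (fun f : DiffPoly →ₐ[ℂ] DiffPoly => f p) h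

theorem derivationOf_apply (f : ℕ → DiffPoly) (p : DiffPoly) :
    derivationOf f p = (dualHomOf f p).snd := rfl

theorem derivationOf_jet (f : ℕ → DiffPoly) (i : ℕ) : derivationOf f (jet i) = f i := by
  simp [derivationOf_apply, dualHomOf, jet]

theorem derivationOf_one (f : ℕ → DiffPoly) : derivationOf f 1 = 0 := by
  simp [derivationOf_apply]

theorem derivationOf_mul (f : ℕ → DiffPoly) (p q : DiffPoly) :
    derivationOf f (p * q) = derivationOf f p * q + p * derivationOf f q := by
  simp [derivationOf_apply, dualHomOf_fst, add_comm]

theorem derivationOf_algebraMap (f : ℕ → DiffPoly) (c : ℂ) :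
    derivationOf f (algebraMap ℂ DiffPoly c) = 0 := by
  rw [Algebra.algebraMap_eq_smul_one, map_smul, derivationOf_one, smul_zero]

/-- The total derivative as a linear map. -/
noncomputable def DLin : DiffPoly →ₗ[ℂ] DiffPoly := derivationOf fun i => jet (i + 1)

theorem DLin_apply (p : DiffPoly) : DLin p = D p := rfl

theorem D_zero : D 0 = 0 := map_zero DLin
theorem D_sub (p q : DiffPoly) : D (p - q) = D p - D q := map_sub DLin p q
theorem D_sum {ι : Type*} (s : Finset ι) (f : ι → DiffPoly) :
    D (∑ i ∈ s, f i) = ∑ i ∈ s, D (f i) := map_sum DLin f s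

theorem induction_jet {P : DiffPoly → Prop} (hc : ∀ c, P (algebraMap ℂ DiffPoly c))
    (hj : ∀ i, P (jet i)) (hm : ∀ p q, P p → P q → P (p * q))
    (ha : ∀ p q, P p → P q → P (p + q)) (p : DiffPoly) : P p :=
  FreeAlgebra.induction ℂ ℕ hc hj hm ha p

theorem constTerm_jet (i : ℕ) : constTerm (jet i) = 0 := by
  simp [constTerm, jet]

theorem constTerm_derivationOf {f : ℕ → DiffPoly} (hf : ∀ i, constTerm (f i) = 0)
    (p : DiffPoly) : constTerm (derivationOf f p) = 0 := by
  induction p using induction_jet with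
  | hc c => simp [derivationOf_algebraMap]
  | hj i => rw [derivationOf_jet, hf]
  | hm p q hp hq => simp [derivationOf_mul, hp, hq]
  | ha p q hp hq => simp [hp, hq]

theorem constTerm_D (p : DiffPoly) : constTerm (D p) = 0 :=
  constTerm_derivationOf (fun i => constTerm_jet (i + 1)) p

/-- The derivation that multiplies a word by its length. -/
noncomputable def lengthDer : DiffPoly →ₗ[ℂ] DiffPoly := derivationOf jet

/-- The lowering derivation `Q⁽ⁱ⁾ ↦ i Q⁽ⁱ⁻¹⁾`. -/
noncomputable def lowerDer : DiffPoly →ₗ[ℂ] DiffPoly :=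
  derivationOf fun i => (i : ℂ) • jet (i - 1)

/-- The commutator of two derivations is a derivation, so `[lowerDer, D] = lengthDer` only has to be
seen on the generators, where `(i+1) - i = 1`. This Heisenberg-type relation drives the proof that
`D` kills only constants. -/
theorem lowerDer_D (p : DiffPoly) : lowerDer (D p) = D (lowerDer p) + lengthDer p := by
  simp only [← DLin_apply]
  induction p using induction_jet with
  | hc c => simp [DLin, lowerDer, lengthDer, derivationOf_algebraMap]
  | hj i =>
    simp only [DLin, lowerDer, lengthDer, derivationOf_jet, map_smul]
    cases i with
    | zero => simp
    | succ i => simp only [Nat.add_sub_cancel]; push_cast; module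
  | hm p q hp hq =>
    simp only [DLin, lowerDer, lengthDer, derivationOf_mul, map_add] at *
    rw [hp, hq]; noncomm_ring
  | ha p q hp hq => simp only [map_add, hp, hq]; abel

theorem lowerDer_lengthDer (p : DiffPoly) : lowerDer (lengthDer p) = lengthDer (lowerDer p) := by
  induction p using induction_jet with
  | hc c => simp [lowerDer, lengthDer, derivationOf_algebraMap]
  | hj i => simp only [lowerDer, lengthDer, derivationOf_jet, map_smul]
  | hm p q hp hq =>
    simp only [lowerDer, lengthDer, derivationOf_mul, map_add] at *
    rw [hp, hq]; abel
  | ha p q hp hq => simp only [map_add, hp, hq]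

theorem lowerDer_pow_D (j : ℕ) (p : DiffPoly) :
    (lowerDer ^ (j + 1)) (D p) =
      D ((lowerDer ^ (j + 1)) p) + ((j : ℂ) + 1) • lengthDer ((lowerDer ^ j) p) := by
  induction j with
  | zero => simp [lowerDer_D]
  | succ j ih =>
    rw [pow_succ', Module.End.mul_apply, ih, map_add, lowerDer_D, map_smul, lowerDer_lengthDer]
    rw [← Module.End.mul_apply lowerDer (lowerDer ^ j), ← pow_succ', ← Module.End.mul_apply lowerDer]
    push_cast
    module

/-- By Leibniz each application of `lowerDer` falls on one of the factors, so one of them is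
exhausted in every term. -/
theorem lowerDer_pow_mul (n : ℕ) : ∀ (j k : ℕ) (p q : DiffPoly), j + k ≤ n →
    (lowerDer ^ j) p = 0 → (lowerDer ^ k) q = 0 → (lowerDer ^ n) (p * q) = 0 := by
  induction n with
  | zero =>
    intro j k p q h hp _
    obtain rfl : j = 0 := by omega
    simp_all
  | succ n ih =>
    intro j k p q h hp hq
    rcases j with _ | j
    · simp_all
    rcases k with _ | k
    · simp_all
    have h1 : lowerDer (p * q) = lowerDer p * q + p * lowerDer q := derivationOf_mul _ p q
    rw [pow_succ, Module.End.mul_apply, h1, map_add]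
    rw [pow_succ, Module.End.mul_apply] at hp hq
    rw [ih j (k + 1) _ q (by omega) hp (by rw [pow_succ, Module.End.mul_apply, hq]),
      ih (j + 1) k p _ (by omega) (by rw [pow_succ, Module.End.mul_apply, hp]) hq, add_zero]

theorem lowerDer_pow_eq_zero_of_le {j k : ℕ} (h : j ≤ k) {p : DiffPoly}
    (hp : (lowerDer ^ j) p = 0) : (lowerDer ^ k) p = 0 := by
  obtain ⟨m, rfl⟩ := Nat.exists_eq_add_of_le' h
  rw [pow_add, Module.End.mul_apply, hp, map_zero]

theorem exists_lowerDer_pow_eq_zero (p : DiffPoly) : ∃ n, (lowerDer ^ n) p = 0 := by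
  induction p using induction_jet with
  | hc c => exact ⟨1, by simp [lowerDer, derivationOf_algebraMap]⟩
  | hj i =>
    induction i with
    | zero => exact ⟨1, by simp [lowerDer, derivationOf_jet]⟩
    | succ i ih =>
      obtain ⟨n, hn⟩ := ih
      refine ⟨n + 1, ?_⟩
      rw [pow_succ, Module.End.mul_apply, lowerDer, derivationOf_jet, ← lowerDer, map_smul,
        Nat.add_sub_cancel, hn, smul_zero]
  | hm p q hp hq =>
    obtain ⟨n, hn⟩ := hp
    obtain ⟨m, hm⟩ := hq
    exact ⟨n + m, lowerDer_pow_mul _ n m p q le_rfl hn hm⟩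
  | ha p q hp hq =>
    obtain ⟨n, hn⟩ := hp
    obtain ⟨m, hm⟩ := hq
    refine ⟨max n m, ?_⟩
    rw [map_add, lowerDer_pow_eq_zero_of_le (le_max_left _ _) hn,
      lowerDer_pow_eq_zero_of_le (le_max_right _ _) hm, add_zero]

theorem basisFreeMonoid_cons (i : ℕ) (w : FreeMonoid ℕ) :
    FreeAlgebra.basisFreeMonoid ℂ ℕ (FreeMonoid.of i * w) =
      jet i * FreeAlgebra.basisFreeMonoid ℂ ℕ w := by
  simp [FreeAlgebra.basisFreeMonoid, FreeAlgebra.equivMonoidAlgebraFreeMonoid, jet]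

theorem basisFreeMonoid_one : FreeAlgebra.basisFreeMonoid ℂ ℕ 1 = 1 := by
  simp [FreeAlgebra.basisFreeMonoid, FreeAlgebra.equivMonoidAlgebraFreeMonoid]

theorem lengthDer_basis (w : FreeMonoid ℕ) :
    lengthDer (FreeAlgebra.basisFreeMonoid ℂ ℕ w) =
      (w.length : ℂ) • FreeAlgebra.basisFreeMonoid ℂ ℕ w := by
  induction w using FreeMonoid.inductionOn' with
  | one => simp [basisFreeMonoid_one, lengthDer, derivationOf_one]
  | of_mul i w ih =>
    rw [basisFreeMonoid_cons, lengthDer, derivationOf_mul, derivationOf_jet, ← lengthDer, ih]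
    simp only [FreeMonoid.length_mul, FreeMonoid.length_of, mul_smul_comm]
    push_cast
    module

/-- Words form a basis of eigenvectors of `lengthDer` with their lengths as eigenvalues, so in
characteristic zero only the empty word survives in the kernel. -/
theorem eq_zero_of_lengthDer_eq_zero {p : DiffPoly} (h : lengthDer p = 0)
    (hc : constTerm p = 0) : p = 0 := by
  set b := FreeAlgebra.basisFreeMonoid ℂ ℕ with hb
  have h1 : ∀ w : FreeMonoid ℕ, b.coord w ∘ₗ lengthDer = (w.length : ℂ) • b.coord w := by
    intro w
    refine b.ext fun v => ?_
    simp only [LinearMap.comp_apply, hb, lengthDer_basis, map_smul, LinearMap.smul_apply,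
      Module.Basis.coord_apply, Module.Basis.repr_self]
    by_cases hvw : v = w
    · subst hvw; rfl
    · simp [hvw]
  have h2 : constTerm.toLinearMap = b.coord 1 := by
    refine b.ext fun v => ?_
    induction v using FreeMonoid.inductionOn' with
    | one =>
      rw [Module.Basis.coord_apply, Module.Basis.repr_self]
      simp [hb, basisFreeMonoid_one]
    | of_mul i w _ =>
      have hne : FreeMonoid.of i * w ≠ 1 := fun h0 => by
        simpa using congrArg FreeMonoid.length h0
      rw [Module.Basis.coord_apply, Module.Basis.repr_self, Finsupp.single_eq_of_ne hne.symm]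
      simp [hb, basisFreeMonoid_cons, constTerm_jet]
  refine b.repr.map_eq_zero_iff.1 (Finsupp.ext fun w => ?_)
  have h3 := congrArg (fun f : DiffPoly →ₗ[ℂ] ℂ => f p) (h1 w)
  simp only [LinearMap.comp_apply, h, map_zero, LinearMap.smul_apply, smul_eq_mul,
    Module.Basis.coord_apply] at h3
  rcases mul_eq_zero.1 h3.symm with h4 | h4
  · have hw : w = 1 := FreeMonoid.length_eq_zero.1 (by exact_mod_cast h4)
    subst hw
    have h5 := congrArg (fun f : DiffPoly →ₗ[ℂ] ℂ => f p) h2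
    simpa [hc] using h5.symm
  · simpa using h4

/-- `lowerDer` is locally nilpotent. If `lowerDer^(n+1) p = 0` and `D p = 0`, then `lowerDer_pow_D`
leaves `(n+1) lengthDer (lowerDer^n p) = 0`, so `lowerDer^n p` is a constant without constant term,
hence zero. Descent on `n` reaches `p` itself. -/
theorem eq_zero_of_D_eq_zero {p : DiffPoly} (h : D p = 0) (hc : constTerm p = 0) : p = 0 := by
  obtain ⟨n, hn⟩ := exists_lowerDer_pow_eq_zero p
  induction n with
  | zero => simpa using hn
  | succ n ih =>
    refine ih ?_
    have h1 := lowerDer_pow_D n p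
    rw [hn, h, map_zero, D_zero, zero_add] at h1
    have h2 : ((n : ℂ) + 1) ≠ 0 := by exact_mod_cast n.succ_ne_zero
    refine eq_zero_of_lengthDer_eq_zero ((smul_eq_zero.1 h1.symm).resolve_left h2) ?_
    -- For `n > 0` the constant term vanishes because `lowerDer` sends every generator to a multiple
    -- of a generator.
    cases n with
    | zero => simpa using hc
    | succ n =>
      rw [pow_succ', Module.End.mul_apply]
      exact constTerm_derivationOf (fun i => by simp [constTerm_jet]) _

theorem IsPrimitive.unique {p q r : DiffPoly} (hq : IsPrimitive p q) (hr : IsPrimitive p r) :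
    q = r :=
  sub_eq_zero.1 <| eq_zero_of_D_eq_zero (by rw [D_sub, hq.1, hr.1, sub_self])
    (by rw [map_sub, hq.2, hr.2, sub_self])

theorem IsPrimitive.existsUnique {p q : DiffPoly} (hq : IsPrimitive p q) :
    ∃! r, IsPrimitive p r := ⟨q, hq, fun _ hr => hr.unique hq⟩

theorem IsPrimitive.Dinv_eq {p q : DiffPoly} (hq : IsPrimitive p q) : Dinv p = q := by
  have h : ∃ q, IsPrimitive p q := ⟨q, hq⟩
  rw [Dinv, dif_pos h]
  exact h.choose_spec.unique hq

theorem IsPrimitive.smul {p q : DiffPoly} (hq : IsPrimitive p q) (c : ℂ) :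
    IsPrimitive (c • p) (c • q) := ⟨by rw [D_smul, hq.1], by rw [map_smul, hq.2, smul_zero]⟩

end DiffPoly

namespace DiffPoly

/-! ### Formal Taylor series in `x - x'` with coefficients depending on `x'` -/

/-- Formal series `∑ₙ (x - x')ⁿ / n! · s n (x')`. -/
abbrev JetSeq : Type := ℕ → DiffPoly

/-- The derivative in `x`. -/
def dLeft : JetSeq →ₗ[ℂ] JetSeq where
  toFun s n := s (n + 1)
  map_add' _ _ := rfl
  map_smul' _ _ := rfl

/-- Multiplication by `x - x'`. -/
def mulSigma : JetSeq →ₗ[ℂ] JetSeq where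
  toFun s n := (n : ℂ) • s (n - 1)
  map_add' s r := by funext n; simp
  map_smul' c s := by funext n; simp [smul_comm c]

/-- The derivative in `x'`. -/
noncomputable def dRight : JetSeq →ₗ[ℂ] JetSeq where
  toFun s n := D (s n) - s (n + 1)
  map_add' s r := by funext n; simp only [Pi.add_apply, D_add]; abel
  map_smul' c s := by funext n; simp [D_smul, smul_sub]

/-- Left multiplication by `Q(x)`. -/
noncomputable def mulLeft : JetSeq →ₗ[ℂ] JetSeq where
  toFun s n := ∑ ij ∈ Finset.HasAntidiagonal.antidiagonal n, (n.choose ij.1 : ℂ) • (jet ij.1 * s ij.2)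
  map_add' s r := by funext n; simp [mul_add, Finset.sum_add_distrib]
  map_smul' c s := by funext n; simp [Finset.smul_sum, smul_comm c]

/-- Right multiplication by `Q(x')`. -/
noncomputable def mulRight : JetSeq →ₗ[ℂ] JetSeq where
  toFun s n := s n * Q
  map_add' s r := by funext n; simp [add_mul]
  map_smul' c s := by funext n; simp

theorem dLeft_apply (s : JetSeq) (n : ℕ) : dLeft s n = s (n + 1) := rfl
theorem mulSigma_apply (s : JetSeq) (n : ℕ) : mulSigma s n = (n : ℂ) • s (n - 1) := rfl
theorem dRight_apply (s : JetSeq) (n : ℕ) : dRight s n = D (s n) - s (n + 1) := rfl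
theorem mulRight_apply (s : JetSeq) (n : ℕ) : mulRight s n = s n * Q := rfl
theorem mulLeft_apply (s : JetSeq) (n : ℕ) : mulLeft s n =
    ∑ ij ∈ Finset.HasAntidiagonal.antidiagonal n, (n.choose ij.1 : ℂ) • (jet ij.1 * s ij.2) := rfl

theorem dLeft_mulSigma (s : JetSeq) : dLeft (mulSigma s) = mulSigma (dLeft s) + s := by
  funext n
  cases n with
  | zero => simp [dLeft_apply, mulSigma_apply]
  | succ n =>
    simp only [dLeft_apply, mulSigma_apply, Pi.add_apply, Nat.add_sub_cancel]
    push_cast; module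

theorem dRight_mulSigma (s : JetSeq) : dRight (mulSigma s) = mulSigma (dRight s) - s := by
  funext n
  cases n with
  | zero => simp [dRight_apply, mulSigma_apply, D_zero]
  | succ n =>
    simp only [dRight_apply, mulSigma_apply, Pi.sub_apply, Nat.add_sub_cancel, D_smul]
    push_cast; module

theorem dRight_dLeft (s : JetSeq) : dRight (dLeft s) = dLeft (dRight s) := rfl

theorem mulRight_dLeft (s : JetSeq) : mulRight (dLeft s) = dLeft (mulRight s) := rfl

theorem mulRight_mulSigma (s : JetSeq) : mulRight (mulSigma s) = mulSigma (mulRight s) := by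
  funext n
  simp [mulRight_apply, mulSigma_apply]

theorem mulRight_mulLeft (s : JetSeq) : mulRight (mulLeft s) = mulLeft (mulRight s) := by
  funext n
  simp [mulRight_apply, mulLeft_apply, Finset.sum_mul, mul_assoc]

theorem mulLeft_mulSigma (s : JetSeq) : mulLeft (mulSigma s) = mulSigma (mulLeft s) := by
  funext n
  cases n with
  | zero => simp [mulLeft_apply, mulSigma_apply]
  | succ n =>
    simp only [mulLeft_apply, mulSigma_apply, Nat.add_sub_cancel]
    rw [Finset.Nat.antidiagonal_succ']
    simp only [Finset.sum_cons, Finset.sum_map, Function.Embedding.prodMap, Function.Embedding.coeFn_mk,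
      Prod.map, Function.Embedding.refl_apply, Nat.cast_zero, zero_smul, mul_zero, smul_zero,
      zero_add, Finset.smul_sum]
    refine Finset.sum_congr rfl fun ij hij => ?_
    rw [Finset.HasAntidiagonal.mem_antidiagonal] at hij
    have h : (n + 1).choose ij.1 * (ij.2 + 1) = (n + 1) * n.choose ij.1 := by
      have := Nat.choose_mul_succ_eq n ij.1
      rw [mul_comm (n + 1), this]
      congr 1
      omega
    have h' : ((n + 1).choose ij.1 : ℂ) * (ij.2 + 1) = (n + 1) * n.choose ij.1 := by
      exact_mod_cast h
    simp only [Nat.succ_eq_add_one, Nat.add_sub_cancel, mul_smul_comm, smul_smul]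
    push_cast
    rw [h']

/-- `Q(x)` does not depend on `x'`. In coefficients, Pascal's rule makes the derivatives of the
`Q⁽ⁱ⁾(x')` cancel against the shift caused by `∂ₓ' σ = -1`. -/
theorem dRight_mulLeft (s : JetSeq) : dRight (mulLeft s) = mulLeft (dRight s) := by
  funext n
  simp only [dRight_apply, mulLeft_apply, D_sum, D_smul, D_mul, D_jet]
  have h := Finset.sum_antidiagonal_choose_succ_nsmul (fun i j => jet i * s j) n
  simp only [← Nat.cast_smul_eq_nsmul ℂ] at h
  rw [h]
  have h2 : ∀ ij ∈ Finset.HasAntidiagonal.antidiagonal n, (n.choose ij.2 : ℂ) • (jet (ij.1 + 1) * s ij.2) =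
      (n.choose ij.1 : ℂ) • (jet (ij.1 + 1) * s ij.2) := by
    intro ij hij
    rw [Nat.choose_symm_of_eq_add (Finset.HasAntidiagonal.mem_antidiagonal.1 hij).symm]
  rw [Finset.sum_congr rfl h2]
  simp only [smul_add, mul_sub, smul_sub, Finset.sum_add_distrib, Finset.sum_sub_distrib]
  abel

/-! ### Off-diagonal coefficients and the transport equations in both variables -/

/-- The operator `-∂ₓ² + Q(x)`. -/
noncomputable def opLeft (s : JetSeq) : JetSeq := -dLeft (dLeft s) + mulLeft s

/-- The operator `f ↦ -∂ₓ'² f + f Q(x')`. -/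
noncomputable def opRight (s : JetSeq) : JetSeq := -dRight (dRight s) + mulRight s

/-- `offDiag k n` is the value on the diagonal of the `n`-th `x`-derivative of the off-diagonal heat
kernel coefficient `a_k(x, x')`. -/
noncomputable def offDiag : ℕ → JetSeq
  | 0 => fun n => if n = 0 then 1 else 0
  | k + 1 => fun n => (((k : ℂ) + 1) / (k + 1 + n)) • opLeft (offDiag k) n

theorem natCast_add_one_add_ne_zero (k n : ℕ) : ((k : ℂ) + 1 + n) ≠ 0 := by
  exact_mod_cast (by omega : k + 1 + n ≠ 0)

theorem mulSigma_dLeft_apply (s : JetSeq) (n : ℕ) : mulSigma (dLeft s) n = (n : ℂ) • s n := by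
  cases n <;> simp [mulSigma_apply, dLeft_apply]

/-- The transport equation `(k + σ∂ₓ) a_k = k L a_{k-1}` in `x`. At `k = 0` the truncated index `k -
1` is harmless because of the factor `k`. -/
theorem offDiag_left (k : ℕ) :
    (k : ℂ) • offDiag k + mulSigma (dLeft (offDiag k)) = (k : ℂ) • opLeft (offDiag (k - 1)) := by
  funext n
  simp only [Pi.add_apply, Pi.smul_apply, mulSigma_dLeft_apply]
  cases k with
  | zero => cases n <;> simp [offDiag]
  | succ k =>
    have h := natCast_add_one_add_ne_zero k n
    simp only [offDiag, smul_smul, ← add_smul, Nat.add_sub_cancel]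
    congr 1
    push_cast
    field_simp

/-- The defect of `a_k` in the transport equation with respect to `x'`. -/
noncomputable def rightDefect (k : ℕ) : JetSeq :=
  (k : ℂ) • offDiag k - mulSigma (dRight (offDiag k)) - (k : ℂ) • opRight (offDiag (k - 1))

theorem rightDefect_zero : rightDefect 0 = 0 := by
  funext n
  rcases n with _ | _ | n <;> simp [rightDefect, mulSigma_apply, dRight_apply, offDiag, D_one, D_zero]

/-- Three identities carry this: `(k + σ∂ₓ)(k+1 - σ∂ₓ') = (k - σ∂ₓ')(k+1 + σ∂ₓ)`, `LR = RL`, and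
`[L, σ∂ₓ'] + [R, σ∂ₓ] = 0`. So the defect satisfies a homogeneous transport equation of its own. -/
theorem rightDefect_transport (k : ℕ) :
    (k : ℂ) • rightDefect (k + 1) + mulSigma (dLeft (rightDefect (k + 1))) =
      ((k : ℂ) + 1) • opLeft (rightDefect k) := by
  have h1 := offDiag_left (k + 1)
  have h2 := offDiag_left k
  simp only [rightDefect, opLeft, opRight, Nat.add_sub_cancel] at *
  set X := offDiag (k + 1)
  set Y := offDiag k
  set Z := offDiag (k - 1)
  push_cast at *
  have e1 := congrArg (fun s => mulSigma (dRight s)) h1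
  have e2 := congrArg (fun s => dRight (dRight s)) h2
  have e3 := congrArg mulRight h2
  simp only [map_add, map_sub, map_smul, map_neg, dLeft_mulSigma, dRight_mulSigma, dRight_dLeft,
    mulRight_dLeft, mulRight_mulSigma, mulRight_mulLeft, mulLeft_mulSigma, dRight_mulLeft] at *
  -- Apply `k - σ∂ₓ'` to the equation for `a_{k+1}` and subtract `(k+1) R` of the equation for
  -- `a_k`.
  linear_combination (norm := module) (k : ℂ) • h1 - e1 + ((k : ℂ) + 1) • e2 - ((k : ℂ) + 1) • e3

/-- Only `offDiag 0 0` has a constant term: `opLeft` either raises the index `n` by two or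
multiplies by some `Q⁽ⁱ⁾`. -/
theorem constTerm_offDiag_succ (k n : ℕ) : constTerm (offDiag k (n + 1)) = 0 ∧
    constTerm (offDiag (k + 1) n) = 0 := by
  have hstep : ∀ k, (∀ n, constTerm (offDiag k (n + 1)) = 0) →
      ∀ n, constTerm (offDiag (k + 1) n) = 0 := by
    intro k hk n
    simp [offDiag, opLeft, dLeft_apply, mulLeft_apply, hk, constTerm_jet]
  have hall : ∀ k n, constTerm (offDiag k (n + 1)) = 0 := by
    intro k
    induction k with
    | zero => intro n; simp [offDiag]
    | succ k ih => intro n; exact hstep k ih (n + 1)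
  exact ⟨hall k n, hstep k (hall k) n⟩

theorem mulLeft_apply_zero (s : JetSeq) : mulLeft s 0 = Q * s 0 := by
  simp [mulLeft_apply, Q]

theorem mulLeft_apply_one (s : JetSeq) : mulLeft s 1 = Q * s 1 + D Q * s 0 := by
  simp [mulLeft_apply, Q, D_jet, Finset.Nat.antidiagonal_succ]

theorem dRight_dRight_apply (s : JetSeq) (n : ℕ) :
    dRight (dRight s) n = D (D (s n)) - (2 : ℂ) • D (s (n + 1)) + s (n + 2) := by
  simp only [dRight_apply, D_sub]
  module

theorem offDiag_zero_apply_zero : offDiag 0 0 = 1 := rfl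

theorem offDiag_one_apply_zero : offDiag 1 0 = Q := by
  simp [offDiag, opLeft, dLeft_apply, mulLeft_apply, Q]

/-- The transport equation reads `(k + n) d_{k+1,n} = 0` once `d_k = 0`. It determines everything
except `k = n = 0`, where both sides of the `x'`-equation for `a_1` are equal to `Q` on the
diagonal. -/
theorem rightDefect_eq_zero (k : ℕ) : rightDefect k = 0 := by
  induction k with
  | zero => exact rightDefect_zero
  | succ k ih =>
    have h := rightDefect_transport k
    rw [ih] at h
    have h0 : opLeft 0 = 0 := by simp [opLeft]
    rw [h0, smul_zero] at h
    funext n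
    have hn := congrFun h n
    simp only [Pi.add_apply, Pi.smul_apply, mulSigma_dLeft_apply, ← add_smul, Pi.zero_apply] at hn ⊢
    by_cases hkn : k + n = 0
    · obtain ⟨rfl, rfl⟩ : k = 0 ∧ n = 0 := by omega
      simp [rightDefect, mulSigma_apply, opRight, dRight_dRight_apply, mulRight_apply, offDiag,
        opLeft, dLeft_apply, mulLeft_apply_zero, D_one, D_zero]
    · refine (smul_eq_zero.1 hn).resolve_left ?_
      exact_mod_cast hkn

/-! ### Diagonal values: the primitive of `[Q, a_k]` and the recursion -/

/-- The diagonal heat kernel coefficients as differential polynomials. -/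
noncomputable def diagCoeff (k : ℕ) : DiffPoly := offDiag k 0

/-- The primitive of `[Q, a_k]`. -/
noncomputable def adPrimitive (k : ℕ) : DiffPoly := (2 : ℂ) • offDiag k 1 - D (diagCoeff k)

/-- `left_zero`, `right_zero`, `left_one`, `right_one` are the transport equations in `x` and in
`x'` at orders `σ⁰` and `σ¹`. -/
theorem left_zero (k : ℕ) :
    diagCoeff (k + 1) = -offDiag k 2 + Q * diagCoeff k := by
  have h : ((k : ℂ) + 1) ≠ 0 := by exact_mod_cast k.succ_ne_zero
  simp [diagCoeff, offDiag, opLeft, dLeft_apply, mulLeft_apply_zero, div_self h]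

theorem right_zero (k : ℕ) :
    diagCoeff (k + 1) =
      -(D (D (diagCoeff k)) - (2 : ℂ) • D (offDiag k 1) + offDiag k 2) + diagCoeff k * Q := by
  have h : ((k + 1 : ℕ) : ℂ) ≠ 0 := by exact_mod_cast k.succ_ne_zero
  have h1 := congrFun (rightDefect_eq_zero (k + 1)) 0
  simp only [rightDefect, opRight, Pi.sub_apply, Pi.smul_apply, Pi.add_apply, Pi.neg_apply,
    mulSigma_apply, dRight_dRight_apply, mulRight_apply, Nat.cast_zero, zero_smul, sub_zero,
    Pi.zero_apply, ← smul_sub, Nat.add_sub_cancel] at h1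
  exact sub_eq_zero.1 ((smul_eq_zero.1 h1).resolve_left h)

theorem left_one (k : ℕ) : ((k : ℂ) + 2) • offDiag (k + 1) 1 =
    ((k : ℂ) + 1) • (-offDiag k 3 + (Q * offDiag k 1 + D Q * diagCoeff k)) := by
  have h : ((k : ℂ) + 1 + 1) ≠ 0 := by exact_mod_cast (k + 1).succ_ne_zero
  simp only [offDiag, opLeft, Pi.add_apply, Pi.neg_apply, dLeft_apply, mulLeft_apply_one, smul_smul,
    Nat.cast_one]
  congr 1
  field_simp
  ring

theorem right_one (k : ℕ) : ((k : ℂ) + 2) • offDiag (k + 1) 1 - D (diagCoeff (k + 1)) =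
    ((k : ℂ) + 1) • (-(D (D (offDiag k 1)) - (2 : ℂ) • D (offDiag k 2) + offDiag k 3) +
      offDiag k 1 * Q) := by
  have h1 := congrFun (rightDefect_eq_zero (k + 1)) 1
  simp only [rightDefect, opRight, Pi.sub_apply, Pi.smul_apply, Pi.add_apply, Pi.neg_apply,
    mulSigma_apply, mulRight_apply, dRight_apply, D_sub, Nat.sub_self,
    Pi.zero_apply, Nat.add_sub_cancel, Nat.reduceAdd] at h1
  rw [← sub_eq_zero, ← h1, diagCoeff]
  push_cast
  module

/-- In the difference of the two equations at order `σ⁰` both `a_{k+1}` and the second-order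
coefficient drop out. What remains is `[Q, a_k] = D(2 a_{k,1} - D a_k)`. -/
theorem isPrimitive_adPrimitive (k : ℕ) : IsPrimitive ⁅Q, diagCoeff k⁆ (adPrimitive k) := by
  constructor
  · have h := (left_zero k).symm.trans (right_zero k)
    rw [adPrimitive, D_sub, D_smul, Ring.lie_def]
    linear_combination (norm := module) -h
  · simp [adPrimitive, constTerm_D, (constTerm_offDiag_succ k 0).1]

theorem offDiag_one_eq (k : ℕ) :
    offDiag k 1 = (1 / 2 : ℂ) • (D (diagCoeff k) + adPrimitive k) := by
  rw [adPrimitive]; module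

/-- At order `σ¹` the difference of the two equations is `D a_{k+1} = (k+1)(D² a_{k,1} - 2 D a_{k,2}
+ [Q, a_{k,1}] + Q' a_k)`; the third-order coefficient has cancelled. Then `a_{k,2} = Q a_k -
a_{k+1}` changes the factor of `D a_{k+1}` into `1 - 2(k+1) = -(2k+1)`, and `a_{k,1} = (D a_k +
D⁻¹[Q, a_k])/2` turns the rest into half of `E`. -/
theorem E_diagCoeff (k : ℕ) : (((k : ℂ) + 1) / 2) • E (diagCoeff k) =
    (-(2 * (k : ℂ) + 1)) • D (diagCoeff (k + 1)) := by
  have hp := isPrimitive_adPrimitive k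
  have hl := left_zero k
  have h1 := left_one k
  have h2 := right_one k
  rw [E, hp.Dinv_eq]
  have h3 : D (offDiag k 2) = D (Q * diagCoeff k) - D (diagCoeff (k + 1)) := by
    rw [hl, ← D_sub]; congr 1; abel
  have h4 : D (D (offDiag k 1)) = (1 / 2 : ℂ) • (D (D (D (diagCoeff k))) + D ⁅Q, diagCoeff k⁆) := by
    rw [offDiag_one_eq, D_smul, D_smul, D_add, D_add, hp.1]
  have h5 : Q * offDiag k 1 - offDiag k 1 * Q =
      (1 / 2 : ℂ) • (⁅Q, D (diagCoeff k)⁆ + ⁅Q, adPrimitive k⁆) := by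
    rw [offDiag_one_eq, Ring.lie_def, Ring.lie_def]
    simp only [mul_smul_comm, smul_mul_assoc, mul_add, add_mul]
    module
  have h6 : D (Q * diagCoeff k) = D Q * diagCoeff k + Q * D (diagCoeff k) := D_mul _ _
  rw [opE]
  -- The factors `2` in `opE` are ring elements; they become complex scalars so that `module` can
  -- collect them.
  simp only [← Nat.cast_ofNat (R := DiffPoly) (n := 2), ← nsmul_eq_mul, ← Nat.cast_smul_eq_nsmul ℂ]
  push_cast
  linear_combination (norm := module) (-1 : ℂ) • h1 + h2 - ((k : ℂ) + 1) • h4 - ((k : ℂ) + 1) • h5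
    + (2 * ((k : ℂ) + 1)) • h3 + ((k : ℂ) + 1) • h6

end DiffPoly

namespace DiffPoly

/-! ### The recursion and the closed formula -/

theorem constTerm_diagCoeff_succ (k : ℕ) : constTerm (diagCoeff (k + 1)) = 0 :=
  (constTerm_offDiag_succ k 0).2

theorem E_diagCoeff_eq (k : ℕ) : E (diagCoeff k) =
    (-(2 * (2 * (k : ℂ) + 1) / (k + 1))) • D (diagCoeff (k + 1)) := by
  have h : ((k : ℂ) + 1) ≠ 0 := by exact_mod_cast k.succ_ne_zero
  have h1 := congrArg (fun p => (2 / ((k : ℂ) + 1)) • p) (E_diagCoeff k)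
  simp only [smul_smul] at h1
  rw [show 2 / ((k : ℂ) + 1) * ((k + 1) / 2) = 1 by field_simp, one_smul] at h1
  rw [h1]
  congr 1
  field_simp

theorem two_mul_natCast_add_one_ne_zero (k : ℕ) : (2 * (k : ℂ) + 1) ≠ 0 := by
  exact_mod_cast (by omega : 2 * k + 1 ≠ 0)

theorem D_diagCoeff (k : ℕ) : D (diagCoeff (k + 1)) =
    (-(((k : ℂ) + 1) / (2 * (2 * k + 1)))) • E (diagCoeff k) := by
  have h : ((k : ℂ) + 1) ≠ 0 := by exact_mod_cast k.succ_ne_zero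
  have h' := two_mul_natCast_add_one_ne_zero k
  rw [E_diagCoeff_eq, smul_smul, neg_mul_neg]
  rw [show ((k : ℂ) + 1) / (2 * (2 * k + 1)) * (2 * (2 * (k : ℂ) + 1) / (k + 1)) = 1 by
    rw [div_mul_div_comm, mul_comm, div_self (mul_ne_zero (mul_ne_zero two_ne_zero h') h)], one_smul]

theorem isPrimitive_E_diagCoeff (k : ℕ) : IsPrimitive (E (diagCoeff k))
    ((-(2 * (2 * (k : ℂ) + 1) / (k + 1))) • diagCoeff (k + 1)) := by
  constructor
  · rw [D_smul, E_diagCoeff_eq]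
  · rw [map_smul, constTerm_diagCoeff_succ, smul_zero]

theorem A_diagCoeff (k : ℕ) : A (diagCoeff k) =
    (2 * (2 * (k : ℂ) + 1) / (k + 1)) • diagCoeff (k + 1) := by
  rw [A, (isPrimitive_E_diagCoeff k).Dinv_eq]
  module

theorem diagCoeff_succ (k : ℕ) : diagCoeff (k + 1) =
    (((k : ℂ) + 1) / (2 * (2 * k + 1))) • A (diagCoeff k) := by
  have h : ((k : ℂ) + 1) ≠ 0 := by exact_mod_cast k.succ_ne_zero
  have h' := two_mul_natCast_add_one_ne_zero k
  rw [A_diagCoeff, smul_smul]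
  rw [show ((k : ℂ) + 1) / (2 * (2 * k + 1)) * (2 * (2 * (k : ℂ) + 1) / (k + 1)) = 1 by
    rw [div_mul_div_comm, mul_comm, div_self (mul_ne_zero (mul_ne_zero two_ne_zero h') h)], one_smul]

theorem inDomainA_diagCoeff (k : ℕ) : InDomainA (diagCoeff k) :=
  ⟨(isPrimitive_adPrimitive k).existsUnique, (isPrimitive_E_diagCoeff k).existsUnique⟩

theorem lie_smul_right (c : ℂ) (p q : DiffPoly) : ⁅p, c • q⁆ = c • ⁅p, q⁆ := by
  rw [Ring.lie_def, Ring.lie_def, mul_smul_comm, smul_mul_assoc, smul_sub]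

theorem opE_smul (c : ℂ) (p w : DiffPoly) : opE D Q (c • p) (c • w) = c • opE D Q p w := by
  simp only [opE, D_smul, mul_smul_comm, lie_smul_right, smul_add, smul_sub]

/-- `E` commutes with scalars where the inner primitive exists. -/
theorem E_smul_diagCoeff (c : ℂ) (k : ℕ) : E (c • diagCoeff k) = c • E (diagCoeff k) := by
  have h := isPrimitive_adPrimitive k
  rw [E, E, lie_smul_right, (h.smul c).Dinv_eq, h.Dinv_eq, opE_smul]

theorem A_smul_diagCoeff (c : ℂ) (k : ℕ) : A (c • diagCoeff k) = c • A (diagCoeff k) := by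
  have h := isPrimitive_E_diagCoeff k
  rw [A, A, E_smul_diagCoeff, (h.smul c).Dinv_eq, h.Dinv_eq, smul_neg]

theorem inDomainA_smul_diagCoeff (c : ℂ) (k : ℕ) : InDomainA (c • diagCoeff k) := by
  refine ⟨?_, ?_⟩
  · rw [lie_smul_right]
    exact ((isPrimitive_adPrimitive k).smul c).existsUnique
  · rw [E_smul_diagCoeff]
    exact ((isPrimitive_E_diagCoeff k).smul c).existsUnique

/-- Starts from `a_1 = Q` and multiplies the factors `2(2k+1)/(k+1)` of `A_diagCoeff`. Because of
its default value `Dinv` is not known to be linear everywhere, so scalars are pulled out of `A` only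
at multiples of the `a_k`. -/
theorem iterate_A_Q (k : ℕ) : A^[k] Q =
    (((2 * k + 1)! : ℂ) / (((k + 1)! : ℂ) * (k ! : ℂ))) • diagCoeff (k + 1) := by
  induction k with
  | zero => simp [diagCoeff, offDiag_one_apply_zero]
  | succ k ih =>
    rw [Function.iterate_succ_apply', ih, A_smul_diagCoeff, A_diagCoeff, smul_smul]
    congr 1
    have h1 : ((k : ℂ) + 1) ≠ 0 := by exact_mod_cast k.succ_ne_zero
    have h2 : ((k : ℂ) + 1 + 1) ≠ 0 := by exact_mod_cast (k + 1).succ_ne_zero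
    have h3 : (k ! : ℂ) ≠ 0 := by exact_mod_cast k.factorial_ne_zero
    rw [show 2 * (k + 1) + 1 = (2 * k + 1) + 1 + 1 by ring]
    simp only [Nat.factorial_succ]
    push_cast
    field_simp
    ring

theorem diagCoeff_eq_iterate (k : ℕ) : diagCoeff (k + 1) =
    ((((k + 1)! : ℂ) * (k ! : ℂ)) / ((2 * k + 1)! : ℂ)) • A^[k] Q := by
  have h1 : (((k + 1)! : ℕ) : ℂ) ≠ 0 := by exact_mod_cast (k + 1).factorial_ne_zero
  have h2 : ((k ! : ℕ) : ℂ) ≠ 0 := by exact_mod_cast k.factorial_ne_zero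
  have h3 : (((2 * k + 1)! : ℕ) : ℂ) ≠ 0 := by exact_mod_cast (2 * k + 1).factorial_ne_zero
  rw [iterate_A_Q, smul_smul, div_mul_div_cancel₀ h3, div_self (mul_ne_zero h1 h2), one_smul]

theorem inDomainA_iterate (k : ℕ) : InDomainA (A^[k] Q) := by
  rw [iterate_A_Q]
  exact inDomainA_smul_diagCoeff _ _

/-! ### Evaluation at a smooth potential -/

section Eval

variable {N : ℕ} {V : ℝ → EndFibre N}

theorem evalAt_jet (i : ℕ) (x : ℝ) : evalAt V x (jet i) = iteratedDeriv i V x := by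
  simp [evalAt, jet]

theorem evalAt_Q (x : ℝ) : evalAt V x Q = V x := by
  rw [Q, evalAt_jet, iteratedDeriv_zero]

theorem hasDerivAt_evalAt (hV : ContDiff ℝ ∞ V) (p : DiffPoly) (x : ℝ) :
    HasDerivAt (fun y => evalAt V y p) (evalAt V x (D p)) x := by
  induction p using induction_jet with
  | hc c =>
    have h : D (algebraMap ℂ DiffPoly c) = 0 := derivationOf_algebraMap _ c
    simpa [h] using hasDerivAt_const x (algebraMap ℂ (EndFibre N) c)
  | hj i =>
    simp only [evalAt_jet, D_jet, iteratedDeriv_succ]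
    exact ((hV.differentiable_iteratedDeriv i (by exact_mod_cast WithTop.coe_lt_top i)) x).hasDerivAt
  | hm p q hp hq =>
    simp only [map_mul, D_mul, map_add]
    exact hp.mul hq
  | ha p q hp hq =>
    simp only [map_add, D_add]
    exact hp.add hq

theorem deriv_evalAt (hV : ContDiff ℝ ∞ V) (p : DiffPoly) :
    deriv (fun y => evalAt V y p) = fun y => evalAt V y (D p) :=
  funext fun x => (hasDerivAt_evalAt hV p x).deriv

/-- The derivative of an evaluated polynomial is again one, so differentiability bootstraps to every
order. -/
theorem contDiff_evalAt (hV : ContDiff ℝ ∞ V) (p : DiffPoly) :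
    ContDiff ℝ ∞ fun y => evalAt V y p := by
  rw [contDiff_infty]
  intro n
  induction n generalizing p with
  | zero =>
    exact contDiff_zero.2 (continuous_iff_continuousAt.2 fun x =>
      (hasDerivAt_evalAt hV p x).continuousAt)
  | succ n ih =>
    push_cast
    rw [contDiff_succ_iff_deriv]
    refine ⟨fun x => (hasDerivAt_evalAt hV p x).differentiableAt, by simp, ?_⟩
    rw [deriv_evalAt hV]
    exact ih (D p)

theorem evalAt_opE (hV : ContDiff ℝ ∞ V) (p w : DiffPoly) :
    (fun x => evalAt V x (opE D Q p w)) =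
      opE deriv V (fun x => evalAt V x p) (fun x => evalAt V x w) := by
  have h1 : V * (fun x => evalAt V x p) = fun x => evalAt V x (Q * p) := by
    funext x; simp [evalAt_Q]
  have h2 : ⁅V, fun x => evalAt V x p⁆ = fun x => evalAt V x ⁅Q, p⁆ := by
    funext x; simp [Ring.lie_def, evalAt_Q]
  have h3 : ∀ q, deriv (fun x => evalAt V x q) = fun x => evalAt V x (D q) := deriv_evalAt hV
  simp only [opE, h1, h2, h3]
  funext x
  simp only [Ring.lie_def, Pi.add_apply, Pi.sub_apply, Pi.mul_apply, map_add,
    map_sub, map_mul, evalAt_Q, map_ofNat, Pi.ofNat_apply]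

theorem function_recursion (hV : ContDiff ℝ ∞ V) (k : ℕ) :
    deriv (fun x => evalAt V x (diagCoeff (k + 1))) =
      (-(((k : ℂ) + 1) / (2 * (2 * k + 1)))) • opE deriv V (fun x => evalAt V x (diagCoeff k))
        (fun x => evalAt V x (Dinv ⁅Q, diagCoeff k⁆)) := by
  rw [deriv_evalAt hV, ← evalAt_opE hV, D_diagCoeff]
  funext x
  rw [map_smul, E, Pi.smul_apply]

theorem deriv_evalAt_Dinv (hV : ContDiff ℝ ∞ V) (k : ℕ) (x : ℝ) :
    deriv (fun x => evalAt V x (Dinv ⁅Q, diagCoeff k⁆)) x = ⁅V x, evalAt V x (diagCoeff k)⁆ := by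
  rw [deriv_evalAt hV, (isPrimitive_adPrimitive k).Dinv_eq, (isPrimitive_adPrimitive k).1]
  simp [Ring.lie_def, evalAt_Q]

end Eval

end DiffPoly

/-! ### A maximum principle on the circle -/

/-- A positive second derivative would make the point a local minimum as well, so the function would
be locally constant and the second derivative zero. -/
theorem IsLocalMax.second_deriv_nonpos {f f' : ℝ → ℝ} {x c : ℝ} (hmax : IsLocalMax f x)
    (hf : ∀ y, HasDerivAt f (f' y) y) (hf' : HasDerivAt f' c x) : c ≤ 0 := by
  by_contra! hc
  have h1 : deriv f = f' := funext fun y => (hf y).deriv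
  have h2 : deriv (deriv f) x = c := by rw [h1]; exact hf'.deriv
  have hmin : IsLocalMin f x := isLocalMin_of_deriv_deriv_pos (by rw [h2]; exact hc)
    hmax.deriv_eq_zero (hf x).continuousAt
  have h3 : f =ᶠ[𝓝 x] fun _ => f x := by
    filter_upwards [hmax, hmin] with y h1 h2 using le_antisymm h1 h2
  have h4 := h3.deriv.deriv_eq
  rw [h2] at h4
  simp at h4
  exact hc.ne' h4

/-- At an endpoint of the interval, values just outside coincide with values just inside the other
end, so a maximum over the interval is a local maximum even there. -/
theorem eventually_le_of_glue {u : ℝ → ℝ} {c d x : ℝ} (hcd : c < d) (hx : x ∈ Icc c d)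
    (hmax : ∀ y ∈ Icc c d, u y ≤ u x) (hglue : ∀ᶠ s in 𝓝 (0 : ℝ), u (c + s) = u (d + s)) :
    ∀ᶠ y in 𝓝 x, u y ≤ u x := by
  rcases eq_or_lt_of_le hx.1 with rfl | h1
  · have h : Tendsto (fun y => y - c) (𝓝 c) (𝓝 0) := by
      have : Tendsto (fun y => y - c) (𝓝 c) (𝓝 (c - c)) := (continuous_sub_right c).tendsto c
      rwa [sub_self] at this
    filter_upwards [h.eventually hglue, h.eventually (Ioo_mem_nhds (neg_lt_zero.2 (sub_pos.2 hcd))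
      (sub_pos.2 hcd))] with y hy1 hy2
    rcases le_or_gt c y with hy | hy
    · exact hmax y ⟨hy, by linarith [hy2.2]⟩
    · rw [add_sub_cancel] at hy1
      rw [hy1]
      exact hmax _ ⟨by linarith [hy2.1], by linarith⟩
  rcases eq_or_lt_of_le hx.2 with rfl | h2
  · have h : Tendsto (fun y => y - x) (𝓝 x) (𝓝 0) := by
      have : Tendsto (fun y => y - x) (𝓝 x) (𝓝 (x - x)) := (continuous_sub_right x).tendsto x
      rwa [sub_self] at this
    filter_upwards [h.eventually hglue, h.eventually (Ioo_mem_nhds (neg_lt_zero.2 (sub_pos.2 hcd))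
      (sub_pos.2 hcd))] with y hy1 hy2
    rcases le_or_gt y x with hy | hy
    · exact hmax y ⟨by linarith [hy2.1], hy⟩
    · rw [add_sub_cancel] at hy1
      rw [← hy1]
      exact hmax _ ⟨by linarith, by linarith [hy2.2]⟩
  · filter_upwards [Icc_mem_nhds h1 h2] with y hy using hmax y hy

/-- A function that stays below a barrier up to the time `t` and touches it at `t` has at least the
slope of the barrier. -/
theorem HasDerivAt.le_of_touching {r ψ : ℝ → ℝ} {r' ψ' t t₀ : ℝ} (hr : HasDerivAt r r' t)
    (hψ : HasDerivAt ψ ψ' t) (ht : t₀ < t) (hle : ∀ s ∈ Ioo t₀ t, r s ≤ ψ s) (heq : r t = ψ t) :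
    ψ' ≤ r' := by
  have h := (hr.sub hψ).hasDerivWithinAt (s := Iio t)
  rw [hasDerivWithinAt_iff_tendsto_slope' self_notMem_Iio] at h
  refine sub_nonneg.1 (ge_of_tendsto h ?_)
  filter_upwards [Ioo_mem_nhdsLT ht] with s hs
  rw [slope_def_field]
  refine div_nonneg_of_nonpos ?_ (by linarith [hs.2])
  have := hle s hs
  simp only [Pi.sub_apply]
  linarith

section MaximumPrinciple

variable {E : Type*} [NormedAddCommGroup E] [NormedSpace ℝ E]

/-- The barrier `ψ` satisfies `ψ' = Kψ + (B+ε)e^{Kt} > Kψ + B`. At a first touching point take a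
functional `ℓ` that norms `w`. Then `ℓ ∘ w ≤ ‖w‖` has a spatial maximum there and touches `ψ` from
below in time, so `ψ' ≤ ℓ(w_t - w_xx) ≤ Kψ + B`, a contradiction. Using `ℓ` avoids differentiating
the norm, and gluing is needed only for norms, so a unitary holonomy is allowed. -/
theorem norm_lt_barrier {c d T K B ε : ℝ} (hcd : c < d) (hK : 0 ≤ K) (hB : 0 ≤ B)
    (hε : 0 < ε) {w wt wx wxx : ℝ → ℝ → E}
    (hcont : ContinuousOn (fun p : ℝ × ℝ => w p.1 p.2) (Ioc 0 T ×ˢ Icc c d))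
    (ht : ∀ t ∈ Ioc 0 T, ∀ x ∈ Icc c d, HasDerivAt (fun s => w s x) (wt t x) t)
    (hx : ∀ t ∈ Ioc 0 T, ∀ x, HasDerivAt (w t) (wx t x) x)
    (hxx : ∀ t ∈ Ioc 0 T, ∀ x, HasDerivAt (wx t) (wxx t x) x)
    (hpde : ∀ t ∈ Ioc 0 T, ∀ x ∈ Icc c d, ‖wt t x - wxx t x‖ ≤ K * ‖w t x‖ + B)
    (hglue : ∀ t ∈ Ioc 0 T, ∀ᶠ s in 𝓝 (0 : ℝ), ‖w t (c + s)‖ = ‖w t (d + s)‖)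
    (h0 : ∀ δ > 0, ∀ᶠ t in 𝓝[>] (0 : ℝ), ∀ x ∈ Icc c d, ‖w t x‖ ≤ δ) :
    ∀ t ∈ Ioc 0 T, ∀ x ∈ Icc c d, ‖w t x‖ < (ε + (B + ε) * t) * Real.exp (K * t) := by
  set ψ : ℝ → ℝ := fun t => (ε + (B + ε) * t) * Real.exp (K * t) with hψdef
  have hψ : ∀ t, HasDerivAt ψ (K * ψ t + (B + ε) * Real.exp (K * t)) t := by
    intro t
    have h1 : HasDerivAt (fun t => ε + (B + ε) * t) (B + ε) t := by
      simpa using ((hasDerivAt_id t).const_mul (B + ε)).const_add ε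
    have h2 : HasDerivAt (fun t => Real.exp (K * t)) (Real.exp (K * t) * K) t := by
      simpa using ((hasDerivAt_id t).const_mul K).exp
    exact (h1.mul h2).congr_deriv (by ring)
  have hexp : ∀ t, 0 < t → 1 ≤ Real.exp (K * t) := fun t h =>
    Real.one_le_exp (by positivity)
  have hψε : ∀ t, 0 < t → ε ≤ ψ t := by
    intro t h
    have : 0 ≤ (B + ε) * t := by positivity
    calc ε ≤ ε + (B + ε) * t := by linarith
      _ ≤ _ := le_mul_of_one_le_right (by positivity) (hexp t h)
  by_contra! hcon
  obtain ⟨t', ht', x', hx', hle'⟩ := hcon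
  -- Before `t₁` the norm is at most `ε/2 < ψ`, so the set of bad points stays away from `t = 0` and
  -- is compact; its point with least time is the first touching point.
  obtain ⟨t₁, ht₁, hsmall⟩ := mem_nhdsGT_iff_exists_Ioo_subset.1 (h0 (ε / 2) (by positivity))
  have ht₁ : 0 < t₁ := ht₁
  have hbelow : ∀ t, 0 < t → t < t₁ → ∀ x ∈ Icc c d, ‖w t x‖ < ψ t := by
    intro t h1 h2 x hx
    have := hsmall ⟨h1, h2⟩ x hx
    linarith [hψε t h1]
  have ht₁' : t₁ ≤ t' := by
    by_contra! h
    exact absurd (hbelow t' ht'.1 h x' hx') (not_lt.2 hle')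
  have hsub : Icc t₁ T ×ˢ Icc c d ⊆ Ioc 0 T ×ˢ Icc c d :=
    prod_mono (fun t h => ⟨ht₁.trans_le h.1, h.2⟩) subset_rfl
  have hψc : Continuous ψ := continuous_iff_continuousAt.2 fun t => (hψ t).continuousAt
  set S := {p ∈ Icc t₁ T ×ˢ Icc c d | ψ p.1 ≤ ‖w p.1 p.2‖} with hS
  have hSc : IsCompact S := by
    have hcl : IsClosed S := IsClosed.isClosed_le (isClosed_Icc.prod isClosed_Icc)
      (hψc.comp continuous_fst).continuousOn (hcont.mono hsub).norm
    exact (isCompact_Icc.prod isCompact_Icc).of_isClosed_subset hcl (sep_subset _ _)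
  obtain ⟨⟨t, x⟩, hmem, hmin⟩ := hSc.exists_isMinOn ⟨(t', x'), ⟨⟨ht₁', ht'.2⟩, hx'⟩, hle'⟩
    continuous_fst.continuousOn
  have htT : t ∈ Ioc 0 T := (hsub hmem.1).1
  have hxI : x ∈ Icc c d := hmem.1.2
  have hlt : ∀ s ∈ Ioo 0 t, ∀ y ∈ Icc c d, ‖w s y‖ < ψ s := by
    intro s hs y hy
    rcases lt_or_ge s t₁ with h | h
    · exact hbelow s hs.1 h y hy
    · by_contra! hge
      have := hmin (show (s, y) ∈ S from ⟨⟨⟨h, hs.2.le.trans htT.2⟩, hy⟩, hge⟩)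
      exact absurd this (not_le.2 hs.2)
  have hle : ∀ y ∈ Icc c d, ‖w t y‖ ≤ ψ t := by
    intro y hy
    have h1 : Tendsto (fun s => ‖w s y‖) (𝓝[<] t) (𝓝 ‖w t y‖) :=
      ((ht t htT y hy).continuousAt.norm.tendsto).mono_left nhdsWithin_le_nhds
    have h2 : Tendsto ψ (𝓝[<] t) (𝓝 (ψ t)) := (hψc.tendsto t).mono_left nhdsWithin_le_nhds
    refine le_of_tendsto_of_tendsto h1 h2 ?_
    filter_upwards [Ioo_mem_nhdsLT htT.1] with s hs using (hlt s hs y hy).le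
  have heq : ‖w t x‖ = ψ t := le_antisymm (hle x hxI) hmem.2
  have hlocal : ∀ᶠ y in 𝓝 x, ‖w t y‖ ≤ ‖w t x‖ :=
    eventually_le_of_glue (u := fun y => ‖w t y‖) hcd hxI
      (fun y hy => heq ▸ hle y hy) (hglue t htT)
  obtain ⟨ℓ, hℓ1, hℓ2⟩ := exists_dual_vector'' ℝ (w t x)
  have hℓ2 : ℓ (w t x) = ‖w t x‖ := hℓ2
  have hℓle : ∀ v, ℓ v ≤ ‖v‖ := fun v =>
    (le_abs_self _).trans ((ℓ.le_of_opNorm_le hℓ1 v).trans_eq (one_mul _))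
  have hspace : ℓ (wxx t x) ≤ 0 := by
    refine IsLocalMax.second_deriv_nonpos (f := fun y => ℓ (w t y)) (f' := fun y => ℓ (wx t y))
      (x := x) ?_ (fun y => ℓ.hasFDerivAt.comp_hasDerivAt y (hx t htT y))
      (ℓ.hasFDerivAt.comp_hasDerivAt x (hxx t htT x))
    filter_upwards [hlocal] with y hy
    rw [hℓ2]
    exact (hℓle _).trans hy
  have htime : K * ψ t + (B + ε) * Real.exp (K * t) ≤ ℓ (wt t x) :=
    HasDerivAt.le_of_touching (r := fun s => ℓ (w s x))
      (ℓ.hasFDerivAt.comp_hasDerivAt t (ht t htT x hxI)) (hψ t) htT.1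
      (fun s hs => (hℓle _).trans (hlt s hs x hxI).le) (hℓ2.trans heq)
  have hp := (hℓle _).trans (hpde t htT x hxI)
  rw [map_sub, heq] at hp
  have h1 := hexp t htT.1
  -- The contradiction is `(B+ε)e^{Kt} ≤ B`, as `e^{Kt} ≥ 1` and `ε > 0`.
  nlinarith [mul_le_mul_of_nonneg_left h1 (by positivity : 0 ≤ B + ε)]

/-- The maximum principle for the inequality `|∂ₜ w - ∂ₓ² w| ≤ K |w| + B` on a circle, with
vanishing initial values. -/
theorem norm_le_of_heat_inequality {c d T K B : ℝ} (hcd : c < d) (hT : 0 < T) (hK : 0 ≤ K)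
    (hB : 0 ≤ B) {w wt wx wxx : ℝ → ℝ → E}
    (hcont : ContinuousOn (fun p : ℝ × ℝ => w p.1 p.2) (Ioc 0 T ×ˢ Icc c d))
    (ht : ∀ t ∈ Ioc 0 T, ∀ x ∈ Icc c d, HasDerivAt (fun s => w s x) (wt t x) t)
    (hx : ∀ t ∈ Ioc 0 T, ∀ x, HasDerivAt (w t) (wx t x) x)
    (hxx : ∀ t ∈ Ioc 0 T, ∀ x, HasDerivAt (wx t) (wxx t x) x)
    (hpde : ∀ t ∈ Ioc 0 T, ∀ x ∈ Icc c d, ‖wt t x - wxx t x‖ ≤ K * ‖w t x‖ + B)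
    (hglue : ∀ t ∈ Ioc 0 T, ∀ᶠ s in 𝓝 (0 : ℝ), ‖w t (c + s)‖ = ‖w t (d + s)‖)
    (h0 : ∀ δ > 0, ∀ᶠ t in 𝓝[>] (0 : ℝ), ∀ x ∈ Icc c d, ‖w t x‖ ≤ δ)
    {x : ℝ} (hxI : x ∈ Icc c d) : ‖w T x‖ ≤ B * T * Real.exp (K * T) := by
  have hlim : Tendsto (fun ε : ℝ => (ε + (B + ε) * T) * Real.exp (K * T)) (𝓝[>] 0)
      (𝓝 (B * T * Real.exp (K * T))) := by
    have h : Continuous fun ε : ℝ => (ε + (B + ε) * T) * Real.exp (K * T) := by fun_prop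
    have := (h.tendsto 0).mono_left (nhdsWithin_le_nhds (s := Ioi 0))
    simpa using this
  refine ge_of_tendsto hlim ?_
  filter_upwards [self_mem_nhdsWithin] with ε hε
  exact (norm_lt_barrier hcd hK hB hε hcont ht hx hxx hpde hglue h0 T ⟨hT, le_rfl⟩ x hxI).le

end MaximumPrinciple

/-! ### Parametric integrals -/

section ParametricIntegral

variable {E : Type*} [NormedAddCommGroup E] [NormedSpace ℝ E]

theorem continuousOn_parametric_intervalIntegral {X : Type*} [TopologicalSpace X]
    [FirstCountableTopology X] {s : Set X} {F : X → ℝ → E}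
    (hF : ContinuousOn (fun p : X × ℝ => F p.1 p.2) (s ×ˢ univ)) (c d : ℝ) :
    ContinuousOn (fun x => ∫ y in c..d, F x y) s := by
  rw [continuousOn_iff_continuous_domRestrict] at hF ⊢
  have h : Continuous fun p : s × ℝ => F p.1 p.2 :=
    hF.comp (f := fun p : s × ℝ => (⟨(p.1, p.2), p.1.2, trivial⟩ : ↥(s ×ˢ univ : Set (X × ℝ))))
      (by fun_prop)
  exact intervalIntegral.continuous_parametric_intervalIntegral_of_continuous' h c d

/-- Joint continuity bounds `F'` on a compact product around `x`, and this constant is the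
dominating function. -/
theorem hasDerivAt_parametric_intervalIntegral {F F' : ℝ → ℝ → E} {s : Set ℝ} (hs : IsOpen s)
    (hF : ContinuousOn (fun p : ℝ × ℝ => F p.1 p.2) (s ×ˢ univ))
    (hF' : ContinuousOn (fun p : ℝ × ℝ => F' p.1 p.2) (s ×ˢ univ))
    (hd : ∀ x ∈ s, ∀ y, HasDerivAt (fun z => F z y) (F' x y) x) (c d : ℝ) {x : ℝ} (hx : x ∈ s) :
    HasDerivAt (fun z => ∫ y in c..d, F z y) (∫ y in c..d, F' x y) x := by
  obtain ⟨r, hr, hball⟩ := Metric.nhds_basis_closedBall.mem_iff.1 (hs.mem_nhds hx)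
  have hsec : ∀ {G : ℝ → ℝ → E}, ContinuousOn (fun p : ℝ × ℝ => G p.1 p.2) (s ×ˢ univ) →
      ∀ z ∈ s, Continuous (G z) := fun hG z hz => continuousOn_univ.1 <|
    hG.comp (f := fun y => (z, y)) (by fun_prop) fun y _ => ⟨hz, trivial⟩
  obtain ⟨C, hC⟩ := ((isCompact_closedBall x r).prod (isCompact_uIcc (a := c) (b := d))).exists_bound_of_continuousOn
    (hF'.mono (prod_mono hball (subset_univ _)))
  refine (intervalIntegral.hasDerivAt_integral_of_dominated_loc_of_deriv_le (bound := fun _ => C)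
    (Metric.closedBall_mem_nhds x hr) ?_ ((hsec hF x hx).intervalIntegrable _ _)
    (hsec hF' x hx).aestronglyMeasurable ?_ (by simp) ?_).2
  · filter_upwards [hs.mem_nhds hx] with z hz using (hsec hF z hz).aestronglyMeasurable
  · exact Eventually.of_forall fun y hy z hz => hC (z, y) ⟨hz, uIoc_subset_uIcc hy⟩
  · exact Eventually.of_forall fun y _ z hz => hd z (hball hz) y

end ParametricIntegral

/-! ### Smooth sections supported near a point -/

/-- A smooth function supported in the interior of a fundamental interval extends to a smooth
section. -/
theorem exists_isSmoothSection_eq {a : ℝ} (ha : 0 < a) {N : ℕ} {g : EndFibre N}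
    (hg : g ∈ unitary (EndFibre N)) {f₀ : ℝ → Fibre N} (hf₀ : ContDiff ℝ ∞ f₀) {x₀ ρ : ℝ}
    (hρ0 : 0 ≤ ρ) (hρ : ρ < Real.pi * a) (hsupp : ∀ x, ρ < |x - x₀| → f₀ x = 0) :
    ∃ f, IsSmoothSection a g f ∧
      ∀ x ∈ Icc (x₀ - Real.pi * a) (x₀ + Real.pi * a), f x = f₀ x := by
  set q : ℝ := Real.pi * a with hq
  have hqpos : 0 < q := by positivity
  set G : ℤ → EndFibre N := fun m => ((⟨g, hg⟩ : unitary (EndFibre N)) ^ m : unitary (EndFibre N))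
    with hG
  set n : ℝ → ℤ := fun x => ⌊(x - (x₀ - q)) / (2 * q)⌋ with hn
  set f : ℝ → Fibre N := fun x => G (n x) (f₀ (x - 2 * q * n x)) with hf
  have hfl : ∀ (x : ℝ) (m : ℤ), x₀ - q ≤ x - 2 * q * m → x - 2 * q * m < x₀ + q → n x = m := by
    intro x m h1 h2
    rw [hn, Int.floor_eq_iff]
    constructor
    · rw [le_div_iff₀ (by positivity)]; linarith
    · rw [div_lt_iff₀ (by positivity)]; linarith
  -- The formula of the `m`-th window remains valid on a strip of width `q - ρ` to its left: there
  -- it and the formula of the preceding window both vanish. This gives smoothness across the window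
  -- ends.
  have hloc : ∀ (x : ℝ) (m : ℤ), x₀ - q - (q - ρ) < x - 2 * q * m → x - 2 * q * m < x₀ + q →
      f x = G m (f₀ (x - 2 * q * m)) := by
    intro x m h1 h2
    rcases le_or_gt (x₀ - q) (x - 2 * q * m) with h | h
    · simp only [hf, hfl x m h h2]
    · have hm : n x = m - 1 := by
        apply hfl <;> push_cast
        · linarith
        · linarith
      simp only [hf, hm]
      rw [hsupp, hsupp, map_zero, map_zero]
      · rw [lt_abs]; right; linarith
      · rw [lt_abs]; left; push_cast; linarith
  refine ⟨f, ⟨?_, ?_⟩, ?_⟩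
  · rw [contDiff_iff_contDiffAt]
    intro x
    have h1 : x₀ - q ≤ x - 2 * q * n x := by
      have := Int.floor_le ((x - (x₀ - q)) / (2 * q))
      rw [le_div_iff₀ (by positivity)] at this
      linarith
    have h2 : x - 2 * q * n x < x₀ + q := by
      have := Int.lt_floor_add_one ((x - (x₀ - q)) / (2 * q))
      rw [div_lt_iff₀ (by positivity)] at this
      linarith
    have h3 : ContDiff ℝ ∞ fun y => G (n x) (f₀ (y - 2 * q * n x)) :=
      ((G (n x)).restrictScalars ℝ).contDiff.comp (hf₀.comp (contDiff_id.sub contDiff_const))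
    refine h3.contDiffAt.congr_of_eventuallyEq ?_
    have hc : ContinuousAt (fun y : ℝ => y - 2 * q * n x) x := by fun_prop
    filter_upwards [hc.eventually (Ioo_mem_nhds (a := x₀ - q - (q - ρ)) (by linarith) h2)]
      with y hy using hloc y _ hy.1 hy.2
  · intro x
    have h1 : n (x + 2 * Real.pi * a) = n x + 1 := by
      simp only [hn]
      rw [← Int.floor_add_one]
      congr 1
      field_simp
      rw [hq]; ring
    simp only [hf, h1]
    have h2 : x + 2 * Real.pi * a - 2 * q * ((n x + 1 : ℤ) : ℝ) = x - 2 * q * n x := by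
      push_cast; rw [hq]; ring
    have h3 : G (n x + 1) = g * G (n x) := by
      simp only [hG, add_comm (n x), zpow_add, zpow_one]
      rfl
    rw [h2, h3]
    rfl
  · intro x hx
    -- The right endpoint already belongs to the next window, but both functions vanish there.
    rcases eq_or_lt_of_le hx.2 with h | h
    · have h1 : f x = G 1 (f₀ (x - 2 * q * (1 : ℤ))) := by
        apply hloc <;> push_cast <;> linarith
      rw [h1, hsupp x, hsupp, map_zero]
      · rw [lt_abs]; right; push_cast; linarith
      · rw [lt_abs]; left; linarith
    · have h1 : f x = G 0 (f₀ (x - 2 * q * (0 : ℤ))) := by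
        apply hloc <;> push_cast <;> linarith [hx.1]
      rw [h1]
      simp [hG]

/-! ### Comparison of a heat kernel with an approximate one -/

/-- `V` is `C¹` in `t > 0` and `C²` in `x`, with derivatives `Vt`, `Vx`, `Vxx` that are jointly
continuous. -/
structure HeatRegular {E : Type*} [NormedAddCommGroup E] [NormedSpace ℝ E]
    (V Vt Vx Vxx : ℝ → ℝ → ℝ → E) : Prop where
  cont : ContinuousOn (fun p : ℝ × ℝ × ℝ => V p.1 p.2.1 p.2.2) (Ioi 0 ×ˢ univ)
  cont_time : ContinuousOn (fun p : ℝ × ℝ × ℝ => Vt p.1 p.2.1 p.2.2) (Ioi 0 ×ˢ univ)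
  cont_space : ContinuousOn (fun p : ℝ × ℝ × ℝ => Vx p.1 p.2.1 p.2.2) (Ioi 0 ×ˢ univ)
  cont_space_two : ContinuousOn (fun p : ℝ × ℝ × ℝ => Vxx p.1 p.2.1 p.2.2) (Ioi 0 ×ˢ univ)
  deriv_time : ∀ t, 0 < t → ∀ x y, HasDerivAt (fun s => V s x y) (Vt t x y) t
  deriv_space : ∀ t, 0 < t → ∀ x y, HasDerivAt (fun z => V t z y) (Vx t x y) x
  deriv_space_two : ∀ t, 0 < t → ∀ x y, HasDerivAt (fun z => Vx t z y) (Vxx t x y) x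

namespace HeatRegular

theorem continuous_right {E : Type*} [NormedAddCommGroup E] {F : ℝ → ℝ → ℝ → E}
    (hF : ContinuousOn (fun p : ℝ × ℝ × ℝ => F p.1 p.2.1 p.2.2) (Ioi 0 ×ˢ univ)) {t : ℝ}
    (ht : 0 < t) (x : ℝ) : Continuous (F t x) :=
  continuousOn_univ.1 <| hF.comp (f := fun y => (t, x, y)) (by fun_prop) fun _ _ => ⟨ht, trivial⟩

section Basic

variable {E : Type*} [NormedAddCommGroup E] [NormedSpace ℝ E]
  {V Vt Vx Vxx W Wt Wx Wxx : ℝ → ℝ → ℝ → E}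

theorem sub (hV : HeatRegular V Vt Vx Vxx) (hW : HeatRegular W Wt Wx Wxx) :
    HeatRegular (V - W) (Vt - Wt) (Vx - Wx) (Vxx - Wxx) where
  cont := hV.cont.sub hW.cont
  cont_time := hV.cont_time.sub hW.cont_time
  cont_space := hV.cont_space.sub hW.cont_space
  cont_space_two := hV.cont_space_two.sub hW.cont_space_two
  deriv_time t ht x y := (hV.deriv_time t ht x y).sub (hW.deriv_time t ht x y)
  deriv_space t ht x y := (hV.deriv_space t ht x y).sub (hW.deriv_space t ht x y)
  deriv_space_two t ht x y := (hV.deriv_space_two t ht x y).sub (hW.deriv_space_two t ht x y)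

theorem continuousOn_integral {F : ℝ → ℝ → ℝ → E}
    (hF : ContinuousOn (fun p : ℝ × ℝ × ℝ => F p.1 p.2.1 p.2.2) (Ioi 0 ×ˢ univ)) (c d : ℝ) :
    ContinuousOn (fun p : ℝ × ℝ => ∫ y in c..d, F p.1 p.2 y) (Ioi 0 ×ˢ univ) :=
  continuousOn_parametric_intervalIntegral (F := fun (p : ℝ × ℝ) y => F p.1 p.2 y)
    (hF.comp (f := fun p : (ℝ × ℝ) × ℝ => (p.1.1, p.1.2, p.2)) (by fun_prop)
      fun _ hp => ⟨hp.1.1, trivial⟩) c d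

theorem hasDerivAt_integral_time (hV : HeatRegular V Vt Vx Vxx) (c d : ℝ) {t : ℝ} (ht : 0 < t)
    (x : ℝ) : HasDerivAt (fun s => ∫ y in c..d, V s x y) (∫ y in c..d, Vt t x y) t :=
  hasDerivAt_parametric_intervalIntegral (F := fun s y => V s x y) (F' := fun s y => Vt s x y)
    isOpen_Ioi
    (hV.cont.comp (f := fun p : ℝ × ℝ => (p.1, x, p.2)) (by fun_prop) fun _ hp => ⟨hp.1, trivial⟩)
    (hV.cont_time.comp (f := fun p : ℝ × ℝ => (p.1, x, p.2)) (by fun_prop)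
      fun _ hp => ⟨hp.1, trivial⟩)
    (fun s hs y => hV.deriv_time s hs x y) c d ht

theorem hasDerivAt_integral_space {F F' : ℝ → ℝ → ℝ → E}
    (hF : ContinuousOn (fun p : ℝ × ℝ × ℝ => F p.1 p.2.1 p.2.2) (Ioi 0 ×ˢ univ))
    (hF' : ContinuousOn (fun p : ℝ × ℝ × ℝ => F' p.1 p.2.1 p.2.2) (Ioi 0 ×ˢ univ))
    (hd : ∀ t, 0 < t → ∀ x y, HasDerivAt (fun z => F t z y) (F' t x y) x)
    (c d : ℝ) {t : ℝ} (ht : 0 < t) (x : ℝ) :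
    HasDerivAt (fun z => ∫ y in c..d, F t z y) (∫ y in c..d, F' t x y) x :=
  hasDerivAt_parametric_intervalIntegral (F := fun z y => F t z y) (F' := fun z y => F' t z y)
    isOpen_univ
    (hF.comp (f := fun p : ℝ × ℝ => (t, p.1, p.2)) (by fun_prop) fun _ _ => ⟨ht, trivial⟩)
    (hF'.comp (f := fun p : ℝ × ℝ => (t, p.1, p.2)) (by fun_prop) fun _ _ => ⟨ht, trivial⟩)
    (fun z _ y => hd t ht z y) c d (mem_univ x)

end Basic

theorem apply {N : ℕ} {V Vt Vx Vxx : ℝ → ℝ → ℝ → EndFibre N} (hV : HeatRegular V Vt Vx Vxx)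
    {f : ℝ → Fibre N} (hf : Continuous f) :
    HeatRegular (fun t x y => V t x y (f y)) (fun t x y => Vt t x y (f y))
      (fun t x y => Vx t x y (f y)) (fun t x y => Vxx t x y (f y)) := by
  have hfc : ContinuousOn (fun p : ℝ × ℝ × ℝ => f p.2.2) (Ioi 0 ×ˢ univ) := by fun_prop
  have hd : ∀ {F : ℝ → EndFibre N} {F' : EndFibre N} {s : ℝ}, HasDerivAt F F' s → ∀ v,
      HasDerivAt (fun z => F z v) (F' v) s := fun {_ _ s} h v =>
    ((ContinuousLinearMap.apply ℂ (Fibre N) v).restrictScalars ℝ).hasFDerivAt.comp_hasDerivAt s h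
  exact
  { cont := hV.cont.clm_apply hfc
    cont_time := hV.cont_time.clm_apply hfc
    cont_space := hV.cont_space.clm_apply hfc
    cont_space_two := hV.cont_space_two.clm_apply hfc
    deriv_time := fun t ht x y => hd (hV.deriv_time t ht x y) _
    deriv_space := fun t ht x y => hd (hV.deriv_space t ht x y) _
    deriv_space_two := fun t ht x y => hd (hV.deriv_space_two t ht x y) _ }

end HeatRegular

theorem IsHeatKernel.heatRegular {a : ℝ} {N : ℕ} {g : EndFibre N} {Q : ℝ → EndFibre N}
    {U : ℝ → ℝ → ℝ → EndFibre N} (hU : IsHeatKernel a g Q U) :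
    HeatRegular U (fun t x y => deriv (fun s => U s x y) t)
      (fun t x y => deriv (fun z => U t z y) x)
      (fun t x y => iteratedDeriv 2 (fun z => U t z y) x) where
  cont := hU.continuousOn
  cont_time := hU.continuousOn_time
  cont_space := hU.continuousOn_space
  cont_space_two := hU.continuousOn_space_two
  deriv_time t ht x y := (hU.differentiable_time t ht x y).hasDerivAt
  deriv_space t ht x y :=
    ((hU.contDiff_space t ht y).differentiable (by norm_num) x).hasDerivAt
  deriv_space_two t ht x y := by
    have h := (hU.contDiff_space t ht y).differentiable_iteratedDeriv 1 (by norm_num) x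
    rw [iteratedDeriv_one] at h
    rw [iteratedDeriv_succ, iteratedDeriv_one]
    exact h.hasDerivAt

/-- `H` is an approximate heat kernel near `x₀`: it vanishes for `x` away from `x₀`, the error
in the heat equation is `O(tᵐ)`, and it has the initial values of a heat kernel. -/
structure IsApproxHeatKernel {N : ℕ} (Q : ℝ → EndFibre N) (x₀ q ρ r C : ℝ) (m : ℕ)
    (H Ht Hx Hxx : ℝ → ℝ → ℝ → EndFibre N) : Prop where
  regular : HeatRegular H Ht Hx Hxx
  eq_zero : ∀ t, 0 < t → ∀ x y, r < |x - x₀| → H t x y = 0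
  residual : ∀ t, 0 < t → t ≤ 1 → ∀ x y, |x - x₀| ≤ q → |y - x₀| ≤ ρ →
    ‖Ht t x y - Hxx t x y + Q x * H t x y‖ ≤ C * t ^ m
  initial : ∀ f : ℝ → Fibre N, ContDiff ℝ ∞ f → (∀ y, ρ < |y - x₀| → f y = 0) →
    TendstoUniformlyOn (fun t x => ∫ y in (x₀ - q)..(x₀ + q), H t x y (f y)) f (𝓝[>] 0)
      (Icc (x₀ - q) (x₀ + q))

section Compare

variable {a : ℝ} {N : ℕ} {g : EndFibre N} {Q : ℝ → EndFibre N} {U : ℝ → ℝ → ℝ → EndFibre N}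

theorem norm_unitary_apply (hg : g ∈ unitary (EndFibre N)) (v : Fibre N) : ‖g v‖ = ‖v‖ :=
  ContinuousLinearMap.norm_map_of_mem_unitary hg v

/-- The holonomies of the dual section `U t x ·` and of `f` cancel, so the integrand is periodic and
any fundamental interval gives the same integral. -/
theorem IsHeatKernel.integral_section (hg : g ∈ unitary (EndFibre N)) (hU : IsHeatKernel a g Q U)
    {f : ℝ → Fibre N} (hf : IsSmoothSection a g f) {t : ℝ} (ht : 0 < t) (x c : ℝ) :
    ∫ y in c..(c + 2 * Real.pi * a), U t x y (f y) =
      ∫ y in (0 : ℝ)..(2 * Real.pi * a), U t x y (f y) := by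
  have hper : Function.Periodic (fun y => U t x y (f y)) (2 * Real.pi * a) := by
    intro y
    simp only [hU.section_right t ht, hf.2]
    rw [← mul_apply_eq_comp, mul_assoc, Unitary.star_mul_self_of_mem hg, mul_one]
  have := hper.intervalIntegral_add_eq c 0
  rwa [zero_add] at this

/-- The weight has mass one, so the bound does not depend on `η`; this is what later permits
shrinking its support. -/
theorem norm_integral_apply_le {F : ℝ → EndFibre N} {η : ℝ → ℝ}
    (hη : Continuous η) (hη0 : ∀ y, 0 ≤ η y) {c d B ρ x₀ : ℝ} (hcd : c ≤ d)
    (hint : ∫ y in c..d, η y = 1) (hsupp : ∀ y, ρ < |y - x₀| → η y = 0)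
    (hB : ∀ y, |y - x₀| ≤ ρ → ‖F y‖ ≤ B) (v : Fibre N) :
    ‖∫ y in c..d, F y (η y • v)‖ ≤ B * ‖v‖ := by
  calc ‖∫ y in c..d, F y (η y • v)‖ ≤ ∫ y in c..d, B * ‖v‖ * η y := by
        refine intervalIntegral.norm_integral_le_of_norm_le hcd (Eventually.of_forall fun y _ => ?_)
          (Continuous.intervalIntegrable (by fun_prop) _ _)
        rcases le_or_gt |y - x₀| ρ with h | h
        · calc ‖F y (η y • v)‖ ≤ ‖F y‖ * ‖η y • v‖ := (F y).le_opNorm _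
            _ = ‖F y‖ * ‖v‖ * η y := by
              rw [norm_smul, Real.norm_of_nonneg (hη0 y)]; ring
            _ ≤ _ := by
              gcongr
              · exact hη0 y
              · exact hB y h
        · simp [hsupp y h]
    _ = B * ‖v‖ := by rw [intervalIntegral.integral_const_mul, hint, mul_one]

/-- The function `W(t,x) = ∫ (U - H)(t,x,y) η(y)v dy` satisfies `W_t - W_xx = -QW - ∫ residual ·
ηv`. Both parts of `W` tend uniformly to `ηv` as `t → 0+`, so `W` has zero initial values and the
maximum principle applies. Smearing in `y` is necessary because the initial condition speaks only of
integrals against smooth sections. -/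
theorem norm_integral_compare_le (ha : 0 < a) (hg : g ∈ unitary (EndFibre N))
    (hU : IsHeatKernel a g Q U) {x₀ ρ r C K : ℝ} {m : ℕ} (hρ0 : 0 ≤ ρ) (hρ : ρ < Real.pi * a)
    (hr : r < Real.pi * a) (hC : 0 ≤ C) (hK : 0 ≤ K)
    (hQ : ∀ x, |x - x₀| ≤ Real.pi * a → ‖Q x‖ ≤ K)
    {H Ht Hx Hxx : ℝ → ℝ → ℝ → EndFibre N}
    (hH : IsApproxHeatKernel Q x₀ (Real.pi * a) ρ r C m H Ht Hx Hxx)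
    {η : ℝ → ℝ} (hη : ContDiff ℝ ∞ η) (hη0 : ∀ y, 0 ≤ η y)
    (hsupp : ∀ y, ρ < |y - x₀| → η y = 0)
    (hint : ∫ y in (x₀ - Real.pi * a)..(x₀ + Real.pi * a), η y = 1) (v : Fibre N)
    {T : ℝ} (hT : 0 < T) (hT1 : T ≤ 1) :
    ‖∫ y in (x₀ - Real.pi * a)..(x₀ + Real.pi * a), (U T x₀ y - H T x₀ y) (η y • v)‖ ≤
      C * T ^ m * ‖v‖ * T * Real.exp (K * T) := by
  set q : ℝ := Real.pi * a with hq
  have hqpos : 0 < q := by positivity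
  have hcd : x₀ - q < x₀ + q := by linarith
  have hp : 2 * Real.pi * a = 2 * q := by rw [hq]; ring
  set f₀ : ℝ → Fibre N := fun y => η y • v with hf₀
  have hf₀s : ContDiff ℝ ∞ f₀ := hη.smul contDiff_const
  have hf₀supp : ∀ y, ρ < |y - x₀| → f₀ y = 0 := fun y hy => by simp [hf₀, hsupp y hy]
  have hmem : ∀ {x}, x ∈ Icc (x₀ - q) (x₀ + q) ↔ |x - x₀| ≤ q := fun {x} => by
    rw [abs_le, mem_Icc]; constructor <;> intro h <;> constructor <;> linarith [h.1, h.2]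
  have hUr := hU.heatRegular.apply hf₀s.continuous
  have hHr := hH.regular.apply hf₀s.continuous
  have hW := hUr.sub hHr
  have hci : ∀ {F : ℝ → ℝ → ℝ → Fibre N},
      ContinuousOn (fun p : ℝ × ℝ × ℝ => F p.1 p.2.1 p.2.2) (Ioi 0 ×ˢ univ) → ∀ t, 0 < t → ∀ x,
      IntervalIntegrable (F t x) MeasureTheory.volume (x₀ - q) (x₀ + q) := fun hF t ht x =>
    (HeatRegular.continuous_right hF ht x).intervalIntegrable _ _
  obtain ⟨f, hfs, hfeq⟩ := exists_isSmoothSection_eq ha hg hf₀s hρ0 hρ hf₀supp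
  have hUf : ∀ t, 0 < t → ∀ x, ∫ y in (x₀ - q)..(x₀ + q), U t x y (f₀ y) =
      ∫ y in (0 : ℝ)..(2 * Real.pi * a), U t x y (f y) := by
    intro t ht x
    rw [← hU.integral_section hg hfs ht x (x₀ - q), hp, show x₀ - q + 2 * q = x₀ + q by ring]
    refine intervalIntegral.integral_congr fun y hy => ?_
    rw [uIcc_of_le hcd.le] at hy
    simp only [hfeq y hy]
  -- On `(0, T]` the residual is at most `C Tᵐ ‖v‖`, a constant. The three remaining goals are the
  -- differential inequality, the gluing of norms, and the initial values.
  have hres := norm_le_of_heat_inequality (E := Fibre N) (K := K) (B := C * T ^ m * ‖v‖) hcd hT hK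
    (by positivity)
    ((HeatRegular.continuousOn_integral hW.cont (x₀ - q) (x₀ + q)).mono
      (prod_mono (fun t h => h.1) (subset_univ _)))
    (fun t ht x _ => hW.hasDerivAt_integral_time _ _ ht.1 x)
    (fun t ht x => HeatRegular.hasDerivAt_integral_space hW.cont hW.cont_space hW.deriv_space
      _ _ ht.1 x)
    (fun t ht x => HeatRegular.hasDerivAt_integral_space hW.cont_space hW.cont_space_two
      hW.deriv_space_two _ _ ht.1 x) ?_ ?_ ?_ (hmem.2 (show |x₀ - x₀| ≤ q by simpa using hqpos.le))
  · exact hres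
  · intro t ht x hx
    rw [← intervalIntegral.integral_sub (hci hW.cont_time t ht.1 x) (hci hW.cont_space_two t ht.1 x)]
    have hsplit : ∀ y, (((fun t x y => (deriv (fun s => U s x y) t) (f₀ y)) -
          fun t x y => (Ht t x y) (f₀ y)) : ℝ → ℝ → ℝ → Fibre N) t x y -
        (((fun t x y => (iteratedDeriv 2 (fun z => U t z y) x) (f₀ y)) -
          fun t x y => (Hxx t x y) (f₀ y)) : ℝ → ℝ → ℝ → Fibre N) t x y =
        -(Q x ((((fun t x y => U t x y (f₀ y)) - fun t x y => H t x y (f₀ y)) :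
          ℝ → ℝ → ℝ → Fibre N) t x y)) -
          (Ht t x y - Hxx t x y + Q x * H t x y) (f₀ y) := by
      intro y
      have h := hU.heat_equation t ht.1 x y
      have h' : deriv (fun s => U s x y) t = iteratedDeriv 2 (fun z => U t z y) x - Q x * U t x y := by
        rw [← sub_eq_zero, ← h]; abel
      simp only [Pi.sub_apply, h', sub_apply, add_apply,
        mul_apply_eq_comp, map_sub]
      abel
    simp only [hsplit]
    have hcR : Continuous fun y => Ht t x y - Hxx t x y + Q x * H t x y :=
      ((HeatRegular.continuous_right hH.regular.cont_time ht.1 x).sub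
        (HeatRegular.continuous_right hH.regular.cont_space_two ht.1 x)).add
        (continuous_const.mul (HeatRegular.continuous_right hH.regular.cont ht.1 x))
    have hcW := HeatRegular.continuous_right hW.cont ht.1 x
    have hneg : Continuous fun y => -(Q x ((((fun t x y => U t x y (f₀ y)) -
        fun t x y => H t x y (f₀ y)) : ℝ → ℝ → ℝ → Fibre N) t x y)) :=
      ((Q x).continuous.comp hcW).neg
    rw [intervalIntegral.integral_sub (hneg.intervalIntegrable _ _)
      (Continuous.intervalIntegrable (hcR.clm_apply hf₀s.continuous) _ _),
      intervalIntegral.integral_neg,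
      ContinuousLinearMap.intervalIntegral_comp_comm _ (hcW.intervalIntegrable _ _)]
    refine (norm_sub_le _ _).trans (add_le_add ?_ ?_)
    · rw [norm_neg]
      exact ((Q x).le_opNorm _).trans
        (mul_le_mul_of_nonneg_right (hQ x (hmem.1 hx)) (norm_nonneg _))
    · refine norm_integral_apply_le hη.continuous hη0 hcd.le hint hsupp (fun y hy => ?_) v
      refine (hH.residual t ht.1 (ht.2.trans hT1) x y (hmem.1 hx) hy).trans ?_
      exact mul_le_mul_of_nonneg_left (pow_le_pow_left₀ ht.1.le ht.2 m) hC
  · intro t ht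
    -- Near the ends of the interval `H` vanishes since `r < q`, and the values of `U` there differ
    -- by the isometry `g`.
    have hnear : ∀ᶠ s in 𝓝 (0 : ℝ), |s| < q - r := by
      have : ContinuousAt (fun s : ℝ => |s|) 0 := by fun_prop
      exact this.eventually (gt_mem_nhds (by simpa using hr))
    filter_upwards [hnear] with s hs
    rw [abs_lt] at hs
    have h1 : ∀ y, H t (x₀ - q + s) y = 0 := fun y => hH.eq_zero t ht.1 _ y (by
      rw [lt_abs]; right; linarith)
    have h2 : ∀ y, H t (x₀ + q + s) y = 0 := fun y => hH.eq_zero t ht.1 _ y (by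
      rw [lt_abs]; left; linarith)
    have h3 : ∀ y, U t (x₀ + q + s) y = g * U t (x₀ - q + s) y := fun y => by
      rw [← hU.section_left t ht.1, hp]; congr 1; ring
    simp only [Pi.sub_apply, h1, h2, h3, zero_apply, sub_zero,
      mul_apply_eq_comp]
    rw [ContinuousLinearMap.intervalIntegral_comp_comm g
      (hci (F := fun t x y => U t x y (f₀ y)) hUr.cont t ht.1 _),
      norm_unitary_apply hg]
  · intro δ hδ
    have h1 := Metric.tendstoUniformly_iff.1 (hU.initial f hfs) (δ / 2) (by positivity)
    have h2 := Metric.tendstoUniformlyOn_iff.1 (hH.initial f₀ hf₀s hf₀supp) (δ / 2) (by positivity)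
    filter_upwards [h1, h2, self_mem_nhdsWithin] with t h1 h2 ht x hx
    have ht : 0 < t := ht
    simp only [Pi.sub_apply]
    rw [intervalIntegral.integral_sub (hci (F := fun t x y => U t x y (f₀ y)) hUr.cont t ht x)
      (hci (F := fun t x y => H t x y (f₀ y)) hHr.cont t ht x), hUf t ht x]
    have e1 := h1 x
    have e2 := h2 x hx
    rw [hfeq x hx] at e1
    rw [← dist_eq_norm]
    have := dist_triangle_left (∫ y in (0 : ℝ)..(2 * Real.pi * a), U t x y (f y))
      (∫ y in (x₀ - q)..(x₀ + q), H t x y (f₀ y)) (f₀ x)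
    linarith

/-- Tests against bumps concentrated at `x₀`. By continuity in `y` the smeared difference is within
`ε‖v‖` of its value at `y = x₀`, while the comparison bound is the same for every bump. -/
theorem norm_diagonal_compare_le (ha : 0 < a) (hg : g ∈ unitary (EndFibre N))
    (hU : IsHeatKernel a g Q U) {x₀ ρ r C K : ℝ} {m : ℕ} (hρ0 : 0 < ρ) (hρ : ρ < Real.pi * a)
    (hr : r < Real.pi * a) (hC : 0 ≤ C) (hK : 0 ≤ K)
    (hQ : ∀ x, |x - x₀| ≤ Real.pi * a → ‖Q x‖ ≤ K)
    {H Ht Hx Hxx : ℝ → ℝ → ℝ → EndFibre N}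
    (hH : IsApproxHeatKernel Q x₀ (Real.pi * a) ρ r C m H Ht Hx Hxx)
    {T : ℝ} (hT : 0 < T) (hT1 : T ≤ 1) :
    ‖U T x₀ x₀ - H T x₀ x₀‖ ≤ C * T ^ m * T * Real.exp (K * T) := by
  have hqpos : 0 < Real.pi * a := by positivity
  refine le_of_forall_pos_le_add fun ε hε => ?_
  set F : ℝ → EndFibre N := fun y => U T x₀ y - H T x₀ y with hF
  have hFc : Continuous F := (HeatRegular.continuous_right hU.continuousOn hT x₀).sub
    (HeatRegular.continuous_right hH.regular.cont hT x₀)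
  obtain ⟨κ, hκ, hκε⟩ := Metric.continuous_iff.1 hFc x₀ ε hε
  set κ' := min (κ / 2) ρ with hκ'
  have hκ'pos : 0 < κ' := lt_min (by positivity) hρ0
  let b : ContDiffBump x₀ := ⟨κ' / 2, κ', by positivity, by linarith⟩
  set η : ℝ → ℝ := b.normed MeasureTheory.volume with hη
  have hηs : ContDiff ℝ ∞ η := b.contDiff_normed
  have hη0 : ∀ y, 0 ≤ η y := b.nonneg_normed
  have hsupp : ∀ y, κ' < |y - x₀| → η y = 0 := by
    intro y hy
    rw [← Function.notMem_support, hη, b.support_normed_eq, Metric.mem_ball, Real.dist_eq]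
    exact not_lt.2 hy.le
  have hint : ∫ y in (x₀ - Real.pi * a)..(x₀ + Real.pi * a), η y = 1 := by
    rw [intervalIntegral.integral_eq_integral_of_support_subset, hη, b.integral_normed]
    rw [hη, b.support_normed_eq]
    intro y hy
    rw [Metric.mem_ball, Real.dist_eq] at hy
    have : |y - x₀| < Real.pi * a := hy.trans_le ((min_le_right _ _).trans hρ.le)
    rw [abs_lt] at this
    exact ⟨by linarith [this.1], by linarith [this.2]⟩
  refine ContinuousLinearMap.opNorm_le_bound _ (by positivity) fun v => ?_
  have h1 := norm_integral_compare_le ha hg hU hρ0.le hρ hr hC hK hQ hH hηs hη0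
    (fun y hy => hsupp y ((min_le_right _ _).trans_lt hy)) hint v hT hT1
  have h2 := norm_integral_apply_le (F := fun y => F y - F x₀) hηs.continuous hη0
    (by linarith : x₀ - Real.pi * a ≤ x₀ + Real.pi * a) hint hsupp (B := ε) (fun y hy => by
      rw [← dist_eq_norm]
      refine (hκε y ?_).le
      rw [Real.dist_eq]
      exact hy.trans_lt ((min_le_left _ _).trans_lt (by linarith))) v
  have hηv : Continuous fun y => η y • v := hηs.continuous.smul continuous_const
  have h3 : ∫ y in (x₀ - Real.pi * a)..(x₀ + Real.pi * a), F x₀ (η y • v) = F x₀ v := by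
    rw [ContinuousLinearMap.intervalIntegral_comp_comm _ (hηv.intervalIntegrable _ _),
      intervalIntegral.integral_smul_const, hint, one_smul]
  simp only [sub_apply] at h2
  have hFv : Continuous fun y => F x₀ (η y • v) := (F x₀).continuous.comp hηv
  rw [intervalIntegral.integral_sub ((hFc.clm_apply hηv).intervalIntegrable _ _)
    (hFv.intervalIntegrable _ _), h3] at h2
  have h4 := norm_le_insert (∫ y in (x₀ - Real.pi * a)..(x₀ + Real.pi * a), F y (η y • v)) (F x₀ v)
  calc ‖F x₀ v‖ ≤ C * T ^ m * ‖v‖ * T * Real.exp (K * T) + ε * ‖v‖ := h4.trans (add_le_add h1 h2)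
    _ = _ := by ring

end Compare

/-! ### The Gaussian and regularity of products -/

namespace HeatRegular

variable {E : Type*} [NormedAddCommGroup E] [NormedSpace ℝ E]
  {f ft fx fxx : ℝ → ℝ → ℝ → ℝ} {V Vt Vx Vxx : ℝ → ℝ → ℝ → E}

/-- The derivatives are left as the bare product rule; `exists_parametrix_residual` uses exactly
this shape. -/
theorem smul (hf : HeatRegular f ft fx fxx) (hV : HeatRegular V Vt Vx Vxx) :
    HeatRegular (fun t x y => f t x y • V t x y)
      (fun t x y => f t x y • Vt t x y + ft t x y • V t x y)
      (fun t x y => f t x y • Vx t x y + fx t x y • V t x y)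
      (fun t x y => f t x y • Vxx t x y + fx t x y • Vx t x y +
        (fx t x y • Vx t x y + fxx t x y • V t x y)) where
  cont := hf.cont.smul hV.cont
  cont_time := (hf.cont.smul hV.cont_time).add (hf.cont_time.smul hV.cont)
  cont_space := (hf.cont.smul hV.cont_space).add (hf.cont_space.smul hV.cont)
  cont_space_two := ((hf.cont.smul hV.cont_space_two).add (hf.cont_space.smul hV.cont_space)).add
    ((hf.cont_space.smul hV.cont_space).add (hf.cont_space_two.smul hV.cont))
  deriv_time t ht x y := (hf.deriv_time t ht x y).smul (hV.deriv_time t ht x y)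
  deriv_space t ht x y := (hf.deriv_space t ht x y).smul (hV.deriv_space t ht x y)
  deriv_space_two t ht x y :=
    ((hf.deriv_space t ht x y).smul (hV.deriv_space_two t ht x y)).add
      ((hf.deriv_space_two t ht x y).smul (hV.deriv_space t ht x y))

theorem sum {ι : Type*} (s : Finset ι) {V Vt Vx Vxx : ι → ℝ → ℝ → ℝ → E}
    (h : ∀ i ∈ s, HeatRegular (V i) (Vt i) (Vx i) (Vxx i)) :
    HeatRegular (fun t x y => ∑ i ∈ s, V i t x y) (fun t x y => ∑ i ∈ s, Vt i t x y)
      (fun t x y => ∑ i ∈ s, Vx i t x y) (fun t x y => ∑ i ∈ s, Vxx i t x y) where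
  cont := continuousOn_finsetSum s fun i hi => (h i hi).cont
  cont_time := continuousOn_finsetSum s fun i hi => (h i hi).cont_time
  cont_space := continuousOn_finsetSum s fun i hi => (h i hi).cont_space
  cont_space_two := continuousOn_finsetSum s fun i hi => (h i hi).cont_space_two
  deriv_time t ht x y := HasDerivAt.fun_sum fun i hi => (h i hi).deriv_time t ht x y
  deriv_space t ht x y := HasDerivAt.fun_sum fun i hi => (h i hi).deriv_space t ht x y
  deriv_space_two t ht x y := HasDerivAt.fun_sum fun i hi => (h i hi).deriv_space_two t ht x y

/-- Functions of `x` alone. -/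
theorem of_space {u : ℝ → ℝ} (hu : ContDiff ℝ ∞ u) :
    HeatRegular (fun _ x _ => u x) (fun _ _ _ => 0) (fun _ x _ => deriv u x)
      (fun _ x _ => deriv (deriv u) x) := by
  have h1 : ContDiff ℝ ∞ (deriv u) := by
    have := hu.iterate_deriv 1
    simpa using this
  have h2 : ContDiff ℝ ∞ (deriv (deriv u)) := by
    have := hu.iterate_deriv 2
    simpa using this
  exact
  { cont := (hu.continuous.comp (by fun_prop : Continuous fun p : ℝ × ℝ × ℝ => p.2.1)).continuousOn
    cont_time := continuousOn_const
    cont_space := (h1.continuous.comp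
      (by fun_prop : Continuous fun p : ℝ × ℝ × ℝ => p.2.1)).continuousOn
    cont_space_two := (h2.continuous.comp
      (by fun_prop : Continuous fun p : ℝ × ℝ × ℝ => p.2.1)).continuousOn
    deriv_time := fun t _ x y => hasDerivAt_const t (u x)
    deriv_space := fun _ _ x _ => (hu.differentiable (by simp) x).hasDerivAt
    deriv_space_two := fun _ _ x _ => (h1.differentiable (by simp) x).hasDerivAt }

/-- The monomials `tᵏ (x - y)ᵐ c(y)`. -/
theorem monomial (k m : ℕ) {c : ℝ → E} (hc : Continuous c) :
    HeatRegular (fun t x y => (t ^ k * (x - y) ^ m) • c y)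
      (fun t x y => (k * t ^ (k - 1) * (x - y) ^ m) • c y)
      (fun t x y => (t ^ k * (m * (x - y) ^ (m - 1))) • c y)
      (fun t x y => (t ^ k * (m * ((m - 1 : ℕ) * (x - y) ^ (m - 2)))) • c y) := by
  have hpow : ∀ (j : ℕ) (x y : ℝ), HasDerivAt (fun z => (z - y) ^ j) (j * (x - y) ^ (j - 1)) x := by
    intro j x y
    exact (hasDerivAt_pow j (x - y)).comp_sub_const x y
  exact
  { cont := by fun_prop
    cont_time := by fun_prop
    cont_space := by fun_prop
    cont_space_two := by fun_prop
    deriv_time := fun t _ x y => ((hasDerivAt_pow k t).mul_const _).smul_const _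
    deriv_space := fun t _ x y => ((hpow m x y).const_mul _).smul_const _
    deriv_space_two := fun t _ x y => (((hpow (m - 1) x y).const_mul _).const_mul _).smul_const _ }

end HeatRegular

/-- The heat kernel of `-∂ₓ²` on the line. -/
noncomputable def lineHeat (t z : ℝ) : ℝ :=
  (4 * Real.pi * t) ^ (-(1 / 2 : ℝ)) * Real.exp (-z ^ 2 / (4 * t))

theorem lineHeat_nonneg {t : ℝ} (ht : 0 < t) (z : ℝ) : 0 ≤ lineHeat t z := by
  unfold lineHeat; positivity

theorem continuous_lineHeat (t : ℝ) : Continuous (lineHeat t) := by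
  unfold lineHeat; fun_prop

theorem hasDerivAt_lineHeat_time {t : ℝ} (ht : 0 < t) (z : ℝ) :
    HasDerivAt (fun s => lineHeat s z) ((z ^ 2 / (4 * t ^ 2) - 1 / (2 * t)) * lineHeat t z) t := by
  have hpi := Real.pi_pos
  have h1 : HasDerivAt (fun s : ℝ => (4 * Real.pi * s) ^ (-(1 / 2 : ℝ)))
      ((4 * Real.pi) * (-(1 / 2 : ℝ)) * (4 * Real.pi * t) ^ (-(1 / 2 : ℝ) - 1)) t := by
    have := (((hasDerivAt_id t).const_mul (4 * Real.pi)).rpow_const (p := -(1 / 2 : ℝ))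
      (Or.inl (by simp only [id]; positivity)))
    simpa using this
  have h2 : HasDerivAt (fun s : ℝ => Real.exp (-z ^ 2 / (4 * s)))
      (Real.exp (-z ^ 2 / (4 * t)) * (z ^ 2 / (4 * t ^ 2))) t := by
    have h3 : HasDerivAt (fun s : ℝ => -z ^ 2 / (4 * s)) (z ^ 2 / (4 * t ^ 2)) t := by
      have := (hasDerivAt_const t (-z ^ 2)).div ((hasDerivAt_id t).const_mul 4)
        (by simp only [id]; positivity)
      refine this.congr_deriv ?_
      simp only [id]
      field_simp
      ring
    exact h3.exp
  refine (h1.mul h2).congr_deriv ?_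
  rw [Real.rpow_sub_one (by positivity), lineHeat]
  field_simp
  ring

theorem hasDerivAt_lineHeat_space (t z : ℝ) :
    HasDerivAt (lineHeat t) (-(z / (2 * t)) * lineHeat t z) z := by
  have h1 : HasDerivAt (fun z : ℝ => -z ^ 2 / (4 * t)) (-(2 * z) / (4 * t)) z := by
    simpa using ((hasDerivAt_pow 2 z).neg.div_const (4 * t))
  refine (h1.exp.const_mul ((4 * Real.pi * t) ^ (-(1 / 2 : ℝ)))).congr_deriv ?_
  rw [lineHeat]
  rcases eq_or_ne t 0 with rfl | ht
  · simp
  · field_simp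
    ring

theorem continuousOn_lineHeat :
    ContinuousOn (fun p : ℝ × ℝ × ℝ => lineHeat p.1 (p.2.1 - p.2.2)) (Ioi 0 ×ˢ univ) := by
  have hpi := Real.pi_pos
  unfold lineHeat
  refine ContinuousOn.mul (ContinuousOn.rpow_const (by fun_prop) fun p hp => Or.inl ?_)
    (ContinuousOn.rexp (ContinuousOn.div (by fun_prop) (by fun_prop) fun p hp => ?_))
  · have : 0 < p.1 := hp.1
    positivity
  · have : 0 < p.1 := hp.1
    positivity

theorem heatRegular_lineHeat : HeatRegular (fun t x y => lineHeat t (x - y))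
    (fun t x y => ((x - y) ^ 2 / (4 * t ^ 2) - 1 / (2 * t)) * lineHeat t (x - y))
    (fun t x y => -((x - y) / (2 * t)) * lineHeat t (x - y))
    (fun t x y => ((x - y) ^ 2 / (4 * t ^ 2) - 1 / (2 * t)) * lineHeat t (x - y)) := by
  have hne : ∀ p ∈ (Ioi 0 ×ˢ univ : Set (ℝ × ℝ × ℝ)), p.1 ≠ 0 := fun p hp => ne_of_gt hp.1
  have hc2 : ContinuousOn (fun p : ℝ × ℝ × ℝ => ((p.2.1 - p.2.2) ^ 2 / (4 * p.1 ^ 2) -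
      1 / (2 * p.1)) * lineHeat p.1 (p.2.1 - p.2.2)) (Ioi 0 ×ˢ univ) := by
    refine ContinuousOn.mul (ContinuousOn.sub ?_ ?_) continuousOn_lineHeat
    · exact ContinuousOn.div (by fun_prop) (by fun_prop) fun p hp => by simpa using hne p hp
    · exact ContinuousOn.div (by fun_prop) (by fun_prop) fun p hp => by simpa using hne p hp
  have hx : ∀ t x y, HasDerivAt (fun z => lineHeat t (z - y))
      (-((x - y) / (2 * t)) * lineHeat t (x - y)) x := fun t x y =>
    (hasDerivAt_lineHeat_space t (x - y)).comp_sub_const x y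
  exact
  { cont := continuousOn_lineHeat
    cont_time := hc2
    cont_space := by
      refine ContinuousOn.mul (ContinuousOn.neg ?_) continuousOn_lineHeat
      exact ContinuousOn.div (by fun_prop) (by fun_prop) fun p hp => by simpa using hne p hp
    cont_space_two := hc2
    deriv_time := fun t ht x y => hasDerivAt_lineHeat_time ht _
    deriv_space := fun t _ x y => hx t x y
    deriv_space_two := fun t ht x y => by
      have h1 : HasDerivAt (fun z => -((z - y) / (2 * t))) (-(1 / (2 * t))) x :=
        (((hasDerivAt_id x).sub_const y).div_const (2 * t)).neg
      refine (h1.mul (hx t x y)).congr_deriv ?_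
      field_simp
      ring }

/-- Comes from `sˡ/l! ≤ eˢ` with `s = z²/(4t)`: two powers of `z` are worth one of `t`. The
prefactor is bounded crudely by `t⁻¹` instead of `t^(-1/2)`, which keeps all exponents integral and
is paid for by surplus terms of the expansion. -/
theorem lineHeat_le {t : ℝ} (ht : 0 < t) (ht1 : t ≤ 1) (l : ℕ) (z : ℝ) :
    z ^ (2 * l) * lineHeat t z ≤ 4 ^ l * l ! * t ^ l * t⁻¹ := by
  have h1 : (4 * Real.pi * t) ^ (-(1 / 2 : ℝ)) ≤ t⁻¹ := by
    calc (4 * Real.pi * t) ^ (-(1 / 2 : ℝ)) ≤ t ^ (-(1 / 2 : ℝ)) :=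
          Real.rpow_le_rpow_of_nonpos ht (by nlinarith [Real.pi_gt_three]) (by norm_num)
      _ ≤ t ^ (-1 : ℝ) := Real.rpow_le_rpow_of_exponent_ge ht ht1 (by norm_num)
      _ = t⁻¹ := Real.rpow_neg_one t
  have h2 : z ^ (2 * l) * Real.exp (-z ^ 2 / (4 * t)) ≤ 4 ^ l * l ! * t ^ l := by
    have h3 := Real.pow_div_factorial_le_exp (z ^ 2 / (4 * t)) (by positivity) l
    rw [neg_div, Real.exp_neg, ← div_eq_mul_inv, div_le_iff₀ (Real.exp_pos _)]
    rw [div_le_iff₀ (by positivity), div_pow, div_le_iff₀ (by positivity), mul_pow] at h3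
    rw [pow_mul]
    linarith
  calc z ^ (2 * l) * lineHeat t z
      = (4 * Real.pi * t) ^ (-(1 / 2 : ℝ)) * (z ^ (2 * l) * Real.exp (-z ^ 2 / (4 * t))) := by
        rw [lineHeat]; ring
    _ ≤ t⁻¹ * (4 ^ l * l ! * t ^ l) :=
        mul_le_mul h1 h2 (by rw [pow_mul]; positivity) (by positivity)
    _ = _ := by ring

theorem integrable_lineHeat {t : ℝ} (ht : 0 < t) : MeasureTheory.Integrable (lineHeat t) := by
  unfold lineHeat
  refine MeasureTheory.Integrable.const_mul ?_ _
  refine (integrable_exp_neg_mul_sq (b := 1 / (4 * t)) (by positivity)).congr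
    (Eventually.of_forall fun z => ?_)
  simp only
  congr 1
  ring

theorem integral_lineHeat {t : ℝ} (ht : 0 < t) : ∫ z, lineHeat t z = 1 := by
  have h : ∀ z : ℝ, lineHeat t z =
      (4 * Real.pi * t) ^ (-(1 / 2 : ℝ)) * Real.exp (-(1 / (4 * t)) * z ^ 2) := fun z => by
    rw [lineHeat]; congr 2; ring
  have hpi := Real.pi_pos
  simp only [h]
  rw [MeasureTheory.integral_const_mul, integral_gaussian, Real.sqrt_eq_rpow,
    show Real.pi / (1 / (4 * t)) = 4 * Real.pi * t by field_simp, ← Real.rpow_add (by positivity)]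
  norm_num

/-- The factor `|z|` is absorbed by half of the exponent, `|z| ≤ 2√t e^{z²/8t}`, leaving a Gaussian
at time `2t`. The prefactors differ by `√2`, estimated by `2`. -/
theorem abs_mul_lineHeat_le {t : ℝ} (ht : 0 < t) (z : ℝ) :
    |z| * lineHeat t z ≤ 4 * Real.sqrt t * lineHeat (2 * t) z := by
  have hpi := Real.pi_pos
  have hs : 0 < Real.sqrt t := Real.sqrt_pos.2 ht
  have hss : Real.sqrt t ^ 2 = t := Real.sq_sqrt ht.le
  have h1 : |z| ≤ 2 * Real.sqrt t * Real.exp (z ^ 2 / (8 * t)) := by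
    have h2 := Real.add_one_le_exp (z ^ 2 / (8 * t))
    have h3 : |z| ≤ 2 * Real.sqrt t * (z ^ 2 / (8 * t) + 1) := by
      have h4 : 2 * Real.sqrt t * (z ^ 2 / (8 * t) + 1) =
          (|z| ^ 2 + 8 * Real.sqrt t ^ 2) / (4 * Real.sqrt t) := by
        rw [sq_abs]; nth_rewrite 2 [← hss]; field_simp; ring
      rw [h4, le_div_iff₀ (by positivity)]
      nlinarith [sq_nonneg (|z| - 2 * Real.sqrt t), sq_nonneg (Real.sqrt t)]
    exact h3.trans (by gcongr)
  have h5 : (4 * Real.pi * t) ^ (-(1 / 2 : ℝ)) ≤ 2 * (4 * Real.pi * (2 * t)) ^ (-(1 / 2 : ℝ)) := by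
    have h6 : (2 : ℝ) * (4 * Real.pi * (2 * t)) ^ (-(1 / 2 : ℝ)) =
        (4 * Real.pi * (2 * t) / 4) ^ (-(1 / 2 : ℝ)) := by
      have h4 : (4 : ℝ) ^ (1 / 2 : ℝ) = 2 := by
        rw [← Real.sqrt_eq_rpow, show (4 : ℝ) = 2 ^ 2 by norm_num, Real.sqrt_sq (by norm_num)]
      rw [Real.div_rpow (by positivity) (by norm_num), Real.rpow_neg (by norm_num : (0 : ℝ) ≤ 4), h4]
      ring
    rw [h6]
    exact Real.rpow_le_rpow_of_nonpos (by positivity) (by nlinarith) (by norm_num)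
  have h7 : Real.exp (z ^ 2 / (8 * t)) * Real.exp (-z ^ 2 / (4 * t)) =
      Real.exp (-z ^ 2 / (4 * (2 * t))) := by
    rw [← Real.exp_add]; congr 1; field_simp; ring
  calc |z| * lineHeat t z
      ≤ (2 * Real.sqrt t * Real.exp (z ^ 2 / (8 * t))) *
        ((2 * (4 * Real.pi * (2 * t)) ^ (-(1 / 2 : ℝ))) * Real.exp (-z ^ 2 / (4 * t))) := by
        unfold lineHeat
        gcongr
    _ = 4 * Real.sqrt t * ((4 * Real.pi * (2 * t)) ^ (-(1 / 2 : ℝ)) *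
        (Real.exp (z ^ 2 / (8 * t)) * Real.exp (-z ^ 2 / (4 * t)))) := by ring
    _ = _ := by rw [h7, lineHeat]

/-- Since the Gaussian has mass one, the error is at most `L ∫ |x-y| lineHeat t (x-y) dy`, and
`abs_mul_lineHeat_le` reduces this to the mass of another Gaussian. -/
theorem norm_integral_lineHeat_sub_le {E : Type*} [NormedAddCommGroup E] [NormedSpace ℝ E]
    [CompleteSpace E] {f : ℝ → E} {L : ℝ} (hf : Continuous f) (hfi : HasCompactSupport f)
    (hL : ∀ x y, ‖f x - f y‖ ≤ L * |x - y|) (hL0 : 0 ≤ L) {t : ℝ} (ht : 0 < t) (x : ℝ) :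
    ‖(∫ y, lineHeat t (x - y) • f y) - f x‖ ≤ 4 * L * Real.sqrt t := by
  have hi : ∀ s, 0 < s → MeasureTheory.Integrable fun y => lineHeat s (x - y) := fun s hs =>
    (integrable_lineHeat hs).comp_sub_left x
  have hone : ∀ s, 0 < s → ∫ y, lineHeat s (x - y) = 1 := fun s hs => by
    rw [MeasureTheory.integral_sub_left_eq_self (lineHeat s), integral_lineHeat hs]
  have hint : MeasureTheory.Integrable fun y => lineHeat t (x - y) • f y :=
    Continuous.integrable_of_hasCompactSupport
      (((continuous_lineHeat t).comp (by fun_prop)).smul hf) hfi.smul_left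
  have h1 : (∫ y, lineHeat t (x - y) • f y) - f x =
      ∫ y, (lineHeat t (x - y) • f y - lineHeat t (x - y) • f x) := by
    rw [MeasureTheory.integral_sub hint ((hi t ht).smul_const _), integral_smul_const, hone t ht,
      one_smul]
  rw [h1]
  calc ‖∫ y, (lineHeat t (x - y) • f y - lineHeat t (x - y) • f x)‖
      ≤ ∫ y, (4 * L * Real.sqrt t) * lineHeat (2 * t) (x - y) := by
        refine MeasureTheory.norm_integral_le_of_norm_le ((hi _ (by positivity)).const_mul _)
          (Eventually.of_forall fun y => ?_)
        rw [← smul_sub, norm_smul, Real.norm_of_nonneg (lineHeat_nonneg ht _)]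
        calc lineHeat t (x - y) * ‖f y - f x‖ ≤ lineHeat t (x - y) * (L * |y - x|) :=
              mul_le_mul_of_nonneg_left (hL y x) (lineHeat_nonneg ht _)
          _ = L * (|x - y| * lineHeat t (x - y)) := by rw [abs_sub_comm]; ring
          _ ≤ L * (4 * Real.sqrt t * lineHeat (2 * t) (x - y)) :=
              mul_le_mul_of_nonneg_left (abs_mul_lineHeat_le ht _) hL0
          _ = _ := by ring
    _ = 4 * L * Real.sqrt t := by
        rw [MeasureTheory.integral_const_mul, hone _ (by positivity), mul_one]

/-! ### Vanishing to finite order on the diagonal -/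

/-- On the square of side `2q` around `(x₀, x₀)`, `F(x, y) = O(|x - y|ᴹ)`. -/
def OffDiagBound {E : Type*} [NormedAddCommGroup E] (x₀ q : ℝ) (M : ℕ) (F : ℝ → ℝ → E) : Prop :=
  ∃ C, 0 ≤ C ∧ ∀ x y, |x - x₀| ≤ q → |y - x₀| ≤ q → ‖F x y‖ ≤ C * |x - y| ^ M

namespace OffDiagBound

variable {E : Type*} [NormedAddCommGroup E] {x₀ q : ℝ} {M M' : ℕ} {F F' : ℝ → ℝ → E}

theorem add (h : OffDiagBound x₀ q M F) (h' : OffDiagBound x₀ q M F') :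
    OffDiagBound x₀ q M (fun x y => F x y + F' x y) := by
  obtain ⟨C, hC, h⟩ := h
  obtain ⟨C', hC', h'⟩ := h'
  refine ⟨C + C', by positivity, fun x y hx hy => ?_⟩
  rw [add_mul]
  exact (norm_add_le _ _).trans (add_le_add (h x y hx hy) (h' x y hx hy))

theorem neg (h : OffDiagBound x₀ q M F) : OffDiagBound x₀ q M (fun x y => -F x y) := by
  obtain ⟨C, hC, h⟩ := h
  exact ⟨C, hC, fun x y hx hy => by rw [norm_neg]; exact h x y hx hy⟩

theorem zero : OffDiagBound x₀ q M (fun _ _ => (0 : E)) := ⟨0, le_rfl, by simp⟩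

theorem sum {ι : Type*} (s : Finset ι) {F : ι → ℝ → ℝ → E}
    (h : ∀ i ∈ s, OffDiagBound x₀ q M (F i)) :
    OffDiagBound x₀ q M (fun x y => ∑ i ∈ s, F i x y) := by
  classical
  induction s using Finset.induction_on with
  | empty => simpa using zero
  | insert i s hi ih =>
    simp only [Finset.sum_insert hi]
    exact (h i (Finset.mem_insert_self i s)).add
      (ih fun j hj => h j (Finset.mem_insert_of_mem hj))

theorem mono (h : OffDiagBound x₀ q M F) (hM : M' ≤ M) : OffDiagBound x₀ q M' F := by
  obtain ⟨C, hC, h⟩ := h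
  refine ⟨C * |2 * q| ^ (M - M'), by positivity, fun x y hx hy => (h x y hx hy).trans ?_⟩
  have hxy : |x - y| ≤ |2 * q| := by
    have h1 := abs_sub_le x x₀ y
    rw [abs_sub_comm x₀ y] at h1
    exact (h1.trans (by linarith)).trans (le_abs_self _)
  calc C * |x - y| ^ M = C * (|x - y| ^ (M - M') * |x - y| ^ M') := by
        rw [← pow_add, Nat.sub_add_cancel hM]
    _ ≤ C * (|2 * q| ^ (M - M') * |x - y| ^ M') := by gcongr
    _ = _ := by ring

theorem of_continuous (hF : Continuous fun p : ℝ × ℝ => F p.1 p.2) : OffDiagBound x₀ q 0 F := by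
  obtain ⟨C, hC⟩ := ((isCompact_Icc (a := x₀ - q) (b := x₀ + q)).prod
    (isCompact_Icc (a := x₀ - q) (b := x₀ + q))).exists_bound_of_continuousOn hF.continuousOn
  refine ⟨|C|, abs_nonneg C, fun x y hx hy => ?_⟩
  rw [abs_le] at hx hy
  rw [pow_zero, mul_one]
  exact (hC (x, y) ⟨⟨by linarith [hx.1], by linarith [hx.2]⟩,
    ⟨by linarith [hy.1], by linarith [hy.2]⟩⟩).trans (le_abs_self C)

theorem pow_smul [NormedSpace ℝ E] (h : OffDiagBound x₀ q M F) (j : ℕ) :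
    OffDiagBound x₀ q (j + M) (fun x y => (x - y) ^ j • F x y) := by
  obtain ⟨C, hC, h⟩ := h
  refine ⟨C, hC, fun x y hx hy => ?_⟩
  rw [norm_smul, norm_pow, Real.norm_eq_abs, pow_add]
  calc |x - y| ^ j * ‖F x y‖ ≤ |x - y| ^ j * (C * |x - y| ^ M) := by
        gcongr; exact h x y hx hy
    _ = _ := by ring

theorem mul {R : Type*} [NormedRing R] {F F' : ℝ → ℝ → R} (h : OffDiagBound x₀ q M F)
    (h' : OffDiagBound x₀ q M' F') : OffDiagBound x₀ q (M + M') (fun x y => F x y * F' x y) := by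
  obtain ⟨C, hC, h⟩ := h
  obtain ⟨C', hC', h'⟩ := h'
  refine ⟨C * C', by positivity, fun x y hx hy => ?_⟩
  calc ‖F x y * F' x y‖ ≤ ‖F x y‖ * ‖F' x y‖ := norm_mul_le _ _
    _ ≤ (C * |x - y| ^ M) * (C' * |x - y| ^ M') := by
        gcongr
        · exact h x y hx hy
        · exact h' x y hx hy
    _ = _ := by ring

/-- Taylor's theorem, uniformly on compact sets. -/
theorem taylor [NormedSpace ℝ E] (M : ℕ) : ∀ {f : ℝ → E}, ContDiff ℝ ∞ f →
    OffDiagBound x₀ q M (fun x y =>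
      f x - ∑ i ∈ Finset.range M, ((x - y) ^ i / i !) • iteratedDeriv i f y) := by
  induction M with
  | zero =>
    intro f hf
    refine of_continuous ?_
    simp only [Finset.range_zero, Finset.sum_empty, sub_zero]
    exact hf.continuous.comp continuous_fst
  | succ M ih =>
    intro f hf
    have hf' : ContDiff ℝ ∞ (deriv f) := by
      have := hf.iterate_deriv 1
      simpa using this
    obtain ⟨C, hC, h⟩ := ih hf'
    refine ⟨C, hC, fun x y hx hy => ?_⟩
    set r : ℝ → E := fun z =>
      f z - ∑ i ∈ Finset.range (M + 1), ((z - y) ^ i / i !) • iteratedDeriv i f y with hr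
    set r' : ℝ → E := fun z =>
      deriv f z - ∑ i ∈ Finset.range M, ((z - y) ^ i / i !) • iteratedDeriv i (deriv f) y with hr'
    have hd : ∀ z, HasDerivAt r (r' z) z := by
      intro z
      simp only [hr, hr', Finset.sum_range_succ' _ M]
      refine ((hf.differentiable (by simp) z).hasDerivAt).sub ?_
      simp only [pow_zero, Nat.factorial_zero, Nat.cast_one, div_one, one_smul]
      refine HasDerivAt.add_const _ (HasDerivAt.fun_sum fun i _ => ?_)
      rw [← iteratedDeriv_succ']
      refine HasDerivAt.smul_const ?_ _
      have h1 := ((hasDerivAt_pow (i + 1) (z - y)).comp_sub_const z y).div_const (((i + 1)! : ℕ) : ℝ)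
      refine h1.congr_deriv ?_
      rw [Nat.factorial_succ, Nat.add_sub_cancel]
      have : (i ! : ℝ) ≠ 0 := by exact_mod_cast i.factorial_ne_zero
      push_cast
      field_simp
    have hry : r y = 0 := by
      simp [hr, Finset.sum_range_succ']
    have hbound : ∀ z ∈ uIcc y x, ‖r' z‖ ≤ C * |x - y| ^ M := by
      intro z hz
      have hzq : |z - x₀| ≤ q := by
        rw [abs_le] at hx hy ⊢
        rcases mem_uIcc.1 hz with hz | hz <;> constructor <;> linarith [hz.1, hz.2]
      have hzy : |z - y| ≤ |x - y| := abs_sub_left_of_mem_uIcc hz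
      exact (h z y hzq hy).trans (by gcongr)
    -- The remainder vanishes at `y` and its derivative is the remainder of `deriv f` of one order
    -- less, so the mean value inequality gains one power of `|x-y|`.
    have hmv := (convex_uIcc y x).norm_image_sub_le_of_norm_hasDerivWithin_le
      (fun z _ => (hd z).hasDerivWithinAt) hbound left_mem_uIcc right_mem_uIcc
    rw [hry, sub_zero, Real.norm_eq_abs] at hmv
    calc ‖r x‖ ≤ C * |x - y| ^ M * |x - y| := hmv
      _ = _ := by ring

end OffDiagBound

/-! ### The coefficients of the parametrix -/

/-- `e k m y` are the values at `x = y` of the `m`-th `x`-derivatives of the off-diagonal heat kernel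
coefficients `a_k(x, y)` for the potential `V`. -/
structure IsOffDiagJet {R : Type*} [NormedRing R] [NormedAlgebra ℝ R] (V : ℝ → R)
    (e : ℕ → ℕ → ℝ → R) : Prop where
  smooth : ContDiff ℝ ∞ V
  continuous : ∀ k m, Continuous (e k m)
  zero_zero : ∀ y, e 0 0 y = 1
  zero_succ : ∀ m y, e 0 (m + 1) y = 0
  succ : ∀ k m y, (k + 1 + m) • e (k + 1) m y =
    (k + 1) • (-e k (m + 2) y + ∑ ij ∈ Finset.HasAntidiagonal.antidiagonal m, m.choose ij.1 •
      (iteratedDeriv ij.1 V y * e k ij.2 y))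

section Coefficients

variable {R : Type*} [NormedRing R] [NormedAlgebra ℝ R]

/-- The coefficient of `tᵏ (x - y)ᵐ` in the parametrix, as a function of `y`. -/
noncomputable def parCoeff (e : ℕ → ℕ → ℝ → R) (k m : ℕ) (y : ℝ) : R :=
  ((-1 : ℝ) ^ k / (k ! * m !)) • e k m y

variable {V : ℝ → R} {e : ℕ → ℕ → ℝ → R}

theorem continuous_parCoeff (he : IsOffDiagJet V e) (k m : ℕ) : Continuous (parCoeff e k m) :=
  (he.continuous k m).const_smul _

theorem parCoeff_zero_zero (he : IsOffDiagJet V e) (y : ℝ) : parCoeff e 0 0 y = 1 := by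
  simp [parCoeff, he.zero_zero]

theorem parCoeff_zero_succ (he : IsOffDiagJet V e) (m : ℕ) (y : ℝ) : parCoeff e 0 (m + 1) y = 0 := by
  simp [parCoeff, he.zero_succ]

theorem parCoeff_succ (he : IsOffDiagJet V e) (k m : ℕ) (y : ℝ) :
    ((k : ℝ) + 1 + m) • parCoeff e (k + 1) m y =
      (((m : ℝ) + 2) * (m + 1)) • parCoeff e k (m + 2) y -
        ∑ ij ∈ Finset.HasAntidiagonal.antidiagonal m,
          ((1 : ℝ) / ij.1 !) • (iteratedDeriv ij.1 V y * parCoeff e k ij.2 y) := by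
  have hk : (k ! : ℝ) ≠ 0 := by exact_mod_cast k.factorial_ne_zero
  have hm : (m ! : ℝ) ≠ 0 := by exact_mod_cast m.factorial_ne_zero
  have hk1 : (k : ℝ) + 1 ≠ 0 := by positivity
  have hm1 : (m : ℝ) + 1 ≠ 0 := by positivity
  have hm2 : (m : ℝ) + 1 + 1 ≠ 0 := by positivity
  have h := congrArg (fun z => ((-1 : ℝ) ^ (k + 1) / ((k + 1)! * m !)) • z)
    (he.succ k m y)
  simp only [← Nat.cast_smul_eq_nsmul ℝ] at h
  push_cast at h
  simp only [parCoeff]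
  rw [smul_comm, h, smul_smul, smul_add, smul_neg, sub_eq_add_neg, smul_smul, Finset.smul_sum,
    ← Finset.sum_neg_distrib]
  congr 1
  · rw [← neg_smul]
    congr 1
    rw [Nat.factorial_succ, Nat.factorial_succ (m + 1), Nat.factorial_succ m]
    push_cast
    field_simp
    ring
  · refine Finset.sum_congr rfl fun ij hij => ?_
    rw [Finset.HasAntidiagonal.mem_antidiagonal] at hij
    subst hij
    have h1 : (ij.1 ! : ℝ) ≠ 0 := by exact_mod_cast ij.1.factorial_ne_zero
    have h2 : (ij.2 ! : ℝ) ≠ 0 := by exact_mod_cast ij.2.factorial_ne_zero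
    rw [mul_smul_comm, smul_smul, smul_smul, ← neg_smul]
    congr 1
    rw [Nat.cast_add_choose, Nat.factorial_succ]
    push_cast
    field_simp
    ring

/-- The polynomial in `x - y` that multiplies `tᵏ` in the parametrix. -/
noncomputable def parPoly (e : ℕ → ℕ → ℝ → R) (k M : ℕ) (x y : ℝ) : R :=
  ∑ m ∈ Finset.range M, (x - y) ^ m • parCoeff e k m y

/-- The `x`-derivative of `parPoly`. -/
noncomputable def parPolyD (e : ℕ → ℕ → ℝ → R) (k M : ℕ) (x y : ℝ) : R :=
  ∑ m ∈ Finset.range M, (m * (x - y) ^ (m - 1)) • parCoeff e k m y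

/-- The second `x`-derivative of `parPoly`. -/
noncomputable def parPolyDD (e : ℕ → ℕ → ℝ → R) (k M : ℕ) (x y : ℝ) : R :=
  ∑ m ∈ Finset.range M, (m * ((m - 1 : ℕ) * (x - y) ^ (m - 2))) • parCoeff e k m y

theorem offDiagBound_parPoly (he : IsOffDiagJet V e) (x₀ q : ℝ) (k M : ℕ) :
    OffDiagBound x₀ q 0 (parPoly e k M) := by
  refine OffDiagBound.of_continuous ?_
  have h := fun m => continuous_parCoeff he k m
  unfold parPoly
  fun_prop

theorem offDiagBound_parPolyD (he : IsOffDiagJet V e) (x₀ q : ℝ) (k M : ℕ) :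
    OffDiagBound x₀ q 0 (parPolyD e k M) := by
  refine OffDiagBound.of_continuous ?_
  have h := fun m => continuous_parCoeff he k m
  unfold parPolyD
  fun_prop

theorem offDiagBound_parPolyDD (he : IsOffDiagJet V e) (x₀ q : ℝ) (k M : ℕ) :
    OffDiagBound x₀ q 0 (parPolyDD e k M) := by
  refine OffDiagBound.of_continuous ?_
  have h := fun m => continuous_parCoeff he k m
  unfold parPolyDD
  fun_prop

theorem parPoly_zero (he : IsOffDiagJet V e) {M : ℕ} (hM : M ≠ 0) (x y : ℝ) : parPoly e 0 M x y = 1 := by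
  obtain ⟨M, rfl⟩ := Nat.exists_eq_succ_of_ne_zero hM
  rw [parPoly, Finset.sum_range_succ', Finset.sum_eq_zero fun m _ => by
    rw [parCoeff_zero_succ he, smul_zero], parCoeff_zero_zero he]
  simp

theorem parPolyD_zero (he : IsOffDiagJet V e) (M : ℕ) (x y : ℝ) : parPolyD e 0 M x y = 0 := by
  refine Finset.sum_eq_zero fun m _ => ?_
  cases m with
  | zero => simp
  | succ m => rw [parCoeff_zero_succ he, smul_zero]

theorem parPoly_diag {M : ℕ} (hM : M ≠ 0) (k : ℕ) (x : ℝ) :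
    parPoly e k M x x = parCoeff e k 0 x := by
  obtain ⟨M, rfl⟩ := Nat.exists_eq_succ_of_ne_zero hM
  simp [parPoly, Finset.sum_range_succ']

/-- The error in the `k`-th transport equation. -/
noncomputable def transportError (V : ℝ → R) (e : ℕ → ℕ → ℝ → R) (k M : ℕ) (x y : ℝ) : R :=
  ((k : ℝ) + 1) • parPoly e (k + 1) M x y + (x - y) • parPolyD e (k + 1) M x y -
    parPolyDD e k (M + 2) x y + V x * parPoly e k (M + 2) x y

/-- The recursion `parCoeff_succ` cancels all complete coefficients of `(x-y)ʲ`, `j < M`. There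
remain the Taylor remainders of `V` and the two top terms of `parPoly e k (M+2)`. The lengths `M`
and `M + 2` match because the second derivative lowers the degree by two. -/
theorem transportError_eq (he : IsOffDiagJet V e) (k M : ℕ) (x y : ℝ) : transportError V e k M x y =
    ∑ j ∈ Finset.range M, (x - y) ^ j • ((V x - ∑ i ∈ Finset.range (M - j),
        ((x - y) ^ i / i !) • iteratedDeriv i V y) * parCoeff e k j y) +
      ((x - y) ^ M • (V x * parCoeff e k M y) +
        (x - y) ^ (M + 1) • (V x * parCoeff e k (M + 1) y)) := by
  have h1 : ((k : ℝ) + 1) • parPoly e (k + 1) M x y + (x - y) • parPolyD e (k + 1) M x y =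
      ∑ m ∈ Finset.range M, (x - y) ^ m • (((k : ℝ) + 1 + m) • parCoeff e (k + 1) m y) := by
    rw [parPoly, parPolyD, Finset.smul_sum, Finset.smul_sum, ← Finset.sum_add_distrib]
    refine Finset.sum_congr rfl fun m _ => ?_
    rw [smul_smul, smul_smul, smul_smul, ← add_smul]
    congr 1
    cases m with
    | zero => simp
    | succ m => rw [Nat.add_sub_cancel]; ring
  have h2 : parPolyDD e k (M + 2) x y =
      ∑ m ∈ Finset.range M, (x - y) ^ m • ((((m : ℝ) + 2) * (m + 1)) • parCoeff e k (m + 2) y) := by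
    rw [parPolyDD, Finset.sum_range_succ', Finset.sum_range_succ']
    simp only [Nat.cast_zero, zero_mul, zero_smul, add_zero, zero_add, Nat.sub_self, mul_zero]
    refine Finset.sum_congr rfl fun m _ => ?_
    rw [smul_smul]
    congr 1
    simp only [Nat.add_sub_cancel]
    push_cast
    ring
  have h3 : V x * parPoly e k (M + 2) x y =
      ∑ j ∈ Finset.range M, (x - y) ^ j • (V x * parCoeff e k j y) +
        ((x - y) ^ M • (V x * parCoeff e k M y) +
        (x - y) ^ (M + 1) • (V x * parCoeff e k (M + 1) y)) := by
    rw [parPoly, Finset.sum_range_succ, Finset.sum_range_succ, mul_add, mul_add, Finset.mul_sum]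
    simp only [mul_smul_comm, add_assoc]
  have h4 : ∑ m ∈ Finset.range M, (x - y) ^ m • ∑ ij ∈ Finset.HasAntidiagonal.antidiagonal m,
        ((1 : ℝ) / ij.1 !) • (iteratedDeriv ij.1 V y * parCoeff e k ij.2 y) =
      ∑ j ∈ Finset.range M, (x - y) ^ j • ((∑ i ∈ Finset.range (M - j),
        ((x - y) ^ i / i !) • iteratedDeriv i V y) * parCoeff e k j y) := by
    have h5 := Finset.sum_range_diag_flip M fun j i => (x - y) ^ j •
      (((x - y) ^ i / i !) • iteratedDeriv i V y * parCoeff e k j y)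
    simp only [Finset.sum_mul, Finset.smul_sum]
    rw [← h5]
    refine Finset.sum_congr rfl fun m _ => ?_
    rw [← Finset.Nat.sum_antidiagonal_swap,
      ← Finset.Nat.sum_antidiagonal_eq_sum_range_succ (fun j i => (x - y) ^ j •
        (((x - y) ^ i / i !) • iteratedDeriv i V y * parCoeff e k j y))]
    refine Finset.sum_congr rfl fun ij hij => ?_
    rw [Finset.HasAntidiagonal.mem_antidiagonal] at hij
    simp only [Prod.fst_swap, Prod.snd_swap]
    rw [smul_mul_assoc, smul_smul, smul_smul, ← hij, pow_add]
    congr 1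
    ring
  rw [transportError, h1, h2, h3, ← add_assoc]
  simp only [parCoeff_succ he, smul_sub, Finset.sum_sub_distrib, sub_mul]
  rw [h4]
  abel

theorem offDiagBound_transportError (he : IsOffDiagJet V e) (x₀ q : ℝ) (k M : ℕ) :
    OffDiagBound x₀ q M (transportError V e k M) := by
  have hc : ∀ m, OffDiagBound x₀ q 0 fun _ y => parCoeff e k m y := fun m =>
    OffDiagBound.of_continuous ((continuous_parCoeff he k m).comp continuous_snd)
  have hVb : OffDiagBound x₀ q 0 fun x _ => V x :=
    OffDiagBound.of_continuous (he.smooth.continuous.comp continuous_fst)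
  rw [show transportError V e k M = _ from funext₂ (transportError_eq he k M)]
  refine (OffDiagBound.sum _ fun j hj => ?_).add (OffDiagBound.add ?_ ?_)
  · rw [Finset.mem_range] at hj
    have h := ((OffDiagBound.taylor (x₀ := x₀) (q := q) (M - j) he.smooth).mul (hc j)).pow_smul j
    exact h.mono (by omega)
  · exact ((hVb.mul (hc M)).pow_smul M).mono (by omega)
  · exact ((hVb.mul (hc (M + 1))).pow_smul (M + 1)).mono (by omega)

end Coefficients

/-! ### The parametrix -/

section Parametrix

variable {R : Type*} [NormedRing R] [NormedAlgebra ℝ R]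

theorem OffDiagBound.exists_bound_sum {x₀ q : ℝ} {M : ℕ} {F : ℕ → ℝ → ℝ → R} (n : ℕ)
    (h : ∀ k ∈ Finset.range n, OffDiagBound x₀ q M (F k)) :
    ∃ C, 0 ≤ C ∧ ∀ t x y : ℝ, 0 < t → t ≤ 1 → |x - x₀| ≤ q → |y - x₀| ≤ q →
      ‖∑ k ∈ Finset.range n, t ^ k • F k x y‖ ≤ C * |x - y| ^ M := by
  induction n with
  | zero => exact ⟨0, le_rfl, by simp⟩
  | succ n ih =>
    obtain ⟨C, hC, hb⟩ := ih fun k hk => h k (Finset.mem_range.2 (by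
      have := Finset.mem_range.1 hk; omega))
    obtain ⟨C', hC', hb'⟩ := h n (Finset.self_mem_range_succ n)
    refine ⟨C + C', by positivity, fun t x y ht ht1 hx hy => ?_⟩
    rw [Finset.sum_range_succ, add_mul]
    refine (norm_add_le _ _).trans (add_le_add (hb t x y ht ht1 hx hy) ?_)
    rw [norm_smul, norm_pow, Real.norm_of_nonneg ht.le]
    calc t ^ n * ‖F n x y‖ ≤ 1 * ‖F n x y‖ := by
          gcongr; exact pow_le_one₀ ht.le ht1
      _ ≤ C' * |x - y| ^ M := by rw [one_mul]; exact hb' x y hx hy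

/-- The heat operator applied to `∑ tᵏ pₖ`, conjugated by the Gaussian, in terms of the transport
equations. -/
theorem sum_transport (p pD pDD : ℕ → R) (v : R) {t z : ℝ} (ht : t ≠ 0) (n : ℕ) :
    (∑ k ∈ Finset.range (n + 1), (k * t ^ (k - 1)) • p k) +
      (z / t) • (∑ k ∈ Finset.range (n + 1), t ^ k • pD k) -
      (∑ k ∈ Finset.range (n + 1), t ^ k • pDD k) +
      v * (∑ k ∈ Finset.range (n + 1), t ^ k • p k) =
    (z / t) • pD 0 + (∑ k ∈ Finset.range n, t ^ k •
      (((k : ℝ) + 1) • p (k + 1) + z • pD (k + 1) - pDD k + v * p k)) +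
      t ^ n • (v * p n - pDD n) := by
  induction n with
  | zero => simp; abel
  | succ n ih =>
    have h : (z / t) • t ^ (n + 1) • pD (n + 1) = t ^ n • z • pD (n + 1) := by
      rw [smul_smul, smul_smul]; congr 1; field_simp; ring
    rw [Finset.sum_range_succ (fun k : ℕ => ((k : ℝ) * t ^ (k - 1)) • p k) (n + 1),
      Finset.sum_range_succ (fun k => t ^ k • pD k) (n + 1),
      Finset.sum_range_succ (fun k => t ^ k • pDD k) (n + 1),
      Finset.sum_range_succ (fun k => t ^ k • p k) (n + 1),
      Finset.sum_range_succ (fun k => t ^ k •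
        (((k : ℝ) + 1) • p (k + 1) + z • pD (k + 1) - pDD k + v * p k)) n, mul_add, smul_add, h, mul_smul_comm, Nat.add_sub_cancel]
    push_cast
    linear_combination (norm := module) ih

/-- The polynomial factor of the parametrix, with `n + 1` powers of `t`. -/
noncomputable def parSum (e : ℕ → ℕ → ℝ → R) (n l : ℕ) (t x y : ℝ) : R :=
  ∑ k ∈ Finset.range (n + 1), t ^ k • parPoly e k (2 * (l + (n - k))) x y

/-- The parametrix with cutoff `χ`. -/
noncomputable def parametrix (χ : ℝ → ℝ) (e : ℕ → ℕ → ℝ → R) (n l : ℕ) (t x y : ℝ) : R :=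
  χ x • lineHeat t (x - y) • parSum e n l t x y

variable {V : ℝ → R} {e : ℕ → ℕ → ℝ → R}

theorem heatRegular_parSum (he : IsOffDiagJet V e) (n l : ℕ) : HeatRegular (parSum e n l)
    (fun t x y => ∑ k ∈ Finset.range (n + 1),
      (k * t ^ (k - 1)) • parPoly e k (2 * (l + (n - k))) x y)
    (fun t x y => ∑ k ∈ Finset.range (n + 1), t ^ k • parPolyD e k (2 * (l + (n - k))) x y)
    (fun t x y => ∑ k ∈ Finset.range (n + 1), t ^ k • parPolyDD e k (2 * (l + (n - k))) x y) := by
  have h := HeatRegular.sum (Finset.range (n + 1)) fun k _ =>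
    HeatRegular.sum (Finset.range (2 * (l + (n - k)))) fun m _ =>
      HeatRegular.monomial k m (continuous_parCoeff he k m)
  unfold parSum
  simpa only [parPoly, parPolyD, parPolyDD, Finset.smul_sum, smul_smul] using h

/-- The Gaussian solves the free heat equation, so three kinds of error survive: transport errors,
small like `|x-y|^(2(n+2))`; the uncancelled top term, carrying `t^(n+1)`; and terms with
derivatives of `χ`, small off the diagonal by assumption. Powers of `|x-y|` become powers of `t`
through `lineHeat_le`. -/
theorem exists_parametrix_residual (he : IsOffDiagJet V e) {χ : ℝ → ℝ} (hχ : ContDiff ℝ ∞ χ)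
    (hχ1 : ∀ x, |χ x| ≤ 1) {x₀ q ρ A : ℝ} (hρ : ρ ≤ q) (n : ℕ) (hA : 0 ≤ A)
    (hχ' : ∀ x y, |x - x₀| ≤ q → |y - x₀| ≤ ρ → |deriv χ x| ≤ A * |x - y| ^ (2 * (n + 2)))
    (hχ'' : ∀ x y, |x - x₀| ≤ q → |y - x₀| ≤ ρ →
      |deriv (deriv χ) x| ≤ A * |x - y| ^ (2 * (n + 2))) :
    ∃ Ht Hx Hxx, HeatRegular (parametrix χ e (n + 1) (n + 2)) Ht Hx Hxx ∧ ∃ C, 0 ≤ C ∧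
      ∀ t, 0 < t → t ≤ 1 → ∀ x y, |x - x₀| ≤ q → |y - x₀| ≤ ρ →
        ‖Ht t x y - Hxx t x y + V x * parametrix χ e (n + 1) (n + 2) t x y‖ ≤ C * t ^ n := by
  -- At least `2(n+2)` powers of `x-y` are worth `n+2` powers of `t`. One is lost to the bound `t⁻¹`
  -- of the prefactor and, in the cutoff terms, one more to the derivative of the Gaussian, leaving
  -- `tⁿ`.
  set M : ℕ → ℕ := fun k => 2 * (n + 2 + (n + 1 - k)) with hM
  have hreg := (HeatRegular.of_space hχ).smul
    (heatRegular_lineHeat.smul (heatRegular_parSum he (n + 1) (n + 2)))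
  refine ⟨_, _, _, hreg, ?_⟩
  obtain ⟨CP, hCP, hP⟩ := OffDiagBound.exists_bound_sum (x₀ := x₀) (q := q) (n + 2) fun k _ =>
    offDiagBound_parPoly he x₀ q k (M k)
  obtain ⟨CX, hCX, hX⟩ := OffDiagBound.exists_bound_sum (x₀ := x₀) (q := q) (n + 2) fun k _ =>
    offDiagBound_parPolyD he x₀ q k (M k)
  obtain ⟨CT, hCT, hT⟩ := OffDiagBound.exists_bound_sum (x₀ := x₀) (q := q) (n + 1) fun k _ =>
    (offDiagBound_transportError he x₀ q k (M (k + 1))).mono (M' := 2 * (n + 2)) (by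
      simp only [hM]; omega)
  have hVb : OffDiagBound x₀ q 0 fun x _ => V x :=
    OffDiagBound.of_continuous (he.smooth.continuous.comp continuous_fst)
  obtain ⟨CR, hCR, hR⟩ := (hVb.mul (offDiagBound_parPoly he x₀ q (n + 1) (M (n + 1)))).add
    (offDiagBound_parPolyDD he x₀ q (n + 1) (M (n + 1))).neg
  set B : ℝ := 4 ^ (n + 2) * ((n + 2)! : ℕ) with hB
  have hB0 : 0 ≤ B := by positivity
  refine ⟨CT * B + CR + 2 * A * B * (CX + |q| * CP) + A * B * CP, by positivity,
    fun t ht ht1 x y hx hy => ?_⟩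
  have hyq := hy.trans hρ
  have hxy : |x - y| ≤ 2 * |q| := by
    have h1 := abs_sub_le x x₀ y
    rw [abs_sub_comm x₀ y] at h1
    linarith [le_abs_self q]
  set z : ℝ := x - y with hz
  set G : ℝ := lineHeat t z with hG
  have hG0 : 0 ≤ G := lineHeat_nonneg ht z
  have hG1 : G ≤ t⁻¹ := by
    have := lineHeat_le ht ht1 0 z
    simpa using this
  have hGB : |z| ^ (2 * (n + 2)) * G ≤ B * t ^ (n + 1) := by
    have h1 := lineHeat_le ht ht1 (n + 2) z
    rw [pow_mul, sq_abs, ← pow_mul]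
    refine h1.trans_eq ?_
    rw [hB, pow_succ t (n + 1)]
    field_simp
  have hGn : G * t ^ (n + 1) ≤ t ^ n := by
    calc G * t ^ (n + 1) ≤ t⁻¹ * t ^ (n + 1) := by gcongr
      _ = t ^ n := by rw [pow_succ]; field_simp
  have htn : t ^ (n + 1) ≤ t ^ n := pow_le_pow_of_le_one ht.le ht1 (Nat.le_succ n)
  set P : R := ∑ k ∈ Finset.range (n + 2), t ^ k • parPoly e k (M k) x y with hPdef
  set PX : R := ∑ k ∈ Finset.range (n + 2), t ^ k • parPolyD e k (M k) x y with hPXdef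
  set S : R := ∑ k ∈ Finset.range (n + 1), t ^ k • transportError V e k (M (k + 1)) x y with hS
  set T : R := V x * parPoly e (n + 1) (M (n + 1)) x y + -parPolyDD e (n + 1) (M (n + 1)) x y
    with hTdef
  have hP := hP t x y ht ht1 hx hyq
  have hX := hX t x y ht ht1 hx hyq
  have hT := hT t x y ht ht1 hx hyq
  have hR := hR x y hx hyq
  simp only [← hPdef, ← hPXdef, ← hS, ← hTdef, pow_zero, mul_one, zero_add] at hP hX hT hR
  have htrans := sum_transport (fun k => parPoly e k (M k) x y) (fun k => parPolyD e k (M k) x y)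
    (fun k => parPolyDD e k (M k) x y) (V x) (z := z) ht.ne' (n + 1)
  have hSeq : ∑ k ∈ Finset.range (n + 1), t ^ k • (((k : ℝ) + 1) • parPoly e (k + 1) (M (k + 1)) x y +
      z • parPolyD e (k + 1) (M (k + 1)) x y - parPolyDD e k (M k) x y +
      V x * parPoly e k (M k) x y) = S := by
    refine Finset.sum_congr rfl fun k hk => ?_
    have hMk : M k = M (k + 1) + 2 := by
      have := Finset.mem_range.1 hk
      simp only [hM]; omega
    rw [transportError, hMk]
  simp only [parPolyD_zero he, smul_zero, zero_add, hSeq, sub_eq_add_neg (V x * _)] at htrans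
  rw [← hPdef, ← hPXdef, ← hTdef] at htrans
  simp only [parametrix, parSum]
  simp only [← hz, ← hG]
  -- The product rule for `χ · (G · P)`, written out with the derivatives of `heatRegular_lineHeat`;
  -- the zero scalar is the time derivative of `χ`.
  change ‖χ x • (G • (∑ k ∈ Finset.range (n + 2), (k * t ^ (k - 1)) • parPoly e k (M k) x y) +
      ((z ^ 2 / (4 * t ^ 2) - 1 / (2 * t)) * G) • P) + (0 : ℝ) • (G • P) -
    (χ x • (G • (∑ k ∈ Finset.range (n + 2), t ^ k • parPolyDD e k (M k) x y) +
        (-(z / (2 * t)) * G) • PX + ((-(z / (2 * t)) * G) • PX +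
          ((z ^ 2 / (4 * t ^ 2) - 1 / (2 * t)) * G) • P)) +
      deriv χ x • (G • PX + (-(z / (2 * t)) * G) • P) +
      (deriv χ x • (G • PX + (-(z / (2 * t)) * G) • P) + deriv (deriv χ) x • (G • P))) +
    V x * (χ x • G • P)‖ ≤ _
  have hmain : χ x • (G • (∑ k ∈ Finset.range (n + 2), (k * t ^ (k - 1)) • parPoly e k (M k) x y) +
      ((z ^ 2 / (4 * t ^ 2) - 1 / (2 * t)) * G) • P) + (0 : ℝ) • (G • P) -
    (χ x • (G • (∑ k ∈ Finset.range (n + 2), t ^ k • parPolyDD e k (M k) x y) +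
        (-(z / (2 * t)) * G) • PX + ((-(z / (2 * t)) * G) • PX +
          ((z ^ 2 / (4 * t ^ 2) - 1 / (2 * t)) * G) • P)) +
      deriv χ x • (G • PX + (-(z / (2 * t)) * G) • P) +
      (deriv χ x • (G • PX + (-(z / (2 * t)) * G) • P) + deriv (deriv χ) x • (G • P))) +
    V x * (χ x • G • P) =
    (χ x * G) • S + (χ x * G * t ^ (n + 1)) • T -
      (2 * deriv χ x * G) • (PX - (z / (2 * t)) • P) - (deriv (deriv χ) x * G) • P := by
    rw [mul_smul_comm, mul_smul_comm]
    -- The coefficient `z/t` in `sum_transport` is the cross term `-2 G_x P_x` divided by `G`.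
    have h2 : z / t = 2 * (z / (2 * t)) := by field_simp
    rw [h2] at htrans
    linear_combination (norm := module) (χ x * G) • htrans
  rw [hmain]
  have hχx := hχ1 x
  have e1 : ‖(χ x * G) • S‖ ≤ CT * B * t ^ n := by
    rw [norm_smul, norm_mul, Real.norm_of_nonneg hG0, Real.norm_eq_abs]
    calc |χ x| * G * ‖S‖ ≤ 1 * G * (CT * |z| ^ (2 * (n + 2))) := by gcongr
      _ = CT * (|z| ^ (2 * (n + 2)) * G) := by ring
      _ ≤ CT * (B * t ^ n) := mul_le_mul_of_nonneg_left
        (hGB.trans (mul_le_mul_of_nonneg_left htn hB0)) hCT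
      _ = _ := by ring
  have e2 : ‖(χ x * G * t ^ (n + 1)) • T‖ ≤ CR * t ^ n := by
    rw [norm_smul, norm_mul, norm_mul, Real.norm_of_nonneg hG0, Real.norm_eq_abs,
      Real.norm_of_nonneg (by positivity)]
    calc |χ x| * G * t ^ (n + 1) * ‖T‖ ≤ 1 * G * t ^ (n + 1) * CR := by gcongr
      _ = CR * (G * t ^ (n + 1)) := by ring
      _ ≤ CR * t ^ n := by gcongr
  have e3 : ‖(2 * deriv χ x * G) • (PX - (z / (2 * t)) • P)‖ ≤
      2 * A * B * (CX + |q| * CP) * t ^ n := by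
    have h3 : ‖PX - (z / (2 * t)) • P‖ ≤ t⁻¹ * (CX + |q| * CP) := by
      have h4 : ‖z / (2 * t)‖ ≤ t⁻¹ * |q| := by
        rw [norm_div, Real.norm_eq_abs, Real.norm_of_nonneg (by positivity : 0 ≤ 2 * t),
          div_le_iff₀ (by positivity)]
        calc |z| ≤ 2 * |q| := hxy
          _ = _ := by field_simp
      have h5 : 1 ≤ t⁻¹ := (one_le_inv₀ ht).2 ht1
      calc ‖PX - (z / (2 * t)) • P‖ ≤ ‖PX‖ + ‖(z / (2 * t)) • P‖ := norm_sub_le _ _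
        _ ≤ 1 * CX + t⁻¹ * |q| * CP := by
          rw [norm_smul, one_mul]
          gcongr
        _ ≤ t⁻¹ * CX + t⁻¹ * |q| * CP := by gcongr
        _ = _ := by ring
    rw [norm_smul, norm_mul, norm_mul, Real.norm_of_nonneg hG0, Real.norm_ofNat,
      Real.norm_eq_abs]
    calc 2 * |deriv χ x| * G * ‖PX - (z / (2 * t)) • P‖
        ≤ 2 * (A * |z| ^ (2 * (n + 2))) * G * (t⁻¹ * (CX + |q| * CP)) := by
          gcongr
          exact hχ' x y hx hy
      _ = 2 * A * (|z| ^ (2 * (n + 2)) * G) * (t⁻¹ * (CX + |q| * CP)) := by ring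
      _ ≤ 2 * A * (B * t ^ (n + 1)) * (t⁻¹ * (CX + |q| * CP)) := by gcongr
      _ = _ := by rw [pow_succ]; field_simp
  have e4 : ‖(deriv (deriv χ) x * G) • P‖ ≤ A * B * CP * t ^ n := by
    rw [norm_smul, norm_mul, Real.norm_of_nonneg hG0, Real.norm_eq_abs]
    calc |deriv (deriv χ) x| * G * ‖P‖ ≤ (A * |z| ^ (2 * (n + 2))) * G * CP := by
          gcongr
          exact hχ'' x y hx hy
      _ = A * (|z| ^ (2 * (n + 2)) * G) * CP := by ring
      _ ≤ A * (B * t ^ n) * CP := mul_le_mul_of_nonneg_right (mul_le_mul_of_nonneg_left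
        (hGB.trans (mul_le_mul_of_nonneg_left htn hB0)) hA) hCP
      _ = _ := by ring
  calc _ ≤ CT * B * t ^ n + CR * t ^ n + 2 * A * B * (CX + |q| * CP) * t ^ n +
        A * B * CP * t ^ n :=
        (norm_sub_le _ _).trans (add_le_add ((norm_sub_le _ _).trans
          (add_le_add ((norm_add_le _ _).trans (add_le_add e1 e2)) e3)) e4)
    _ = _ := by ring

end Parametrix

/-! ### The initial condition for the parametrix -/

/-- Replacing `h` by `f` costs `Ct`, since the truncated Gaussian has mass at most one; replacing
the Gaussian average of `f` by `f` costs `4L√t`. The cutoff is invisible in the limit because it is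
`1` on the support of `f`. -/
theorem tendstoUniformlyOn_lineHeat {E : Type*} [NormedAddCommGroup E] [NormedSpace ℝ E]
    [CompleteSpace E] {f : ℝ → E} (hf : ContDiff ℝ ∞ f) {x₀ q ρ C : ℝ} (hρ : ρ ≤ q) (hq : 0 ≤ q)
    (hsupp : ∀ y, ρ < |y - x₀| → f y = 0) {χ : ℝ → ℝ} (hχ1 : ∀ x, |χ x| ≤ 1)
    (hχ : ∀ x, |x - x₀| ≤ ρ → χ x = 1) {h : ℝ → ℝ → ℝ → E}
    (hh : ∀ t, 0 < t → ∀ x, Continuous (h t x))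
    (hC : ∀ t, 0 < t → t ≤ 1 → ∀ x y, |x - x₀| ≤ q → |y - x₀| ≤ q → ‖h t x y - f y‖ ≤ C * t) :
    TendstoUniformlyOn (fun t x => ∫ y in (x₀ - q)..(x₀ + q), χ x • lineHeat t (x - y) • h t x y) f
      (𝓝[>] 0) (Icc (x₀ - q) (x₀ + q)) := by
  have hmem : ∀ x, x ∈ Icc (x₀ - q) (x₀ + q) → |x - x₀| ≤ q := fun x hx => by
    rw [abs_le]; constructor <;> linarith [hx.1, hx.2]
  have hle : x₀ - q ≤ x₀ + q := by linarith
  have hfc : HasCompactSupport f := by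
    refine HasCompactSupport.intro (isCompact_Icc (a := x₀ - ρ) (b := x₀ + ρ)) fun y hy => ?_
    refine hsupp y (not_le.1 fun hy' => hy ?_)
    rw [abs_le] at hy'
    constructor <;> linarith [hy'.1, hy'.2]
  obtain ⟨L, hL⟩ := hf.lipschitzWith_of_hasCompactSupport hfc (by simp)
  have hL' : ∀ x y, ‖f x - f y‖ ≤ (L : ℝ) * |x - y| := fun x y => hL.norm_sub_le x y
  have hbound : ∀ t, 0 < t → t ≤ 1 → ∀ x ∈ Icc (x₀ - q) (x₀ + q),
      ‖f x - ∫ y in (x₀ - q)..(x₀ + q), χ x • lineHeat t (x - y) • h t x y‖ ≤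
        C * t + 4 * L * Real.sqrt t := by
    intro t ht ht1 x hx
    have hG : Continuous fun y => lineHeat t (x - y) :=
      (continuous_lineHeat t).comp (continuous_const.sub continuous_id)
    have hGi : MeasureTheory.Integrable fun y => lineHeat t (x - y) :=
      (integrable_lineHeat ht).comp_sub_left x
    have hG1 : ∫ y in (x₀ - q)..(x₀ + q), lineHeat t (x - y) ≤ 1 := by
      rw [intervalIntegral.integral_of_le hle]
      refine (MeasureTheory.setIntegral_le_integral hGi
        (Eventually.of_forall fun y => lineHeat_nonneg ht _)).trans_eq ?_
      rw [MeasureTheory.integral_sub_left_eq_self (lineHeat t) _ x, integral_lineHeat ht]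
    have hC0 : 0 ≤ C := by
      have := (norm_nonneg _).trans (hC t ht ht1 x x (hmem x hx) (hmem x hx))
      exact nonneg_of_mul_nonneg_left this ht
    have hIf : ∫ y in (x₀ - q)..(x₀ + q), lineHeat t (x - y) • f y = ∫ y, lineHeat t (x - y) • f y := by
      rw [intervalIntegral.integral_of_le hle, ← MeasureTheory.integral_Icc_eq_integral_Ioc]
      refine MeasureTheory.setIntegral_eq_integral_of_forall_compl_eq_zero fun y hy => ?_
      rw [hsupp y, smul_zero]
      refine not_le.1 fun hy' => hy ?_
      rw [abs_le] at hy'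
      constructor <;> linarith [hy'.1, hy'.2]
    have hχf : χ x • f x = f x := by
      rcases le_or_gt |x - x₀| ρ with h' | h'
      · rw [hχ x h', one_smul]
      · rw [hsupp x h', smul_zero]
    have hsplit : (∫ y in (x₀ - q)..(x₀ + q), lineHeat t (x - y) • h t x y) =
        (∫ y in (x₀ - q)..(x₀ + q), lineHeat t (x - y) • (h t x y - f y)) +
          ∫ y, lineHeat t (x - y) • f y := by
      rw [← hIf, ← intervalIntegral.integral_add (f := fun y => lineHeat t (x - y) • (h t x y - f y))
        (g := fun y => lineHeat t (x - y) • f y)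
        ((hG.smul ((hh t ht x).sub hf.continuous)).intervalIntegrable _ _)
        ((hG.smul hf.continuous).intervalIntegrable _ _)]
      simp only [← smul_add, sub_add_cancel]
    have h1 : ‖∫ y in (x₀ - q)..(x₀ + q), lineHeat t (x - y) • (h t x y - f y)‖ ≤ C * t := by
      have h2 : ‖∫ y in (x₀ - q)..(x₀ + q), lineHeat t (x - y) • (h t x y - f y)‖ ≤
          ∫ y in (x₀ - q)..(x₀ + q), lineHeat t (x - y) * (C * t) := by
        refine intervalIntegral.norm_integral_le_of_norm_le hle
          (Eventually.of_forall fun y hy => ?_) ((hG.mul continuous_const).intervalIntegrable _ _)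
        rw [norm_smul, Real.norm_of_nonneg (lineHeat_nonneg ht _)]
        exact mul_le_mul_of_nonneg_left (hC t ht ht1 x y (hmem x hx) (hmem y ⟨hy.1.le, hy.2⟩))
          (lineHeat_nonneg ht _)
      rw [intervalIntegral.integral_mul_const] at h2
      exact h2.trans (mul_le_of_le_one_left (by positivity) hG1)
    have h3 := norm_integral_lineHeat_sub_le hf.continuous hfc hL' L.2 ht x
    rw [intervalIntegral.integral_smul, hsplit]
    calc _ = ‖χ x • ((∫ y in (x₀ - q)..(x₀ + q), lineHeat t (x - y) • (h t x y - f y)) +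
          ((∫ y, lineHeat t (x - y) • f y) - f x))‖ := by
          rw [norm_sub_rev, ← add_sub_assoc, smul_sub, hχf]
      _ ≤ 1 * ‖(∫ y in (x₀ - q)..(x₀ + q), lineHeat t (x - y) • (h t x y - f y)) +
          ((∫ y, lineHeat t (x - y) • f y) - f x)‖ := by
          rw [norm_smul]
          exact mul_le_mul_of_nonneg_right (hχ1 x) (norm_nonneg _)
      _ ≤ _ := by
          rw [one_mul]
          exact (norm_add_le _ _).trans (add_le_add h1 h3)
  have hlim : Tendsto (fun t : ℝ => C * t + 4 * L * Real.sqrt t) (𝓝[>] 0) (𝓝 0) := by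
    have hc : Continuous fun t : ℝ => C * t + 4 * L * Real.sqrt t := by fun_prop
    have := hc.tendsto 0
    simp only [mul_zero, Real.sqrt_zero, add_zero] at this
    exact this.mono_left nhdsWithin_le_nhds
  rw [Metric.tendstoUniformlyOn_iff]
  intro ε hε
  filter_upwards [hlim.eventually (gt_mem_nhds hε), self_mem_nhdsWithin,
    mem_nhdsWithin_of_mem_nhds (Iic_mem_nhds zero_lt_one)] with t ht ht0 ht1 x hx
  rw [dist_eq_norm]
  exact (hbound t ht0 ht1 x hx).trans_lt ht

section Parametrix

variable {R : Type*} [NormedRing R] [NormedAlgebra ℝ R] {V : ℝ → R} {e : ℕ → ℕ → ℝ → R}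

theorem exists_norm_parSum_sub_one_le (he : IsOffDiagJet V e) (x₀ q : ℝ) (n : ℕ) {l : ℕ}
    (hl : l ≠ 0) : ∃ C, 0 ≤ C ∧ ∀ t, 0 < t → t ≤ 1 → ∀ x y, |x - x₀| ≤ q → |y - x₀| ≤ q →
      ‖parSum e n l t x y - 1‖ ≤ C * t := by
  obtain ⟨C, hC, h⟩ := OffDiagBound.exists_bound_sum (x₀ := x₀) (q := q) n fun k _ =>
    offDiagBound_parPoly he x₀ q (k + 1) (2 * (l + (n - (k + 1))))
  refine ⟨C, hC, fun t ht ht1 x y hx hy => ?_⟩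
  have h1 : parSum e n l t x y - 1 = t • ∑ k ∈ Finset.range n,
      t ^ k • parPoly e (k + 1) (2 * (l + (n - (k + 1)))) x y := by
    rw [parSum, Finset.sum_range_succ', parPoly_zero he (by omega), pow_zero, one_smul,
      add_sub_cancel_right, Finset.smul_sum]
    refine Finset.sum_congr rfl fun k _ => ?_
    rw [smul_smul, ← pow_succ']
  rw [h1, norm_smul, Real.norm_of_nonneg ht.le, mul_comm]
  have h2 := h t x y ht ht1 hx hy
  rw [pow_zero, mul_one] at h2
  gcongr

theorem continuous_parSum (he : IsOffDiagJet V e) (n l : ℕ) (t x : ℝ) :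
    Continuous (parSum e n l t x) := by
  have h := continuous_parCoeff he
  unfold parSum parPoly
  fun_prop

theorem parSum_diag (n : ℕ) {l : ℕ} (hl : l ≠ 0) (t x : ℝ) : parSum e n l t x x =
    ∑ k ∈ Finset.range (n + 1), t ^ k • parCoeff e k 0 x :=
  Finset.sum_congr rfl fun k _ => by rw [parPoly_diag (by omega)]

end Parametrix

/-- A cutoff around `x₀` whose derivatives vanish to every order on the diagonal. -/
theorem exists_cutoff (x₀ : ℝ) {q : ℝ} (hq : 0 < q) (m : ℕ) : ∃ (χ : ℝ → ℝ) (A : ℝ),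
    ContDiff ℝ ∞ χ ∧ (∀ x, |χ x| ≤ 1) ∧ (∀ x, |x - x₀| ≤ q / 4 → χ x = 1) ∧
    (∀ x, 3 * q / 4 < |x - x₀| → χ x = 0) ∧ 0 ≤ A ∧
    (∀ x y, |x - x₀| ≤ q → |y - x₀| ≤ q / 4 → |deriv χ x| ≤ A * |x - y| ^ m) ∧
    ∀ x y, |x - x₀| ≤ q → |y - x₀| ≤ q / 4 → |deriv (deriv χ) x| ≤ A * |x - y| ^ m := by
  let b : ContDiffBump x₀ := ⟨q / 2, 3 * q / 4, by positivity, by linarith⟩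
  have hb : ContDiff ℝ ∞ (b : ℝ → ℝ) := b.contDiff
  have hd1 : ContDiff ℝ ∞ (deriv b) := by
    have := hb.iterate_deriv 1
    simpa using this
  have hd2 : ContDiff ℝ ∞ (deriv (deriv b)) := by
    have := hb.iterate_deriv 2
    simpa using this
  have hone : ∀ x, |x - x₀| < q / 2 → (b : ℝ → ℝ) =ᶠ[𝓝 x] fun _ => 1 := fun x hx =>
    b.eventuallyEq_one_of_mem_ball (by rwa [Metric.mem_ball, Real.dist_eq])
  have hz1 : ∀ x, |x - x₀| < q / 2 → deriv b =ᶠ[𝓝 x] fun _ => 0 := fun x hx => by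
    simpa using (hone x hx).deriv
  have hz2 : ∀ x, |x - x₀| < q / 2 → deriv (deriv b) x = 0 := fun x hx => by
    simpa using (hz1 x hx).deriv_eq
  -- Where the derivatives of the bump are nonzero, `|x-x₀| ≥ q/2`, so `|x-y| ≥ q/4`, and a bounded
  -- function is dominated by any power of `|x-y|`.
  have key : ∀ F : ℝ → ℝ, Continuous F → (∀ x, |x - x₀| < q / 2 → F x = 0) → ∃ A, 0 ≤ A ∧
      ∀ x y, |x - x₀| ≤ q → |y - x₀| ≤ q / 4 → |F x| ≤ A * |x - y| ^ m := by
    intro F hF hF0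
    obtain ⟨C, hC⟩ := (isCompact_Icc (a := x₀ - q) (b := x₀ + q)).exists_bound_of_continuousOn
      hF.continuousOn
    refine ⟨|C| / (q / 4) ^ m, by positivity, fun x y hx hy => ?_⟩
    rcases lt_or_ge |x - x₀| (q / 2) with h | h
    · rw [hF0 x h, abs_zero]; positivity
    · have hxy : q / 4 ≤ |x - y| := by
        have := abs_sub_le x y x₀
        linarith
      rw [abs_le] at hx
      calc |F x| ≤ |C| := (hC x ⟨by linarith [hx.1], by linarith [hx.2]⟩).trans (le_abs_self C)
        _ = |C| / (q / 4) ^ m * (q / 4) ^ m := by field_simp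
        _ ≤ _ := by gcongr
  obtain ⟨A₁, hA₁, h1⟩ := key _ hd1.continuous fun x hx => (hz1 x hx).eq_of_nhds
  obtain ⟨A₂, hA₂, h2⟩ := key _ hd2.continuous hz2
  refine ⟨b, A₁ + A₂, hb, fun x => abs_le.2 ⟨by linarith [b.nonneg (x := x)], b.le_one⟩,
    fun x hx => (hone x (by linarith)).eq_of_nhds, fun x hx => ?_, by positivity,
    fun x y hx hy => (h1 x y hx hy).trans ?_, fun x y hx hy => (h2 x y hx hy).trans ?_⟩
  · exact b.zero_of_le_dist (by rw [Real.dist_eq]; exact hx.le)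
  · gcongr; linarith
  · gcongr; linarith

/-! ### The parametrix of `-D² + Q` -/

section OffDiagJet

variable {N : ℕ} {Q : ℝ → EndFibre N}

theorem isOffDiagJet_evalAt (hQ : ContDiff ℝ ∞ Q) :
    IsOffDiagJet Q fun k m y => DiffPoly.evalAt Q y (DiffPoly.offDiag k m) where
  smooth := hQ
  continuous k m := (DiffPoly.contDiff_evalAt hQ _).continuous
  zero_zero y := by rw [DiffPoly.offDiag_zero_apply_zero, map_one]
  zero_succ m y := by simp [DiffPoly.offDiag]
  succ k m y := by
    have h : ((k : ℂ) + 1 + m) • DiffPoly.offDiag (k + 1) m =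
        ((k : ℂ) + 1) • DiffPoly.opLeft (DiffPoly.offDiag k) m := by
      simp only [DiffPoly.offDiag, smul_smul]
      congr 1
      have := DiffPoly.natCast_add_one_add_ne_zero k m
      field_simp
    have h' := congrArg (DiffPoly.evalAt Q y) h
    simp only [DiffPoly.opLeft, Pi.add_apply, Pi.neg_apply, DiffPoly.dLeft_apply,
      DiffPoly.mulLeft_apply, map_smul, map_add, map_neg, map_sum, map_mul,
      DiffPoly.evalAt_jet] at h'
    simp only [← Nat.cast_smul_eq_nsmul ℂ]
    push_cast
    exact h'

end OffDiagJet

/-! ### The diagonal expansion -/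

section Expansion

variable {E : Type*} [NormedAddCommGroup E] [NormedSpace ℝ E] {u : ℝ → E} {c c' : ℕ → E}

/-- `u t ∼ (4πt)^(-1/2) ∑ₖ (-t)ᵏ / k! · c k` as `t → 0+`. -/
def HasGaussianExpansion (u : ℝ → E) (c : ℕ → E) : Prop :=
  ∀ n : ℕ, (fun t : ℝ => u t - ((4 * Real.pi * t) ^ (-(1 / 2 : ℝ))) •
      ∑ k ∈ Finset.range n, ((-t) ^ k / (k ! : ℝ)) • c k)
    =O[𝓝[>] 0] fun t : ℝ => t ^ ((n : ℝ) - 1 / 2)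

theorem rpow_four_pi_mul {t : ℝ} (ht : 0 < t) (n : ℕ) : (4 * Real.pi * t) ^ (-(1 / 2 : ℝ)) * t ^ n =
    (4 * Real.pi) ^ (-(1 / 2 : ℝ)) * t ^ ((n : ℝ) - 1 / 2) := by
  rw [Real.mul_rpow (by positivity) ht.le, mul_assoc, ← Real.rpow_natCast t n, ← Real.rpow_add ht,
    neg_add_eq_sub]

/-- If the coefficients agree below `n`, subtracting the two expansions with `n + 1` terms leaves `K
‖c n - c' n‖ ≤ C t`, and `t → 0+`. -/
theorem HasGaussianExpansion.unique (h : HasGaussianExpansion u c) (h' : HasGaussianExpansion u c')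
    (k : ℕ) : c k = c' k := by
  induction k using Nat.strong_induction_on with
  | _ n ih =>
    have hs : ∀ t : ℝ, ∑ k ∈ Finset.range n, ((-t) ^ k / (k ! : ℝ)) • c k =
        ∑ k ∈ Finset.range n, ((-t) ^ k / (k ! : ℝ)) • c' k := fun t =>
      Finset.sum_congr rfl fun k hk => by rw [ih k (Finset.mem_range.1 hk)]
    obtain ⟨C, hC⟩ := ((h' (n + 1)).sub (h (n + 1))).bound
    set K : ℝ := (4 * Real.pi) ^ (-(1 / 2 : ℝ)) / n ! with hK
    have hKpos : 0 < K := by positivity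
    have hev : ∀ᶠ t : ℝ in 𝓝[>] 0, K * ‖c n - c' n‖ ≤ C * t := by
      filter_upwards [hC, self_mem_nhdsWithin] with t hCt (ht : 0 < t)
      have hpos : 0 < t ^ ((n : ℝ) - 1 / 2) := Real.rpow_pos_of_pos ht _
      have h1 : u t - (4 * Real.pi * t) ^ (-(1 / 2 : ℝ)) •
            ∑ k ∈ Finset.range (n + 1), ((-t) ^ k / (k ! : ℝ)) • c' k -
          (u t - (4 * Real.pi * t) ^ (-(1 / 2 : ℝ)) •
            ∑ k ∈ Finset.range (n + 1), ((-t) ^ k / (k ! : ℝ)) • c k) =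
          ((-1 : ℝ) ^ n * (K * t ^ ((n : ℝ) - 1 / 2))) • (c n - c' n) := by
        have h2 : (-1 : ℝ) ^ n * (K * t ^ ((n : ℝ) - 1 / 2)) =
            (4 * Real.pi * t) ^ (-(1 / 2 : ℝ)) * ((-t) ^ n / (n ! : ℝ)) := by
          rw [neg_pow t, hK, div_mul_eq_mul_div, ← rpow_four_pi_mul ht]
          ring
        rw [Finset.sum_range_succ, Finset.sum_range_succ, hs, h2]
        module
      rw [h1, norm_smul, norm_mul, norm_pow, norm_neg, norm_one, one_pow, one_mul,
        Real.norm_of_nonneg (by positivity), Real.norm_of_nonneg (by positivity)] at hCt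
      have h3 : t ^ (((n + 1 : ℕ) : ℝ) - 1 / 2) = t * t ^ ((n : ℝ) - 1 / 2) := by
        rw [mul_comm, ← Real.rpow_add_one ht.ne']
        congr 1; push_cast; ring
      rw [h3] at hCt
      refine le_of_mul_le_mul_right ?_ hpos
      linarith
    have hlim : Tendsto (fun t : ℝ => C * t) (𝓝[>] 0) (𝓝 0) := by
      have h4 : Continuous fun t : ℝ => C * t := by fun_prop
      have := h4.tendsto 0
      rw [mul_zero] at this
      exact this.mono_left nhdsWithin_le_nhds
    have h5 : K * ‖c n - c' n‖ ≤ 0 := ge_of_tendsto hlim hev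
    have h6 : ‖c n - c' n‖ = 0 :=
      le_antisymm (nonpos_of_mul_nonpos_right h5 hKpos) (norm_nonneg _)
    exact sub_eq_zero.1 (norm_eq_zero.1 h6)

/-- An expansion may be checked with surplus terms. -/
theorem hasGaussianExpansion_of_bound (h : ∀ n : ℕ, ∃ C, ∀ t : ℝ, 0 < t → t ≤ 1 →
      ‖u t - (4 * Real.pi * t) ^ (-(1 / 2 : ℝ)) •
        ∑ k ∈ Finset.range (n + 2), ((-t) ^ k / (k ! : ℝ)) • c k‖ ≤ C * t ^ n) :
    HasGaussianExpansion u c := by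
  intro n
  obtain ⟨C, hC⟩ := h n
  set K : ℝ := (4 * Real.pi) ^ (-(1 / 2 : ℝ)) with hK
  refine IsBigO.of_bound (|C| + K * ‖c n‖ + K * ‖c (n + 1)‖) ?_
  filter_upwards [self_mem_nhdsWithin, mem_nhdsWithin_of_mem_nhds (Iic_mem_nhds zero_lt_one)]
    with t (ht : 0 < t) (ht1 : t ≤ 1)
  have hpos : 0 < t ^ ((n : ℝ) - 1 / 2) := Real.rpow_pos_of_pos ht _
  have hterm : ∀ k, n ≤ k → ‖((4 * Real.pi * t) ^ (-(1 / 2 : ℝ)) * ((-t) ^ k / (k ! : ℝ))) • c k‖ ≤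
      K * ‖c k‖ * t ^ ((n : ℝ) - 1 / 2) := by
    intro k hk
    rw [norm_smul, norm_mul, norm_div, norm_pow, norm_neg, Real.norm_of_nonneg ht.le,
      Real.norm_of_nonneg (by positivity), Real.norm_natCast]
    have h1 : (1 : ℝ) ≤ (k ! : ℝ) := by exact_mod_cast k.factorial_pos
    calc (4 * Real.pi * t) ^ (-(1 / 2 : ℝ)) * (t ^ k / (k ! : ℝ)) * ‖c k‖
        ≤ (4 * Real.pi * t) ^ (-(1 / 2 : ℝ)) * t ^ n * ‖c k‖ := by
          gcongr
          exact (div_le_self (by positivity) h1).trans (pow_le_pow_of_le_one ht.le ht1 hk)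
      _ = _ := by rw [rpow_four_pi_mul ht]; ring
  -- The error `O(tⁿ)` is better than the required `O(t^(n-1/2))`, which the two surplus terms also
  -- satisfy.
  have hCt : C * t ^ n ≤ |C| * t ^ ((n : ℝ) - 1 / 2) := by
    have h2 : t ^ n ≤ t ^ ((n : ℝ) - 1 / 2) := by
      rw [← Real.rpow_natCast]
      exact Real.rpow_le_rpow_of_exponent_ge ht ht1 (by linarith)
    calc C * t ^ n ≤ |C| * t ^ n := by gcongr; exact le_abs_self C
      _ ≤ _ := by gcongr
  have hsplit : u t - (4 * Real.pi * t) ^ (-(1 / 2 : ℝ)) •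
        ∑ k ∈ Finset.range n, ((-t) ^ k / (k ! : ℝ)) • c k =
      u t - (4 * Real.pi * t) ^ (-(1 / 2 : ℝ)) •
        ∑ k ∈ Finset.range (n + 2), ((-t) ^ k / (k ! : ℝ)) • c k +
      ((4 * Real.pi * t) ^ (-(1 / 2 : ℝ)) * ((-t) ^ n / (n ! : ℝ))) • c n +
      ((4 * Real.pi * t) ^ (-(1 / 2 : ℝ)) * ((-t) ^ (n + 1) / ((n + 1)! : ℝ))) • c (n + 1) := by
    rw [Finset.sum_range_succ _ (n + 1), Finset.sum_range_succ _ n]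
    module
  rw [hsplit, Real.norm_of_nonneg hpos.le]
  calc _ ≤ |C| * t ^ ((n : ℝ) - 1 / 2) + K * ‖c n‖ * t ^ ((n : ℝ) - 1 / 2) +
        K * ‖c (n + 1)‖ * t ^ ((n : ℝ) - 1 / 2) :=
        (norm_add_le _ _).trans (add_le_add ((norm_add_le _ _).trans
          (add_le_add ((hC t ht ht1).trans hCt) (hterm n le_rfl))) (hterm (n + 1) n.le_succ))
    _ = _ := by ring

theorem parametrix_diag {R : Type*} [NormedRing R] [NormedAlgebra ℝ R] {χ : ℝ → ℝ} {x₀ : ℝ}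
    (hχ : χ x₀ = 1) (e : ℕ → ℕ → ℝ → R) (n : ℕ) {l : ℕ} (hl : l ≠ 0) (t : ℝ) :
    parametrix χ e n l t x₀ x₀ = (4 * Real.pi * t) ^ (-(1 / 2 : ℝ)) •
      ∑ k ∈ Finset.range (n + 1), ((-t) ^ k / (k ! : ℝ)) • e k 0 x₀ := by
  have h1 : lineHeat t (x₀ - x₀) = (4 * Real.pi * t) ^ (-(1 / 2 : ℝ)) := by simp [lineHeat]
  rw [parametrix, hχ, one_smul, h1, parSum_diag n hl]
  congr 1
  refine Finset.sum_congr rfl fun k _ => ?_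
  rw [parCoeff, smul_smul, neg_pow t, Nat.factorial_zero, Nat.cast_one, mul_one]
  congr 1
  ring

end Expansion

/-! ### The parametrix as an approximate heat kernel, and the diagonal expansion -/

section HeatKernel

variable {a : ℝ} {N : ℕ} {g : EndFibre N} {Q : ℝ → EndFibre N} {U : ℝ → ℝ → ℝ → EndFibre N}

theorem exists_isApproxHeatKernel (hQ : ContDiff ℝ ∞ Q) (x₀ : ℝ) {q : ℝ} (hq : 0 < q) (n : ℕ) :
    ∃ C, 0 ≤ C ∧ ∃ χ : ℝ → ℝ, χ x₀ = 1 ∧ ∃ Ht Hx Hxx,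
      IsApproxHeatKernel Q x₀ q (q / 4) (3 * q / 4) C n (parametrix χ
        (fun k m y => DiffPoly.evalAt Q y (DiffPoly.offDiag k m)) (n + 1) (n + 2)) Ht Hx Hxx := by
  have he := isOffDiagJet_evalAt hQ
  set e : ℕ → ℕ → ℝ → EndFibre N := fun k m y => DiffPoly.evalAt Q y (DiffPoly.offDiag k m)
  obtain ⟨χ, A, hχ, hχ1, hχone, hχzero, hA, hχ', hχ''⟩ := exists_cutoff x₀ hq (2 * (n + 2))
  obtain ⟨Ht, Hx, Hxx, hreg, C, hC, hres⟩ :=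
    exists_parametrix_residual he hχ hχ1 (by linarith : q / 4 ≤ q) n hA hχ' hχ''
  refine ⟨C, hC, χ, hχone x₀ (by simp; positivity), Ht, Hx, Hxx, hreg, ?_, hres, ?_⟩
  · intro t _ x y hx
    rw [parametrix, hχzero x hx]
    exact zero_smul ℝ _
  · intro f hf hsupp
    obtain ⟨CP, hCP, hP⟩ := exists_norm_parSum_sub_one_le he x₀ q (n + 1) (l := n + 2) (by omega)
    obtain ⟨B, hB⟩ := (isCompact_Icc (a := x₀ - q) (b := x₀ + q)).exists_bound_of_continuousOn
      hf.continuous.continuousOn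
    refine tendstoUniformlyOn_lineHeat hf (by linarith : q / 4 ≤ q) hq.le hsupp hχ1 hχone
      (h := fun t x y => parSum e (n + 1) (n + 2) t x y (f y)) (C := CP * |B|)
      (fun t _ x => (continuous_parSum he _ _ t x).clm_apply hf.continuous)
      fun t ht ht1 x y hx hy => ?_
    have h1 : parSum e (n + 1) (n + 2) t x y (f y) - f y =
      (parSum e (n + 1) (n + 2) t x y - 1) (f y) := rfl
    have hy' : y ∈ Icc (x₀ - q) (x₀ + q) := by
      rw [abs_le] at hy
      exact ⟨by linarith [hy.1], by linarith [hy.2]⟩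
    rw [h1]
    calc _ ≤ ‖parSum e (n + 1) (n + 2) t x y - 1‖ * ‖f y‖ := ContinuousLinearMap.le_opNorm _ _
      _ ≤ CP * t * |B| := by
          gcongr
          · exact hP t ht ht1 x y hx hy
          · exact (hB y hy').trans (le_abs_self B)
      _ = _ := by ring

/-- The parametrix with parameter `n + 1` has `n + 2` terms on the diagonal, as
`hasGaussianExpansion_of_bound` requires. The comparison takes place on the interval of length `2πa`
centred at `x`, where `Q` is bounded. -/
theorem hasDiagonalExpansion_diagCoeff (ha : 0 < a) (hg : g ∈ unitary (EndFibre N))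
    (hQ : IsPotential a g Q) (hU : IsHeatKernel a g Q U) (x : ℝ) :
    HasGaussianExpansion (fun t => U t x x) fun k => DiffPoly.evalAt Q x (DiffPoly.diagCoeff k) := by
  refine hasGaussianExpansion_of_bound fun n => ?_
  have hq : 0 < Real.pi * a := by positivity
  obtain ⟨K, hK⟩ := (isCompact_Icc (a := x - Real.pi * a)
    (b := x + Real.pi * a)).exists_bound_of_continuousOn hQ.smooth.continuous.continuousOn
  have hK' : ∀ y, |y - x| ≤ Real.pi * a → ‖Q y‖ ≤ |K| := fun y hy => by
    rw [abs_le] at hy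
    exact (hK y ⟨by linarith [hy.1], by linarith [hy.2]⟩).trans (le_abs_self K)
  obtain ⟨C, hC, χ, hχ, Ht, Hx, Hxx, hH⟩ := exists_isApproxHeatKernel hQ.smooth x hq n
  refine ⟨C * Real.exp |K|, fun t ht ht1 => ?_⟩
  have h := norm_diagonal_compare_le ha hg hU (by positivity) (by linarith) (by linarith) hC
    (abs_nonneg K) hK' hH ht ht1
  rw [parametrix_diag hχ _ _ (by omega)] at h
  calc _ ≤ C * t ^ n * t * Real.exp (|K| * t) := h
    _ ≤ C * t ^ n * 1 * Real.exp (|K| * 1) := by gcongr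
    _ = _ := by rw [mul_one, mul_one]; ring

theorem hasDiagonalExpansion_iff (ha : 0 < a) (hg : g ∈ unitary (EndFibre N))
    (hQ : IsPotential a g Q) (hU : IsHeatKernel a g Q U) (x : ℝ) (c : ℕ → EndFibre N) :
    HasDiagonalExpansion U x c ↔ ∀ k, c k = DiffPoly.evalAt Q x (DiffPoly.diagCoeff k) := by
  have h := hasDiagonalExpansion_diagCoeff ha hg hQ hU x
  constructor
  · intro hc
    exact HasGaussianExpansion.unique (u := fun t => U t x x) hc h
  · intro hc
    rw [funext hc]
    exact h

end HeatKernel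

/-! ### Assembly of the theorem -/

theorem mainTheorem3 :
    -- the universal differential polynomials `α k = [a_k]`
    ∃ α : ℕ → DiffPoly,
      -- they give the diagonal heat kernel coefficients of every operator `L = -D² + Q`
      (∀ (a : ℝ) (_ : 0 < a) (N : ℕ) (g : EndFibre N) (_ : g ∈ unitary (EndFibre N))
        (Q : ℝ → EndFibre N) (_ : IsPotential a g Q)
        (U : ℝ → ℝ → ℝ → EndFibre N) (_ : IsHeatKernel a g Q U)
        (x : ℝ) (c : ℕ → EndFibre N),
        HasDiagonalExpansion U x c ↔ ∀ k, c k = DiffPoly.evalAt Q x (α k)) ∧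
      α 0 = 1 ∧
      -- the recursion and the closed formula, for differential polynomials
      (∀ k : ℕ, 1 ≤ k →
        DiffPoly.InDomainA (α (k - 1)) ∧
        DiffPoly.D (α k) = (-((k : ℂ) / (2 * (2 * k - 1)))) • DiffPoly.E (α (k - 1)) ∧
        α k = ((k : ℂ) / (2 * (2 * k - 1))) • DiffPoly.A (α (k - 1)) ∧
        DiffPoly.InDomainA (DiffPoly.A^[k - 1] DiffPoly.Q) ∧
        α k = (((k ! : ℂ) * ((k - 1)! : ℂ)) / ((2 * k - 1)! : ℂ)) •
          DiffPoly.A^[k - 1] DiffPoly.Q) ∧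
      -- the recursion for the functions `x ↦ [a_k](x)`, with `w` as `D⁻¹ Ad_Q [a_{k-1}]`
      (∀ (a : ℝ) (_ : 0 < a) (N : ℕ) (g : EndFibre N) (_ : g ∈ unitary (EndFibre N))
        (Q : ℝ → EndFibre N) (_ : IsPotential a g Q) (k : ℕ) (_ : 1 ≤ k)
        (b b' w : ℝ → EndFibre N)
        (_ : b = fun x => DiffPoly.evalAt Q x (α k))
        (_ : b' = fun x => DiffPoly.evalAt Q x (α (k - 1)))
        (_ : w = fun x => DiffPoly.evalAt Q x (DiffPoly.Dinv ⁅DiffPoly.Q, α (k - 1)⁆)),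
        ContDiff ℝ ∞ b ∧ ContDiff ℝ ∞ b' ∧ ContDiff ℝ ∞ w ∧
        (∀ x, deriv w x = ⁅Q x, b' x⁆) ∧
        deriv b = (-((k : ℂ) / (2 * (2 * k - 1)))) • opE deriv Q b' w) := by
  -- Index shift: the lemmas are stated for `k + 1`, the theorem for `k ≥ 1`.
  have hcast : ∀ k : ℕ, ((k + 1 : ℕ) : ℂ) / (2 * (2 * ((k + 1 : ℕ) : ℂ) - 1)) =
      ((k : ℂ) + 1) / (2 * (2 * k + 1)) := fun k => by
    push_cast
    congr 2
    ring
  refine ⟨DiffPoly.diagCoeff, fun a ha N g hg Q hQ U hU x c =>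
    hasDiagonalExpansion_iff ha hg hQ hU x c, DiffPoly.offDiag_zero_apply_zero, ?_, ?_⟩
  · intro k hk
    obtain ⟨k, rfl⟩ := Nat.exists_eq_add_of_le' hk
    rw [Nat.add_sub_cancel, hcast, show 2 * (k + 1) - 1 = 2 * k + 1 by omega]
    exact ⟨DiffPoly.inDomainA_diagCoeff k, DiffPoly.D_diagCoeff k, DiffPoly.diagCoeff_succ k,
      DiffPoly.inDomainA_iterate k, DiffPoly.diagCoeff_eq_iterate k⟩
  · intro a _ N g _ Q hQ k hk b b' w hb hb' hw
    obtain ⟨k, rfl⟩ := Nat.exists_eq_add_of_le' hk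
    rw [Nat.add_sub_cancel] at hb' hw
    subst hb hb' hw
    rw [hcast]
    exact ⟨DiffPoly.contDiff_evalAt hQ.smooth _, DiffPoly.contDiff_evalAt hQ.smooth _,
      DiffPoly.contDiff_evalAt hQ.smooth _, DiffPoly.deriv_evalAt_Dinv hQ.smooth k,
      DiffPoly.function_recursion hQ.smooth k⟩
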